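/- Let $N\ge 1$, and let $\alpha_1,\dots,\alpha_N$ be signed planar angles (indices modulo $N$, $\alpha_n=\alpha_{n,n+1}$ being the angle from fold $n$ to fold $n+1$) with $0<|\alpha_n|<\pi$ for all $n$ and $\sum_n\alpha_n=2\pi w$ for an integer $w$ (the winding). Let $L_1,\dots,L_N>0$ be the fold lengths. Let $f$ be the number of forward-tracks ($\alpha_n>0$) and $b$ the number of back-tracks ($\alpha_n<0$). The unfolded state $U$ of the origami vertex has its hub $U_0$ at the origin and the end of fold $n$ at $U_n=L_n(\cos\theta_n,\sin\theta_n,0)$ with $\theta_n=\sum_{k<n}\alpha_k$. Its configuration space $\mathcal C$ is the set of all $(X_0,\dots,X_N)\in(\mathbb R^3)^{N+1}$ with $|X_n-X_0|=|U_n-U_0|$ and $|X_n-X_{n+1}|=|U_n-U_{n+1}|$ for $n=1,\dots,N$. Let $\mathcal C_0\subset\mathcal C$ be the configuration space with the in-plane rigid motions removed: $X_0$ lies on the $z$-axis and $X_1$ lies in the $xz$-plane. On the heights $h=(h_0,\dots,h_N)\in\mathbb R^{N+1}$ consider the quadratic form $$Q(h)=\sum_{n=1}^N\left(2g_{n,n+1}h_nh_{n+1}+f_nh_n^2+2A_nh_0h_n\right)-h_0^2\sum_{n=1}^N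 A_n,$$ where $f_n=(\cot\alpha_{n}+\cot\alpha_{n-1})/L_n^2$, $g_{n,n+1}=-\csc\alpha_{n}/(L_nL_{n+1})$ and $A_n=-f_n-g_{n,n+1}-g_{n-1,n}$. (1) $Q$ has nullity $3$ and signature $(f-2w-1,\;b+2w-1)$ (numbers of positive and of negative eigenvalues). (2) The germ of $\mathcal C_0$ at $U$ is isomorphic, as a real-analytic germ of sets, to the germ at $0$ of the null-cone $\{Q=0\}\subset\mathbb R^{N+1}$; and the germ of $\mathcal C$ at $U$ is isomorphic to the germ at $0$ of $\{Q=0\}\times\mathbb R^3$. (3) In the ordinary case (all $\alpha_n>0$ and $w=1$), the matrix of $Q$ has exactly one negative eigenvalue, with an eigenvector $v$ that can be scaled so that in suitable linear coordinates $(r,t,y)\in\mathbb R^3\times\mathbb R\times\mathbb R^{N-3}$ with $t=v\cdot h$ one has $Q=|y|^2-t^2$, so that the null-cone is a double cone (times $\mathbb R^3$). The isomorphism $\varphi$ of the germ of $\mathcal C_0$ with that of the null-cone in (2) and the vector $v$ can be chosen such that for all $X\in\mathcal C_0$ sufficiently close to $U$: $X$ is popped up if and only if $v\cdot\varphi(X)>0$,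 popped down if and only if $v\cdot\varphi(X)<0$, and unfolded (planar) if and only if $v\cdot\varphi(X)=0$. Here the trace of $X$ is the spherical polygon cut out by the origami on a small sphere about the hub, scaled to the unit sphere; it cuts the sphere into an upper piece (the one containing the upward vertical direction) and a lower piece, and $X$ is popped down if the upper piece has area less than $2\pi$ and popped up if the lower piece has area less than $2\pi$. -/

import Mathlib

open MeasureTheory Filter Topology Matrix

noncomputable section

namespace Origami

/-- Three-dimensional Euclidean space. -/
abbrev Space : Type := EuclideanSpace ℝ (Fin 3)

/-- The vertices of a wheel with `N` spokes: the hub is `none`, the outer end of the `n`-th fold is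
`some n`. The index `n : Fin N` is cyclic: `n + 1` and `n - 1` are taken modulo `N`. -/
abbrev Vertex (N : ℕ) : Type := Option (Fin N)

/-- Positions in space of the vertices of the wheel. -/
abbrev Placement (N : ℕ) : Type := Vertex N → Space

/-- Vertical displacements (heights) of the vertices of the wheel. -/
abbrev Heights (N : ℕ) : Type := Vertex N → ℝ

section Wheel

variable {N : ℕ} [NeZero N] (α L : Fin N → ℝ)

/-- The polar angle of the `n`-th fold in the plane, the fold `0` pointing along the first axis;
`α n` is the signed planar angle from fold `n` to fold `n + 1`. -/
def polarAngle (n : Fin N) : ℝ := ∑ k ∈ Finset.Iio n, α k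

/-- The unfolded state: hub at the origin, everything in the horizontal plane, the `n`-th fold of
length `L n` and polar angle `polarAngle α n`. -/
def flatState : Placement N
  | none => 0
  | some n => !₂[L n * Real.cos (polarAngle α n), L n * Real.sin (polarAngle α n), 0]

/-- The configuration space: all placements in which every fold (hub to `n`) and every outer edge
(`n` to `n + 1`) has the length it has in the unfolded state. -/
def configSpace : Set (Placement N) :=
  {X | (∀ n : Fin N, dist (X (some n)) (X none) =
          dist (flatState α L (some n)) (flatState α L none)) ∧
       (∀ n : Fin N, dist (X (some n)) (X (some (n + 1))) =
          dist (flatState α L (some n)) (flatState α L (some (n + 1))))}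

/-- The configuration space with the in-plane rigid motions removed: the hub stays on the vertical
axis, and fold `0` stays in the vertical plane spanned by the first and the third axis. -/
def reducedConfigSpace : Set (Placement N) :=
  {X | X ∈ configSpace α L ∧ X none 0 = 0 ∧ X none 1 = 0 ∧ X (some 0) 1 = 0}

/-- The diagonal coefficient `f_n`. -/
def diagCoeff (n : Fin N) : ℝ := (Real.cot (α n) + Real.cot (α (n - 1))) / L n ^ 2

/-- The coefficient `g_{n,n+1}`. -/
def rimCoeff (n : Fin N) : ℝ := -(1 / Real.sin (α n)) / (L n * L (n + 1))

/-- The coefficient `A_n` that couples the hub to the end of fold `n`. -/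
def hubCoeff (n : Fin N) : ℝ := -diagCoeff α L n - rimCoeff α L n - rimCoeff α L (n - 1)

/-- The stress matrix of the vertex, the symmetric matrix of the quadratic form
`∑ n, (2 g_{n,n+1} h_n h_{n+1} + f_n h_n ^ 2 + 2 A_n h_0 h_n) - h_0 ^ 2 ∑ n, A_n`
(here `h_0` is the height of the hub). -/
def stressMatrix : Matrix (Vertex N) (Vertex N) ℝ
  | none, none => -∑ n, hubCoeff α L n
  | none, some n => hubCoeff α L n
  | some n, none => hubCoeff α L n
  | some m, some n => (if m = n then diagCoeff α L n else 0) +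
      (if n = m + 1 then rimCoeff α L m else 0) + (if m = n + 1 then rimCoeff α L n else 0)

theorem stressMatrix_isHermitian : (stressMatrix α L).IsHermitian := by
  ext i j
  rcases i with _ | m <;> rcases j with _ | n <;> simp only [conjTranspose_apply, star_trivial]
  · rfl
  · rfl
  · by_cases h : m = n
    · subst h; rfl
    · have h' : ¬ n = m := fun e => h e.symm
      simp only [stressMatrix, h, h', if_false]
      ring

/-- The quadratic form of the stress matrix on the heights. -/
def stressForm : QuadraticForm ℝ (Heights N) :=
  (stressMatrix α L).toQuadraticForm'

end Wheel

/-- The null-cone of a quadratic form. -/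
def nullCone {E : Type*} [AddCommGroup E] [Module ℝ E] (Q : QuadraticForm ℝ E) : Set E :=
  {x | Q x = 0}

/-- `φ` and `ψ` represent mutually inverse real-analytic isomorphisms between the germ of the set
`A` at `a` and the germ of the set `B` at `b`. -/
structure IsGermIso {E F : Type*} [NormedAddCommGroup E] [NormedSpace ℝ E]
    [NormedAddCommGroup F] [NormedSpace ℝ F]
    (A : Set E) (a : E) (B : Set F) (b : F) (φ : E → F) (ψ : F → E) : Prop where
  mem_left : a ∈ A
  mem_right : b ∈ B
  analyticAt_toFun : AnalyticAt ℝ φ a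
  analyticAt_invFun : AnalyticAt ℝ ψ b
  map_base : φ a = b
  inv_base : ψ b = a
  mapsTo : ∀ᶠ x in 𝓝[A] a, φ x ∈ B
  inv_mapsTo : ∀ᶠ y in 𝓝[B] b, ψ y ∈ A
  left_inv : ∀ᶠ x in 𝓝[A] a, ψ (φ x) = x
  right_inv : ∀ᶠ y in 𝓝[B] b, φ (ψ y) = y

/-- The unit sphere in space. -/
abbrev UnitSphere : Type := Metric.sphere (0 : Space) 1

/-- The upward vertical direction, as a point of the unit sphere. -/
def northPole : UnitSphere := ⟨EuclideanSpace.single 2 1, by simp⟩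

/-- The downward vertical direction, as a point of the unit sphere. -/
def southPole : UnitSphere := ⟨-EuclideanSpace.single 2 1, by simp⟩

/-- The trace of a placement: the spherical polygon of all directions in which the faces of the
origami leave the hub, that is, the intersection of the origami with a small sphere about the hub,
rescaled to the unit sphere. -/
def vertexTrace {N : ℕ} [NeZero N] (X : Placement N) : Set UnitSphere :=
  {u | ∃ n : Fin N, ∃ s t : ℝ, 0 ≤ s ∧ 0 ≤ t ∧
    (u : Space) = s • (X (some n) - X none) + t • (X (some (n + 1)) - X none)}

/-- The piece of the unit sphere cut out by the trace on the upper side of the origami. (Used for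
placements near the unfolded state, whose trace is close to the equator.) -/
def upperPiece {N : ℕ} [NeZero N] (X : Placement N) : Set UnitSphere :=
  connectedComponentIn (vertexTrace X)ᶜ northPole

/-- The piece of the unit sphere cut out by the trace on the lower side of the origami. -/
def lowerPiece {N : ℕ} [NeZero N] (X : Placement N) : Set UnitSphere :=
  connectedComponentIn (vertexTrace X)ᶜ southPole

/-- The surface area on the unit sphere (of total mass `4 π`). -/
def area : Measure UnitSphere := (volume : Measure Space).toSphere

/-- The vertex is popped down: the piece on the upper side has area less than `2 π`. -/
def PoppedDown {N : ℕ} [NeZero N] (X : Placement N) : Prop :=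
  area (upperPiece X) < ENNReal.ofReal (2 * Real.pi)

/-- The vertex is popped up: the piece on the lower side has area less than `2 π`. -/
def PoppedUp {N : ℕ} [NeZero N] (X : Placement N) : Prop :=
  area (lowerPiece X) < ENNReal.ofReal (2 * Real.pi)

/-- The placement is unfolded: it lies in a plane. (For the configurations near an unfolded state
without back-tracks this says that all dihedral angles are `π`.) -/
def Unfolded {N : ℕ} (X : Placement N) : Prop := Coplanar ℝ (Set.range X)

end Origami

end

set_option maxSynthPendingDepth 3
set_option linter.unusedSectionVars false

open MeasureTheory Filter Topology Matrix
open scoped Pointwise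

noncomputable section

namespace Origami

/-! ### Composition, products and inverses of analytic germ isomorphisms -/

namespace IsGermIso

variable {E F G E' F' : Type*} [NormedAddCommGroup E] [NormedSpace ℝ E]
  [NormedAddCommGroup F] [NormedSpace ℝ F] [NormedAddCommGroup G] [NormedSpace ℝ G]
  [NormedAddCommGroup E'] [NormedSpace ℝ E'] [NormedAddCommGroup F'] [NormedSpace ℝ F']
  {A : Set E} {a : E} {B : Set F} {b : F} {C : Set G} {c : G}
  {A' : Set E'} {a' : E'} {B' : Set F'} {b' : F'}

/-! Write u_n for the unit vector along fold n. By the law of cosines, a configuration is a closed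
chain of unit vectors with u_n · u_{n+1} = cos α_n (`mem_configSpace_iff`). Take the face between
folds 0 and 1 as reference plane and let z_n be the component of u_n along its normal, so that z_0 =
z_1 = 0. Near U the z_n determine the turn β_n(z) between the projections of u_n and u_{n+1} to this
plane, and the chain closes up exactly when ∑ β_n(z) = 2πw. So the reduced configuration space is
locally given by this single equation on the z_n, times an ℝ³ that records the height of the hub and
the tilt of the reference face (`isGermIso_reducedChart`).

The closing defect is exactly quadratic with variable coefficients: -2(∑ β_n(z) - ∑ α_n) = S_z(z,
z), where S_z is symmetric, analytic in z, and S_0 is the stress form written in slopes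
(`angleForm_self`, `angleForm_zero`). The radical of Q consists of the affine functions of the
position in the plane, and the slopes vanishing on folds 0 and 1 are a complement of the linear
ones, so S_0 is nondegenerate on them. The Morse lemma (`exists_morse_chart`) then turns S_z(z, z) =
0 into S_0(y, y) = 0 by a map tangent to the identity. The affine functions supply the ℝ³ factor of
the null-cone. In-plane rigid motions split off separately (`isGermIso_planarNormalize`).

For the signature, choose a direction φ to which no fold is parallel and divide the slopes by
sin(θ_n - φ), itself a slope vector in the radical. This turns Q into a weighted sum of squares ∑
c_n (y_{n+1} - y_n)² (`slopeForm_refSin_mul`). Counting half turns shows that f - 2w of the weights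
are positive (`card_edgeWeight_pos`). The only relation between the increments is that their sum
vanishes, so there are definite subspaces of dimensions f - 2w - 1 and b + 2w - 1. Together with the
three-dimensional space of affine functions in the radical they exhaust the dimension N + 1, so all
three bounds are equalities.

In the ordinary case the folds go once around the hub and the trace is the graph of a positively
homogeneous, piecewise linear height function. Comparing volumes of solid cones, the vertex is
popped up or down according to the sign of the integral of this height over the unit disc, truncated
to the ball (`popped_iff`). A linear part of the height does not contribute, by oddness, so to first
order the integral is a third of ∑ tan(α_n/2)(z_n + z_{n+1}). That sum is minus the product, in the
stress form, of z with the slopes of a pyramid, all equal to 1 (`discMoment_eq`). The pyramid is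
time-like, and on a Lorentzian null-cone the product with a time-like vector has a sign determined
by the time coordinate t and is at least a constant times |t|. Since the norm on the cone is also
bounded by a constant times |t|, the higher-order errors cannot change this sign
(`eventually_popped_iff`). -/

theorem tendsto_toFun {φ : E → F} {ψ : F → E} (h : IsGermIso A a B b φ ψ) :
    Tendsto φ (𝓝[A] a) (𝓝[B] b) := by
  refine tendsto_nhdsWithin_iff.2 ⟨?_, h.mapsTo⟩
  have := h.analyticAt_toFun.continuousAt.tendsto
  rw [h.map_base] at this
  exact this.mono_left nhdsWithin_le_nhds

theorem symm {φ : E → F} {ψ : F → E} (h : IsGermIso A a B b φ ψ) :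
    IsGermIso B b A a ψ φ :=
  ⟨h.mem_right, h.mem_left, h.analyticAt_invFun, h.analyticAt_toFun, h.inv_base, h.map_base,
    h.inv_mapsTo, h.mapsTo, h.right_inv, h.left_inv⟩

theorem trans {φ : E → F} {ψ : F → E} {φ' : F → G} {ψ' : G → F}
    (h : IsGermIso A a B b φ ψ) (h' : IsGermIso B b C c φ' ψ') :
    IsGermIso A a C c (φ' ∘ φ) (ψ ∘ ψ') where
  mem_left := h.mem_left
  mem_right := h'.mem_right
  analyticAt_toFun := by
    refine AnalyticAt.comp ?_ h.analyticAt_toFun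
    rw [h.map_base]; exact h'.analyticAt_toFun
  analyticAt_invFun := by
    refine AnalyticAt.comp ?_ h'.analyticAt_invFun
    rw [h'.inv_base]; exact h.analyticAt_invFun
  map_base := by simp [h.map_base, h'.map_base]
  inv_base := by simp [h.inv_base, h'.inv_base]
  mapsTo := h.tendsto_toFun.eventually h'.mapsTo
  inv_mapsTo := h'.symm.tendsto_toFun.eventually h.inv_mapsTo
  left_inv := by
    filter_upwards [h.left_inv, h.tendsto_toFun.eventually h'.left_inv] with x h1 h2
    simp only [Function.comp_apply, h2, h1]
  right_inv := by
    filter_upwards [h'.right_inv, h'.symm.tendsto_toFun.eventually h.right_inv] with x h1 h2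
    simp only [Function.comp_apply, h2, h1]

theorem refl (ha : a ∈ A) : IsGermIso A a A a id id where
  mem_left := ha
  mem_right := ha
  analyticAt_toFun := analyticAt_id
  analyticAt_invFun := analyticAt_id
  map_base := rfl
  inv_base := rfl
  mapsTo := eventually_mem_nhdsWithin
  inv_mapsTo := eventually_mem_nhdsWithin
  left_inv := Eventually.of_forall fun _ => rfl
  right_inv := Eventually.of_forall fun _ => rfl

theorem prodMap {φ : E → F} {ψ : F → E} {φ' : E' → F'} {ψ' : F' → E'}
    (h : IsGermIso A a B b φ ψ) (h' : IsGermIso A' a' B' b' φ' ψ') :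
    IsGermIso (A ×ˢ A') (a, a') (B ×ˢ B') (b, b') (Prod.map φ φ') (Prod.map ψ ψ') where
  mem_left := ⟨h.mem_left, h'.mem_left⟩
  mem_right := ⟨h.mem_right, h'.mem_right⟩
  analyticAt_toFun :=
    (h.analyticAt_toFun.comp_of_eq analyticAt_fst rfl).prod
      (h'.analyticAt_toFun.comp_of_eq analyticAt_snd rfl)
  analyticAt_invFun :=
    (h.analyticAt_invFun.comp_of_eq analyticAt_fst rfl).prod
      (h'.analyticAt_invFun.comp_of_eq analyticAt_snd rfl)
  map_base := by simp [h.map_base, h'.map_base]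
  inv_base := by simp [h.inv_base, h'.inv_base]
  mapsTo := by
    rw [nhdsWithin_prod_eq]
    exact h.mapsTo.prod_mk h'.mapsTo
  inv_mapsTo := by
    rw [nhdsWithin_prod_eq]
    exact h.inv_mapsTo.prod_mk h'.inv_mapsTo
  left_inv := by
    rw [nhdsWithin_prod_eq]
    exact (h.left_inv.prod_mk h'.left_inv).mono fun x hx => Prod.ext hx.1 hx.2
  right_inv := by
    rw [nhdsWithin_prod_eq]
    exact (h.right_inv.prod_mk h'.right_inv).mono fun x hx => Prod.ext hx.1 hx.2

theorem of_continuousLinearEquiv (e : E ≃L[ℝ] F) (h : ∀ x, x ∈ A ↔ e x ∈ B) (h0 : (0 : E) ∈ A) :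
    IsGermIso A 0 B 0 e e.symm where
  mem_left := h0
  mem_right := by simpa using (h 0).1 h0
  analyticAt_toFun := e.toContinuousLinearMap.analyticAt 0
  analyticAt_invFun := e.symm.toContinuousLinearMap.analyticAt 0
  map_base := map_zero e
  inv_base := map_zero e.symm
  mapsTo := eventually_mem_nhdsWithin.mono fun x hx => (h x).1 hx
  inv_mapsTo := eventually_mem_nhdsWithin.mono fun y hy => (h _).2 (by simpa using hy)
  left_inv := Eventually.of_forall fun x => e.symm_apply_apply x
  right_inv := Eventually.of_forall fun x => e.apply_symm_apply x

end IsGermIso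

/-! ### Analytic Morse lemma -/

section Morse

variable {E : Type*} [NormedAddCommGroup E] [NormedSpace ℝ E]

/-- An analytic function with derivative the multiple `c ≠ 0` of the identity has an analytic local
inverse. -/
theorem exists_analyticAt_localInverse [CompleteSpace E] {f : E → E} {a b : E} {c : ℝ}
    (hc : c ≠ 0) (hf : AnalyticAt ℝ f a) (hd : HasFDerivAt f (c • ContinuousLinearMap.id ℝ E) a)
    (hab : f a = b) :
    ∃ g : E → E, AnalyticAt ℝ g b ∧ g b = a ∧ (∀ᶠ x in 𝓝 a, g (f x) = x) ∧
      ∀ᶠ y in 𝓝 b, f (g y) = y := by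
  subst hab
  let e : E ≃L[ℝ] E := ContinuousLinearEquiv.smulLeft (Units.mk0 c hc)
  have hd' : HasFDerivAt f (e : E →L[ℝ] E) a := by
    refine hd.congr_fderiv ?_
    ext x
    simp [e]
  -- The smoothness exponent `⊤` stands for analyticity, here and throughout, so the inverse
  -- function theorem returns an analytic inverse.
  have hs := hf.contDiffAt (n := ⊤)
  have hs' := hs.hasStrictFDerivAt' hd' (by simp)
  exact ⟨hs.localInverse hd' (by simp), (hs.to_localInverse hd' (by simp)).analyticAt,
    hs.localInverse_apply_image hd' (by simp), hs'.eventually_left_inverse,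
    hs'.eventually_right_inverse⟩

/-- The square root near the identity in the algebra of endomorphisms. -/
theorem exists_analyticAt_sqrt_one [CompleteSpace E] :
    ∃ s : (E →L[ℝ] E) → (E →L[ℝ] E), AnalyticAt ℝ s 1 ∧ s 1 = 1 ∧
      (∀ᶠ T in 𝓝 (1 : E →L[ℝ] E), s (T * T) = T) ∧
      (∀ᶠ R in 𝓝 (1 : E →L[ℝ] E), s R * s R = R) := by
  -- Squaring has derivative T ↦ 1·T + T·1 = 2T at the identity.
  refine exists_analyticAt_localInverse (c := 2) two_ne_zero (f := fun T => T * T)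
    (analyticAt_id.mul analyticAt_id) ?_ (mul_one 1)
  refine ((hasFDerivAt_id (𝕜 := ℝ) (1 : E →L[ℝ] E)).mul'
    (hasFDerivAt_id (𝕜 := ℝ) (1 : E →L[ℝ] E))).congr_fderiv ?_
  refine ContinuousLinearMap.ext fun T => ?_
  change 1 * T + T * 1 = (2 : ℝ) • T
  rw [one_mul, mul_one, two_smul]

/-- The **Morse lemma** for a nondegenerate quadratic form with analytic coefficients. -/
theorem exists_morse_chart [FiniteDimensional ℝ E] (S : E → E →L[ℝ] E →L[ℝ] ℝ)
    (hS : AnalyticAt ℝ S 0) (hsymm : ∀ᶠ x in 𝓝 0, ∀ a b, S x a b = S x b a)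
    (hnd : ∀ a, (∀ b, S 0 a b = 0) → a = 0) :
    ∃ F G : E → E, AnalyticAt ℝ F 0 ∧ AnalyticAt ℝ G 0 ∧ F 0 = 0 ∧ G 0 = 0 ∧
      (∀ᶠ x in 𝓝 0, G (F x) = x) ∧ (∀ᶠ y in 𝓝 0, F (G y) = y) ∧
      HasFDerivAt F (ContinuousLinearMap.id ℝ E) 0 ∧
      ∀ᶠ x in 𝓝 0, S x x x = S 0 (F x) (F x) := by
  have : CompleteSpace E := FiniteDimensional.complete ℝ E
  have hinj : Function.Injective (S 0).toLinearMap := by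
    rw [injective_iff_map_eq_zero]
    intro a ha
    exact hnd a fun b => by
      have : S 0 a = 0 := ha
      rw [this]; rfl
  have hfr : Module.finrank ℝ E = Module.finrank ℝ (E →L[ℝ] ℝ) := by
    rw [← (LinearMap.toContinuousLinearMap : (E →ₗ[ℝ] ℝ) ≃ₗ[ℝ] (E →L[ℝ] ℝ)).finrank_eq]
    exact (Subspace.dual_finrank_eq).symm
  let e : E ≃L[ℝ] (E →L[ℝ] ℝ) :=
    (LinearEquiv.ofInjectiveOfFinrankEq (S 0).toLinearMap hinj hfr).toContinuousLinearEquiv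
  have he : ∀ a, e a = S 0 a := fun a => rfl
  have hes : ∀ l, S 0 (e.symm l) = l := fun l => by rw [← he]; simp
  obtain ⟨s, hs, hs1, hsl, hsr⟩ := exists_analyticAt_sqrt_one (E := E)
  -- R x = S_0⁻¹ S_x, so that S_x(a, b) = S_0(R x a, b). The chart will be x ↦ A x x, where A x is
  -- the square root of R x near 1.
  let R : E → (E →L[ℝ] E) := fun x => (e.symm : (E →L[ℝ] ℝ) →L[ℝ] E).comp (S x)
  have hR : AnalyticAt ℝ R 0 :=
    ((contDiffAt_const (n := ⊤)).clm_comp (hS.contDiffAt (n := ⊤))).analyticAt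
  have hR0 : R 0 = 1 := by
    ext a
    simp only [R, ContinuousLinearMap.comp_apply, ContinuousLinearEquiv.coe_coe,
      one_apply_eq_self, ← he, e.symm_apply_apply]
  have hSR : ∀ x a, S 0 (R x a) = S x a := fun x a => hes _
  let A : E → (E →L[ℝ] E) := fun x => s (R x)
  have hA : AnalyticAt ℝ A 0 := AnalyticAt.comp (by rw [hR0]; exact hs) hR
  have hA0 : A 0 = 1 := by simp [A, hR0, hs1]
  -- The adjoint with respect to S_0.
  let adj : (E →L[ℝ] E) → (E →L[ℝ] E) := fun T =>
    (e.symm : (E →L[ℝ] ℝ) →L[ℝ] E).comp (((ContinuousLinearMap.compL ℝ E E ℝ).flip T).comp (S 0))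
  have hadj : ∀ T a b, S 0 (adj T a) b = S 0 a (T b) := fun T a b => by
    simp only [adj, ContinuousLinearMap.comp_apply, ContinuousLinearEquiv.coe_coe, hes,
      ContinuousLinearMap.flip_apply, ContinuousLinearMap.compL_apply]
  have hext : ∀ T T' : E →L[ℝ] E, (∀ a b, S 0 (T a) b = S 0 (T' a) b) → T = T' := by
    intro T T' h
    ext a
    exact hinj (ContinuousLinearMap.ext fun b => h a b)
  have hadjc : Continuous adj := by
    refine ((ContinuousLinearMap.compL ℝ E (E →L[ℝ] ℝ) E) _).continuous.comp ?_
    exact (((ContinuousLinearMap.compL ℝ E (E →L[ℝ] ℝ) (E →L[ℝ] ℝ)).flip (S 0)).comp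
      ((ContinuousLinearMap.compL ℝ E E ℝ).flip)).continuous
  have hadj1 : adj 1 = 1 := hext _ _ fun a b => by rw [hadj]; rfl
  have htA : Tendsto A (𝓝 0) (𝓝 1) := hA0 ▸ hA.continuousAt.tendsto
  have htR : Tendsto R (𝓝 0) (𝓝 1) := hR0 ▸ hR.continuousAt.tendsto
  have htadj : Tendsto (fun x => adj (A x)) (𝓝 0) (𝓝 1) := by
    have := (hadjc.tendsto 1).comp htA
    rwa [hadj1] at this
  have hsymm0 : ∀ a b, S 0 a b = S 0 b a := hsymm.self_of_nhds
  have hAA : ∀ᶠ x in 𝓝 0, A x * A x = R x := htR.eventually hsr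
  -- By symmetry of S_x, R x is self-adjoint for S_0, so the adjoint of A x is a square root of R x
  -- too. Both roots are near 1, where the root is unique. Self-adjointness then gives S_0(A x x, A
  -- x x) = S_0(R x x, x) = S_x(x, x).
  have hself : ∀ᶠ x in 𝓝 0, adj (A x) = A x := by
    filter_upwards [hAA, htadj.eventually hsl, hsymm] with x h1 h2 h4
    rw [← h2]
    have : adj (A x) * adj (A x) = A x * A x := by
      refine hext _ _ fun a b => ?_
      have hx : ∀ b, A x (A x b) = R x b := fun b => by rw [← h1]; rfl
      rw [mul_apply_eq_comp, mul_apply_eq_comp, hadj, hadj, hx, hx, hSR,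
        hsymm0, hSR, h4]
    rw [this, h1]
  have hF : AnalyticAt ℝ (fun x => A x x) 0 := 
    ((hA.contDiffAt (n := ⊤)).clm_apply (contDiffAt_id (n := ⊤))).analyticAt
  have hFd : HasFDerivAt (fun x => A x x) (ContinuousLinearMap.id ℝ E) 0 := by
    refine (hA.differentiableAt.hasFDerivAt.clm_apply (hasFDerivAt_id (𝕜 := ℝ) (0 : E))).congr_fderiv
      ?_
    ext a
    simp [hA0]
  obtain ⟨G, hG, hG0, hl, hr⟩ := exists_analyticAt_localInverse (c := 1) one_ne_zero hF
    (by simpa using hFd) (b := 0) (by simp)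
  refine ⟨_, G, hF, hG, by simp, hG0, hl, hr, hFd, ?_⟩
  filter_upwards [hself, hAA] with x h1 h2
  have hx : ∀ b, A x (A x b) = R x b := fun b => by rw [← h2]; rfl
  conv_rhs => rw [← h1]
  rw [hadj, h1, hx, hsymm0, hSR]

/-- The Morse chart as an isomorphism of germs of zero sets. -/
theorem isGermIso_of_morse_chart {S : E → E →L[ℝ] E →L[ℝ] ℝ} {F G : E → E}
    (hF : AnalyticAt ℝ F 0) (hG : AnalyticAt ℝ G 0) (hF0 : F 0 = 0) (hG0 : G 0 = 0)
    (hl : ∀ᶠ x in 𝓝 0, G (F x) = x) (hr : ∀ᶠ y in 𝓝 0, F (G y) = y)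
    (hS : ∀ᶠ x in 𝓝 0, S x x x = S 0 (F x) (F x)) :
    IsGermIso {x | S x x x = 0} 0 {y | S 0 y y = 0} 0 F G where
  mem_left := by simp
  mem_right := by simp
  analyticAt_toFun := hF
  analyticAt_invFun := hG
  map_base := hF0
  inv_base := hG0
  mapsTo := by
    filter_upwards [hS.filter_mono nhdsWithin_le_nhds, self_mem_nhdsWithin] with x h1 h2
    exact h1.symm.trans h2
  inv_mapsTo := by
    have ht : Tendsto G (𝓝 0) (𝓝 0) := by simpa [hG0] using hG.continuousAt.tendsto
    filter_upwards [(ht.eventually hS).filter_mono nhdsWithin_le_nhds,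
      hr.filter_mono nhdsWithin_le_nhds, self_mem_nhdsWithin] with y h1 h2 h3
    rw [h2] at h1
    exact h1.trans h3
  left_inv := hl.filter_mono nhdsWithin_le_nhds
  right_inv := hr.filter_mono nhdsWithin_le_nhds

end Morse

/-! ### Cyclic indices and polar angles -/

section Cyclic

variable {N : ℕ} [NeZero N]

theorem sum_add_one_eq {M : Type*} [AddCommMonoid M] (g : Fin N → M) :
    ∑ n, g (n + 1) = ∑ n, g n :=
  Equiv.sum_comp (Equiv.addRight (1 : Fin N)) g

@[simp]
theorem polarAngle_zero (α : Fin N → ℝ) : polarAngle α 0 = 0 := by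
  have : Finset.Iio (0 : Fin N) = ∅ := by
    ext k; simp
  simp [polarAngle, this]

/-- The polar angles are the partial sums, up to a full turn when the index wraps around. -/
theorem polarAngle_add_one (α : Fin N → ℝ) (n : Fin N) :
    (n + 1 ≠ 0 ∧ polarAngle α (n + 1) = polarAngle α n + α n) ∨
      (n + 1 = 0 ∧ polarAngle α n + α n = ∑ k, α k) := by
  have hIic : polarAngle α n + α n = ∑ k ∈ Finset.Iic n, α k := by
    rw [polarAngle, ← Finset.Iio_insert, Finset.sum_insert (by simp), add_comm]
  rcases Nat.lt_or_ge (n.val + 1) N with h | h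
  · left
    have hv : (n + 1).val = n.val + 1 := by
      rw [Fin.val_add, Fin.val_one', Nat.add_mod_mod, Nat.mod_eq_of_lt h]
    refine ⟨fun h0 => ?_, ?_⟩
    · rw [h0] at hv; simp at hv
    · rw [hIic, polarAngle]
      congr 1
      ext k
      simp only [Finset.mem_Iio, Finset.mem_Iic, Fin.lt_def, Fin.le_def, hv]
      omega
  · right
    have hN : n.val + 1 = N := le_antisymm n.isLt h
    refine ⟨?_, ?_⟩
    · ext
      rw [Fin.val_add, Fin.val_one', Nat.add_mod_mod, hN]
      simp
    · rw [hIic]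
      congr 1
      ext k
      simp only [Finset.mem_Iic, Fin.le_def, Finset.mem_univ, iff_true]
      omega

theorem polarAngle_one (α : Fin N → ℝ) (hN : 2 ≤ N) : polarAngle α 1 = α 0 := by
  have h10 : (0 : Fin N) + 1 ≠ 0 := by
    intro h
    have := congrArg Fin.val h
    rw [zero_add, Fin.val_one', Nat.mod_eq_of_lt (by omega)] at this
    simp at this
  rcases polarAngle_add_one α 0 with ⟨_, h⟩ | ⟨h, _⟩
  · simpa using h
  · exact absurd h h10

/-- The partial sums restart at 0 when the index wraps around. Because the total is a multiple of
2π, cosine and sine do not notice, so addition formulas hold cyclically. -/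
theorem exp_polarAngle_add_one (α : Fin N → ℝ) (w : ℤ) (hw : ∑ n, α n = 2 * Real.pi * w)
    (n : Fin N) :
    (Real.cos (polarAngle α (n + 1)) = Real.cos (polarAngle α n + α n)) ∧
      Real.sin (polarAngle α (n + 1)) = Real.sin (polarAngle α n + α n) := by
  rcases polarAngle_add_one α n with ⟨_, h⟩ | ⟨h0, h⟩
  · rw [h]; exact ⟨rfl, rfl⟩
  · rw [h0, h, hw, polarAngle_zero, mul_comm (2 * Real.pi) (w : ℝ), Real.cos_int_mul_two_pi,
      Real.sin_zero, Real.cos_zero]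
    refine ⟨rfl, ?_⟩
    have := Real.sin_int_mul_pi (w * 2)
    push_cast at this
    rw [← this]; ring_nf

/-- A single fold would have angle 2πw, whose absolute value is 0 or at least 2π. Folds 0 and 1 are
therefore distinct, as the choice of a reference face needs. -/
theorem two_le_of_sum_eq {α : Fin N → ℝ} {w : ℤ} (hα : ∀ n, 0 < |α n| ∧ |α n| < Real.pi)
    (hw : ∑ n, α n = 2 * Real.pi * w) : 2 ≤ N := by
  by_contra hN
  have h1 : N = 1 := by have := NeZero.pos N; omega
  subst h1
  have h := hα 0
  rw [Fin.sum_univ_one] at hw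
  rw [hw, abs_mul, abs_of_pos Real.two_pi_pos] at h
  rcases eq_or_ne w 0 with rfl | h0
  · simp at h
  · have : (1 : ℝ) ≤ |(w : ℝ)| := by exact_mod_cast Int.one_le_abs h0
    nlinarith [h.2, Real.pi_pos]

theorem sin_ne_zero_of_abs {x : ℝ} (h : 0 < |x| ∧ |x| < Real.pi) : Real.sin x ≠ 0 := by
  rcases lt_or_gt_of_ne (abs_pos.1 h.1) with hx | hx
  · exact (Real.sin_neg_of_neg_of_neg_pi_lt hx (by rw [abs_of_neg hx] at h; linarith)).ne
  · exact (Real.sin_pos_of_pos_of_lt_pi hx (by rw [abs_of_pos hx] at h; linarith)).ne'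

end Cyclic

/-! ### The stress form in terms of slopes -/

section StressForm

section Slope

variable {N : ℕ} (L : Fin N → ℝ)

/-- The slope of the `n`-th fold. -/
def slope (h : Heights N) (n : Fin N) : ℝ := (h (some n) - h none) / L n

theorem slope_add (h k : Heights N) : slope L (h + k) = slope L h + slope L k := by
  ext n; simp only [slope, Pi.add_apply]; ring

theorem slope_smul (c : ℝ) (h : Heights N) : slope L (c • h) = c • slope L h := by
  ext n; simp only [slope, Pi.smul_apply, smul_eq_mul]; ring

end Slope

variable {N : ℕ} [NeZero N] (α L : Fin N → ℝ)

/-- The symmetric bilinear form on slopes along the folds that corresponds to the stress matrix. -/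
def slopeForm (z y : Fin N → ℝ) : ℝ :=
  ∑ n, (Real.cot (α n) * (z n * y n + z (n + 1) * y (n + 1)) -
    (z n * y (n + 1) + z (n + 1) * y n) / Real.sin (α n))

theorem slopeForm_comm (z y : Fin N → ℝ) : slopeForm α z y = slopeForm α y z :=
  Finset.sum_congr rfl fun n _ => by ring

/-- The hub coefficients make every row of the matrix sum to zero, so only differences to the height
of the hub matter. After scaling by the lengths, each f_n splits into the cotangents of the two
adjacent sectors, and L disappears. -/
theorem dotProduct_stressMatrix_mulVec (hL : ∀ n, L n ≠ 0) (h k : Heights N) :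
    h ⬝ᵥ (stressMatrix α L) *ᵥ k = slopeForm α (slope L h) (slope L k) := by
  have e1 : h ⬝ᵥ (stressMatrix α L) *ᵥ k =
      h none * (∑ n, (hubCoeff α L n * k (some n) - hubCoeff α L n * k none)) +
      ∑ m, h (some m) * (hubCoeff α L m * k none + diagCoeff α L m * k (some m) +
        rimCoeff α L m * k (some (m + 1)) + rimCoeff α L (m - 1) * k (some (m - 1))) := by
    simp only [dotProduct, mulVec, Fintype.sum_option, stressMatrix]
    congr 1
    · rw [Finset.sum_sub_distrib, ← Finset.sum_mul]; ring
    · refine Finset.sum_congr rfl fun m _ => ?_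
      have h3 : ∀ n, (if m = n + 1 then rimCoeff α L n else 0) =
          if m - 1 = n then rimCoeff α L n else 0 := fun n => by
        simp only [sub_eq_iff_eq_add]
      simp only [h3, add_mul, ite_mul, zero_mul, Finset.sum_add_distrib]
      simp [add_assoc]
  have e2 : ∀ F : Fin N → ℝ, ∑ n, F n = ∑ n, F (n + 1) := fun F => (sum_add_one_eq F).symm
  have e3 : h ⬝ᵥ (stressMatrix α L) *ᵥ k =
      ∑ n, (diagCoeff α L n * ((h (some n) - h none) * (k (some n) - k none))) +
      ∑ n, rimCoeff α L n * ((h (some n) - h none) * (k (some (n + 1)) - k none) +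
        (h (some (n + 1)) - h none) * (k (some n) - k none)) := by
    rw [e1]
    have a1 : ∑ n, rimCoeff α L (n - 1) * (k none * h (some n) + h none * k (some n) -
          h none * k none - h (some n) * k (some (n - 1))) =
        ∑ n, rimCoeff α L n * (k none * h (some (n + 1)) + h none * k (some (n + 1)) -
          h none * k none - h (some (n + 1)) * k (some n)) := by
      rw [e2]; simp only [add_sub_cancel_right]
    rw [Finset.mul_sum, ← Finset.sum_add_distrib, ← Finset.sum_add_distrib, ← sub_eq_zero,
      ← Finset.sum_sub_distrib]
    rw [← sub_eq_zero, ← Finset.sum_sub_distrib, ← neg_eq_zero, ← Finset.sum_neg_distrib] at a1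
    rw [← a1]
    refine Finset.sum_congr rfl fun n _ => ?_
    simp only [hubCoeff]
    ring
  rw [e3, slopeForm]
  have a2 : ∑ n, (diagCoeff α L n * ((h (some n) - h none) * (k (some n) - k none))) =
      ∑ n, Real.cot (α n) * (slope L h n * slope L k n +
        slope L h (n + 1) * slope L k (n + 1)) := by
    simp only [mul_add (Real.cot _)]
    rw [Finset.sum_add_distrib]
    have : ∑ n, Real.cot (α n) * (slope L h (n + 1) * slope L k (n + 1)) =
        ∑ n, Real.cot (α (n - 1)) * (slope L h n * slope L k n) := by
      rw [e2 (fun n => Real.cot (α (n - 1)) * _)]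
      simp only [add_sub_cancel_right]
    rw [this, ← Finset.sum_add_distrib]
    refine Finset.sum_congr rfl fun n _ => ?_
    simp only [diagCoeff, slope]
    field_simp [hL n]
  rw [a2, ← Finset.sum_add_distrib]
  refine Finset.sum_congr rfl fun n _ => ?_
  have h1 := hL n
  have h2 := hL (n + 1)
  simp only [rimCoeff, slope]
  -- No condition on the angles is assumed; for a vanishing sine both sides are zero because
  -- division by zero gives zero.
  by_cases hs : Real.sin (α n) = 0
  · simp [hs]
  · field_simp
    ring

theorem stressForm_apply (hL : ∀ n, L n ≠ 0) (h : Heights N) :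
    stressForm α L h = slopeForm α (slope L h) (slope L h) := by
  rw [← dotProduct_stressMatrix_mulVec α L hL]
  simp [stressForm, Matrix.toQuadraticForm', Matrix.toLinearMap₂'_apply']

theorem slopeForm_add_left (z z' y : Fin N → ℝ) :
    slopeForm α (z + z') y = slopeForm α z y + slopeForm α z' y := by
  simp only [slopeForm, ← Finset.sum_add_distrib, Pi.add_apply]
  exact Finset.sum_congr rfl fun n _ => by ring

theorem slopeForm_add_right (z y y' : Fin N → ℝ) :
    slopeForm α z (y + y') = slopeForm α z y + slopeForm α z y' := by
  simp only [slopeForm_comm α z, slopeForm_add_left]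

theorem mem_radical_stressForm (hL : ∀ n, L n ≠ 0) (h : Heights N) :
    h ∈ (stressForm α L).radical ↔ ∀ k, slopeForm α (slope L h) (slope L k) = 0 := by
  rw [QuadraticMap.mem_radical_iff']
  simp only [stressForm_apply α L hL, slope_add, slopeForm_add_left, slopeForm_add_right]
  constructor
  · rintro ⟨h0, h1⟩ k
    have := h1 k
    rw [h0, slopeForm_comm α (slope L k)] at this
    linarith
  · intro hk
    refine ⟨hk h, fun k => ?_⟩
    rw [hk h, slopeForm_comm α (slope L k), hk k]
    ring

/-- The slopes of a linear function on the plane. -/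
def linearSlope (a b : ℝ) (n : Fin N) : ℝ :=
  a * Real.cos (polarAngle α n) + b * Real.sin (polarAngle α n)

/-- Linear functions carry no stress: each sector contributes t_n y_n - t_{n+1} y_{n+1}, where t is
minus the derivative of the linear function along the unit circle. The sum telescopes around the
cycle. -/
theorem slopeForm_linearSlope {w : ℤ} (hα : ∀ n, Real.sin (α n) ≠ 0)
    (hw : ∑ n, α n = 2 * Real.pi * w) (a b : ℝ) (y : Fin N → ℝ) :
    slopeForm α (linearSlope α a b) y = 0 := by
  let t : Fin N → ℝ := fun n =>
    a * Real.sin (polarAngle α n) - b * Real.cos (polarAngle α n)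
  have : slopeForm α (linearSlope α a b) y = ∑ n, (t n * y n - t (n + 1) * y (n + 1)) := by
    refine Finset.sum_congr rfl fun n _ => ?_
    obtain ⟨hc, hs⟩ := exp_polarAngle_add_one α w hw n
    simp only [t, linearSlope, hc, hs, Real.cos_add, Real.sin_add, Real.cot_eq_cos_div_sin]
    have h1 := hα n
    have h2 := Real.sin_sq_add_cos_sq (α n)
    field_simp
    linear_combination (y (n + 1) * (a * Real.cos (polarAngle α n) + b * Real.sin (polarAngle α n))) * h2
  rw [this, Finset.sum_sub_distrib, sum_add_one_eq (fun n => t n * y n), sub_self]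

end StressForm

/-- The bad φ are the θ_n + kπ, a countable set. Such a φ allows dividing slopes by sin(θ_n - φ). -/
theorem exists_forall_sin_sub_ne_zero {ι : Type*} [Countable ι] (θ : ι → ℝ) :
    ∃ φ : ℝ, ∀ n, Real.sin (θ n - φ) ≠ 0 := by
  have hc : (⋃ n, Set.range fun k : ℤ => θ n - k * Real.pi).Countable :=
    Set.countable_iUnion fun n => Set.countable_range _
  obtain ⟨φ, hφ⟩ := (hc.dense_compl ℝ).nonempty
  refine ⟨φ, fun n h => hφ ?_⟩
  obtain ⟨k, hk⟩ := Real.sin_eq_zero_iff.1 h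
  exact Set.mem_iUnion.2 ⟨n, k, by simp only [hk]; ring⟩

/-- Counting sign changes of the sine by the number of half turns. -/
theorem ite_sin_mul_sin_div_sin {x a : ℝ} (hx : Real.sin x ≠ 0) (hxa : Real.sin (x + a) ≠ 0)
    (ha : 0 < |a| ∧ |a| < Real.pi) :
    (if 0 < Real.sin x * Real.sin (x + a) / Real.sin a then 1 else 0 : ℤ) =
      (if 0 < a then 1 else 0) - (⌊(x + a) / Real.pi⌋ - ⌊x / Real.pi⌋) := by
  have hpi := Real.pi_pos
  set m := ⌊x / Real.pi⌋ with hm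
  -- Removing m half turns from x multiplies both sines by (-1)^m and lowers both floors by m, so
  -- only x in (0, π) has to be treated.
  obtain ⟨r, hr⟩ : ∃ r, x = r + m * Real.pi := ⟨x - m * Real.pi, by ring⟩
  have hr0 : 0 ≤ r := by
    have : (m : ℝ) ≤ x / Real.pi := Int.floor_le _
    rw [le_div_iff₀ hpi] at this; linarith
  have hr1 : r < Real.pi := by
    have : x / Real.pi < m + 1 := Int.lt_floor_add_one _
    rw [div_lt_iff₀ hpi] at this; linarith
  have hfl : ⌊(x + a) / Real.pi⌋ = ⌊(r + a) / Real.pi⌋ + m := by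
    rw [← Int.floor_add_intCast]
    congr 1
    rw [hr]; field_simp; ring
  have hsx : Real.sin x * Real.sin (x + a) = Real.sin r * Real.sin (r + a) := by
    rw [hr, show r + m * Real.pi + a = (r + a) + m * Real.pi by ring, Real.sin_add_int_mul_pi,
      Real.sin_add_int_mul_pi]
    have : ((-1 : ℝ) ^ m) * (-1) ^ m = 1 := by
      rw [← mul_zpow]; simp
    linear_combination (Real.sin r * Real.sin (r + a)) * this
  have hrs : Real.sin r ≠ 0 := by
    intro h; apply hx; rw [hr, Real.sin_add_int_mul_pi, h, mul_zero]
  have hra : Real.sin (r + a) ≠ 0 := by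
    intro h; apply hxa
    rw [hr, show r + m * Real.pi + a = (r + a) + m * Real.pi by ring, Real.sin_add_int_mul_pi, h,
      mul_zero]
  have hr0' : 0 < r := lt_of_le_of_ne hr0 fun h => hrs (by rw [← h]; simp)
  have hsr := Real.sin_pos_of_pos_of_lt_pi hr0' hr1
  rw [hsx, hfl]
  have key : ∀ k : ℤ, k * Real.pi < r + a → r + a < (k + 1) * Real.pi →
      ⌊(r + a) / Real.pi⌋ = k := by
    intro k h1 h2
    rw [Int.floor_eq_iff, le_div_iff₀ hpi, div_lt_iff₀ hpi]
    exact ⟨h1.le, h2⟩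
  rcases lt_or_gt_of_ne (abs_pos.1 ha.1) with hneg | hpos
  · rw [abs_of_neg hneg] at ha
    have hsa := Real.sin_neg_of_neg_of_neg_pi_lt hneg (by linarith)
    rcases lt_trichotomy (r + a) 0 with h | h | h
    · have h2 := Real.sin_neg_of_neg_of_neg_pi_lt h (by linarith)
      rw [key (-1) (by push_cast; linarith) (by push_cast; linarith),
        if_pos (div_pos_of_neg_of_neg (mul_neg_of_pos_of_neg hsr h2) hsa), if_neg hneg.not_gt]
      ring
    · exact absurd (by rw [h]; simp) hra
    · have h2 := Real.sin_pos_of_pos_of_lt_pi h (by linarith)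
      rw [key 0 (by push_cast; linarith) (by push_cast; linarith),
        if_neg (div_neg_of_pos_of_neg (mul_pos hsr h2) hsa).not_gt, if_neg hneg.not_gt]
      ring
  · rw [abs_of_pos hpos] at ha
    have hsa := Real.sin_pos_of_pos_of_lt_pi hpos ha.2
    rcases lt_trichotomy (r + a) Real.pi with h | h | h
    · have h2 := Real.sin_pos_of_pos_of_lt_pi (by linarith) h
      rw [key 0 (by push_cast; linarith) (by push_cast; linarith),
        if_pos (div_pos (mul_pos hsr h2) hsa), if_pos hpos]
      ring
    · exact absurd (by rw [h]; simp) hra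
    · have h2 : Real.sin (r + a) < 0 := by
        have := Real.sin_pos_of_pos_of_lt_pi (x := r + a - Real.pi) (by linarith) (by linarith)
        rw [Real.sin_sub_pi] at this; linarith
      rw [key 1 (by push_cast; linarith) (by push_cast; linarith),
        if_neg (div_neg_of_neg_of_pos (mul_neg_of_pos_of_neg hsr h2) hsa).not_gt, if_pos hpos]
      ring

/-! ### Nullity and signature -/

section Signature

section Balanced

variable {N : ℕ}

/-- The increments supported on a set, with sum zero. -/
def balancedIncrements (s : Set (Fin N)) : Submodule ℝ (Fin N → ℝ) :=
  Pi.spanSubset ℝ s ⊓ LinearMap.ker (∑ n, LinearMap.proj (R := ℝ) (φ := fun _ : Fin N => ℝ) n)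

theorem mem_balancedIncrements {s : Set (Fin N)} {d : Fin N → ℝ} :
    d ∈ balancedIncrements s ↔ (∀ n ∉ s, d n = 0) ∧ ∑ n, d n = 0 := by
  rw [balancedIncrements, Submodule.mem_inf, Pi.mem_spanSubset_iff, LinearMap.mem_ker]
  simp

/-- The condition that the sum vanishes costs at most one dimension. -/
theorem le_finrank_balancedIncrements (s : Set (Fin N)) :
    s.ncard ≤ Module.finrank ℝ (balancedIncrements s) + 1 := by
  set l := ∑ n, LinearMap.proj (R := ℝ) (φ := fun _ : Fin N => ℝ) n with hl
  have h1 := Submodule.finrank_sup_add_finrank_inf_eq (Pi.spanSubset ℝ s) (LinearMap.ker l)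
  have h2 := LinearMap.finrank_range_add_finrank_ker l
  have h3 : Module.finrank ℝ (LinearMap.range l) ≤ 1 := by
    simpa using (LinearMap.range l).finrank_le
  have h4 := (Pi.spanSubset ℝ s ⊔ LinearMap.ker l).finrank_le
  have h5 : Module.finrank ℝ (Pi.spanSubset ℝ s) = s.ncard := Pi.dim_spanSubset
  rw [h5] at h1
  change _ ≤ Module.finrank ℝ (Pi.spanSubset ℝ s ⊓ LinearMap.ker l : Submodule ℝ _) + 1
  omega

end Balanced

variable {N : ℕ} [NeZero N] (α L : Fin N → ℝ)

/-- The sines of the polar angles relative to a reference direction. -/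
def refSin (φ : ℝ) (n : Fin N) : ℝ := Real.sin (polarAngle α n - φ)

/-- The coefficients of the stress form after dividing slopes by `refSin`. -/
def edgeWeight (φ : ℝ) (n : Fin N) : ℝ := refSin α φ n * refSin α φ (n + 1) / Real.sin (α n)

variable {α L} {w : ℤ} {φ : ℝ}

theorem sin_sub_polarAngle_add_one (hw : ∑ n, α n = 2 * Real.pi * w) (φ : ℝ) (n : Fin N) :
    refSin α φ (n + 1) = Real.sin (polarAngle α n - φ + α n) := by
  obtain ⟨h1, h2⟩ := exp_polarAngle_add_one α w hw n
  rw [refSin, Real.sin_sub, h1, h2, ← Real.sin_sub]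
  ring_nf

/-- Since sin(θ_n - φ) belongs to the radical, factoring it out leaves only differences of y. Sector
by sector the two sides differ by the increment of cos(θ_n - φ) sin(θ_n - φ) y_n², which telescopes
around the cycle. -/
theorem slopeForm_refSin_mul (hα : ∀ n, Real.sin (α n) ≠ 0) (hw : ∑ n, α n = 2 * Real.pi * w)
    (y : Fin N → ℝ) :
    slopeForm α (fun n => refSin α φ n * y n) (fun n => refSin α φ n * y n) =
      ∑ n, edgeWeight α φ n * (y (n + 1) - y n) ^ 2 := by
  let c : Fin N → ℝ := fun n => Real.cos (polarAngle α n - φ)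
  have : slopeForm α (fun n => refSin α φ n * y n) (fun n => refSin α φ n * y n) =
      ∑ n, (edgeWeight α φ n * (y (n + 1) - y n) ^ 2 +
        (c (n + 1) * refSin α φ (n + 1) * y (n + 1) ^ 2 - c n * refSin α φ n * y n ^ 2)) := by
    refine Finset.sum_congr rfl fun n _ => ?_
    have hs := sin_sub_polarAngle_add_one hw φ n
    have hc : c (n + 1) = Real.cos (polarAngle α n - φ + α n) := by
      obtain ⟨h1, h2⟩ := exp_polarAngle_add_one α w hw n
      simp only [c]
      rw [Real.cos_sub, h1, h2, ← Real.cos_sub]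
      ring_nf
    simp only [edgeWeight, hs, hc, Real.cot_eq_cos_div_sin]
    simp only [c, refSin, Real.sin_add, Real.cos_add]
    have h1 := hα n
    have h2 := Real.sin_sq_add_cos_sq (α n)
    field_simp
    linear_combination (Real.sin (polarAngle α n - φ) * (Real.sin (polarAngle α n - φ) *
      Real.cos (α n) + Real.cos (polarAngle α n - φ) * Real.sin (α n)) * y (n + 1) ^ 2) * h2
  rw [this, Finset.sum_add_distrib, Finset.sum_sub_distrib,
    sum_add_one_eq (fun n => c n * refSin α φ n * y n ^ 2), sub_self, add_zero]

theorem edgeWeight_ne_zero (hα : ∀ n, Real.sin (α n) ≠ 0) (hφ : ∀ n, refSin α φ n ≠ 0)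
    (n : Fin N) : edgeWeight α φ n ≠ 0 :=
  div_ne_zero (mul_ne_zero (hφ n) (hφ _)) (hα n)

/-- Each weight is positive according to the sign of α_n, corrected by the change of the number of
half turns of θ_n - φ. Summed once around the hub these changes add up to 2w. -/
theorem card_edgeWeight_pos (hα : ∀ n, 0 < |α n| ∧ |α n| < Real.pi)
    (hw : ∑ n, α n = 2 * Real.pi * w) (hφ : ∀ n, refSin α φ n ≠ 0) :
    ((Finset.univ.filter fun n => 0 < edgeWeight α φ n).card : ℤ) =
      ((Finset.univ.filter fun n => 0 < α n).card : ℤ) - 2 * w := by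
  let m : Fin N → ℤ := fun n => ⌊(polarAngle α n - φ) / Real.pi⌋
  have hpi := Real.pi_pos
  -- At the wrap the polar angle falls back from 2πw to 0, which hides 2w half turns.
  have hm : ∀ n, ⌊(polarAngle α n - φ + α n) / Real.pi⌋ =
      m (n + 1) + if n + 1 = 0 then 2 * w else 0 := by
    intro n
    rcases polarAngle_add_one α n with ⟨h0, h⟩ | ⟨h0, h⟩
    · rw [if_neg h0, add_zero]
      simp only [m, h]
      ring_nf
    · rw [if_pos h0, h0]
      simp only [m, polarAngle_zero]
      rw [show polarAngle α n - φ + α n = 2 * Real.pi * w - φ by rw [← hw, ← h]; ring]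
      rw [show (2 * Real.pi * w - φ) / Real.pi = (0 - φ) / Real.pi + ((2 * w : ℤ) : ℝ) by
        push_cast; field_simp; ring, Int.floor_add_intCast]
  rw [Finset.card_filter, Finset.card_filter]
  push_cast
  have : ∀ n, (if 0 < edgeWeight α φ n then 1 else 0 : ℤ) =
      (if 0 < α n then 1 else 0) - ((m (n + 1) + if n + 1 = 0 then 2 * w else 0) - m n) := by
    intro n
    have hn := hφ (n + 1)
    rw [edgeWeight, ← hm]
    rw [sin_sub_polarAngle_add_one hw] at hn ⊢
    exact ite_sin_mul_sin_div_sin (hφ n) hn (hα n)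
  simp only [this, Finset.sum_sub_distrib, Finset.sum_add_distrib]
  rw [sum_add_one_eq m, sum_add_one_eq (fun n : Fin N => if n = 0 then 2 * w else 0)]
  simp

/-- Slopes with prescribed increments (relative to `refSin`), realised by heights. -/
def heightsOfIncrements (α L : Fin N → ℝ) (φ : ℝ) : (Fin N → ℝ) →ₗ[ℝ] Heights N where
  toFun d i := i.elim 0 fun n => L n * (refSin α φ n * polarAngle d n)
  map_add' d d' := by
    ext (_ | n)
    · simp
    · simp [polarAngle, Finset.sum_add_distrib]; ring
  map_smul' c d := by
    ext (_ | n)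
    · simp
    · simp [polarAngle, ← Finset.mul_sum]; ring

theorem stressForm_heightsOfIncrements (hα : ∀ n, Real.sin (α n) ≠ 0)
    (hw : ∑ n, α n = 2 * Real.pi * w) (hL : ∀ n, L n ≠ 0)
    {d : Fin N → ℝ} (hd : ∑ n, d n = 0) :
    stressForm α L (heightsOfIncrements α L φ d) = ∑ n, edgeWeight α φ n * d n ^ 2 := by
  have hs : slope L (heightsOfIncrements α L φ d) = fun n => refSin α φ n * polarAngle d n := by
    ext n
    simp [slope, heightsOfIncrements, hL n]
  rw [stressForm_apply α L hL, hs, slopeForm_refSin_mul hα hw]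
  refine Finset.sum_congr rfl fun n _ => ?_
  congr 2
  -- Here `polarAngle d` just means partial sums of the increments; at the wrap the last increment
  -- is recovered because their total is zero.
  rcases polarAngle_add_one d n with ⟨h0, h⟩ | ⟨h0, h⟩
  · rw [h]; ring
  · rw [h0, polarAngle_zero]; linarith

/-- Positivity off zero makes the map injective, so its range is a positive definite subspace of the
same dimension. -/
theorem finrank_le_sigPos {M M' : Type*} [AddCommGroup M] [Module ℝ M] [Module.Finite ℝ M]
    [AddCommGroup M'] [Module ℝ M'] {Q : QuadraticForm ℝ M} (f : M' →ₗ[ℝ] M)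
    (hf : ∀ u, u ≠ 0 → 0 < Q (f u)) : Module.finrank ℝ M' ≤ sigPos Q := by
  have hinj : Function.Injective f := by
    rw [injective_iff_map_eq_zero]
    intro u hu
    by_contra h
    simpa [hu] using hf u h
  rw [← LinearMap.finrank_range_of_inj hinj]
  refine le_sigPos_of_posDef Q ?_
  rintro ⟨_, u, rfl⟩ hu
  exact hf u fun h => hu (by simp [h])

/-- The heights that are affine functions of the position in the plane. -/
def planarHeights (α L : Fin N → ℝ) : (ℝ × ℝ × ℝ) →ₗ[ℝ] Heights N where
  toFun a i := i.elim a.1 fun n => a.1 + L n * linearSlope α a.2.1 a.2.2 n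
  map_add' a b := by
    ext (_ | n)
    · simp
    · simp [linearSlope]; ring
  map_smul' c a := by
    ext (_ | n)
    · simp
    · simp [linearSlope]; ring

theorem slope_planarHeights (hL : ∀ n, L n ≠ 0) (a : ℝ × ℝ × ℝ) :
    slope L (planarHeights α L a) = linearSlope α a.2.1 a.2.2 := by
  ext n
  simp [slope, planarHeights, hL n]

theorem planarHeights_mem_radical (hα : ∀ n, Real.sin (α n) ≠ 0)
    (hw : ∑ n, α n = 2 * Real.pi * w) (hL : ∀ n, L n ≠ 0) (a : ℝ × ℝ × ℝ) :
    planarHeights α L a ∈ (stressForm α L).radical := by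
  rw [mem_radical_stressForm α L hL]
  intro k
  rw [slope_planarHeights hL, slopeForm_linearSlope α hα hw]

/-- Folds 0 and 1 are not parallel, so a linear function vanishing on both is zero. -/
theorem eq_zero_of_linearSlope (hN : 2 ≤ N) (hα : ∀ n, Real.sin (α n) ≠ 0) {a b : ℝ}
    (h0 : linearSlope α a b 0 = 0) (h1 : linearSlope α a b 1 = 0) : a = 0 ∧ b = 0 := by
  simp only [linearSlope, polarAngle_zero, Real.cos_zero, Real.sin_zero, mul_one, mul_zero,
    add_zero, polarAngle_one α hN] at h0 h1
  simp only [h0, zero_mul, zero_add, mul_eq_zero, hα, or_false] at h1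
  exact ⟨h0, h1⟩

theorem planarHeights_injective (hN : 2 ≤ N) (hα : ∀ n, Real.sin (α n) ≠ 0)
    (hL : ∀ n, L n ≠ 0) : Function.Injective (planarHeights α L) := by
  rw [injective_iff_map_eq_zero]
  rintro ⟨a, b, c⟩ h
  have h1 : a = 0 := congrFun h none
  have hs := slope_planarHeights (α := α) hL (a, b, c)
  rw [h] at hs
  obtain ⟨h2, h3⟩ := eq_zero_of_linearSlope hN hα (a := b) (b := c)
    ((congrFun hs 0).symm.trans (by simp [slope])) ((congrFun hs 1).symm.trans (by simp [slope]))
  simp [h1, h2, h3]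

/-- Nullity and signature of the stress form. -/
theorem signature_stressForm (hα : ∀ n, 0 < |α n| ∧ |α n| < Real.pi)
    (hw : ∑ n, α n = 2 * Real.pi * w) (hL : ∀ n, L n ≠ 0) :
    Module.finrank ℝ (stressForm α L).radical = 3 ∧
    (sigPos (stressForm α L) : ℤ) =
      ((Finset.univ.filter fun n => 0 < α n).card : ℤ) - 2 * w - 1 ∧
    (sigNeg (stressForm α L) : ℤ) =
      ((Finset.univ.filter fun n => α n < 0).card : ℤ) + 2 * w - 1 := by
  obtain ⟨φ, hφ⟩ := exists_forall_sin_sub_ne_zero (polarAngle α)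
  change ∀ n, refSin α φ n ≠ 0 at hφ
  have hsin : ∀ n, Real.sin (α n) ≠ 0 := fun n => sin_ne_zero_of_abs (hα n)
  have hN := two_le_of_sum_eq hα hw
  have hpos : {n | 0 < edgeWeight α φ n}.ncard ≤ sigPos (stressForm α L) + 1 := by
    refine (le_finrank_balancedIncrements _).trans (Nat.add_le_add_right ?_ 1)
    refine finrank_le_sigPos ((heightsOfIncrements α L φ).domRestrict _) ?_
    rintro ⟨d, hd⟩ h0
    rw [mem_balancedIncrements] at hd
    change 0 < stressForm α L (heightsOfIncrements α L φ d)
    rw [stressForm_heightsOfIncrements hsin hw hL hd.2]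
    obtain ⟨n, hn⟩ : ∃ n, d n ≠ 0 := by
      by_contra! h
      exact h0 (Subtype.ext (funext h))
    refine Finset.sum_pos' (fun m _ => ?_) ⟨n, Finset.mem_univ _, ?_⟩
    · by_cases hm : 0 < edgeWeight α φ m
      · positivity
      · simp [hd.1 m hm]
    · have : 0 < edgeWeight α φ n := by
        by_contra h
        exact hn (hd.1 n h)
      positivity
  have hneg : {n | edgeWeight α φ n < 0}.ncard ≤ sigNeg (stressForm α L) + 1 := by
    refine (le_finrank_balancedIncrements _).trans (Nat.add_le_add_right ?_ 1)
    rw [← sigPos_neg]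
    refine finrank_le_sigPos ((heightsOfIncrements α L φ).domRestrict _) ?_
    rintro ⟨d, hd⟩ h0
    rw [mem_balancedIncrements] at hd
    change 0 < -stressForm α L (heightsOfIncrements α L φ d)
    rw [stressForm_heightsOfIncrements hsin hw hL hd.2, ← Finset.sum_neg_distrib]
    obtain ⟨n, hn⟩ : ∃ n, d n ≠ 0 := by
      by_contra! h
      exact h0 (Subtype.ext (funext h))
    refine Finset.sum_pos' (fun m _ => ?_) ⟨n, Finset.mem_univ _, ?_⟩
    · by_cases hm : edgeWeight α φ m < 0
      · nlinarith [sq_nonneg (d m)]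
      · simp [hd.1 m hm]
    · have : edgeWeight α φ n < 0 := by
        by_contra h
        exact hn (hd.1 n h)
      have := mul_pos (neg_pos.2 this) (sq_pos_of_ne_zero hn)
      linarith
  have hrad : 3 ≤ Module.finrank ℝ (stressForm α L).radical := by
    have := LinearMap.finrank_le_finrank_of_injective
      (f := (planarHeights α L).codRestrict _ (planarHeights_mem_radical hsin hw hL))
      (fun a b h => planarHeights_injective hN hsin hL (congrArg Subtype.val h))
    simpa using this
  -- The lower bounds f - 2w - 1, b + 2w - 1 and 3 add up to N + 1, the whole dimension, so none of
  -- them can be strict.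
  have htot := QuadraticForm.sigPos_add_sigNeg_add_radical (Q := stressForm α L)
  rw [show Module.finrank ℝ (Heights N) = N + 1 by simp] at htot
  have hc1 := card_edgeWeight_pos hα hw hφ
  have e1 : {n | 0 < edgeWeight α φ n}.ncard =
      (Finset.univ.filter fun n => 0 < edgeWeight α φ n).card := by
    rw [← Set.ncard_coe_finset]; congr 1; ext; simp
  have e2 : {n | edgeWeight α φ n < 0}.ncard =
      (Finset.univ.filter fun n => ¬ 0 < edgeWeight α φ n).card := by
    rw [← Set.ncard_coe_finset]; congr 1; ext n
    have := edgeWeight_ne_zero hsin hφ n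
    simp [this.le_iff_lt]
  have e3 := Finset.card_filter_add_card_filter_not (s := (Finset.univ : Finset (Fin N)))
    (fun n => 0 < edgeWeight α φ n)
  have e4 := Finset.card_filter_add_card_filter_not (s := (Finset.univ : Finset (Fin N)))
    (fun n => 0 < α n)
  have e5 : (Finset.univ.filter fun n => ¬ 0 < α n) = Finset.univ.filter fun n => α n < 0 := by
    ext n
    have := abs_pos.1 (hα n).1
    simp [this.le_iff_lt]
  rw [e5] at e4
  rw [e1] at hpos
  rw [e2] at hneg
  simp only [Finset.card_univ, Fintype.card_fin] at e3 e4
  omega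

/-- The affine functions fill three dimensions of a radical of dimension three, hence all of it. The
form in slopes does not involve the lengths, so they may be taken equal to 1. -/
theorem eq_linearSlope_of_slopeForm_eq_zero (hα : ∀ n, 0 < |α n| ∧ |α n| < Real.pi)
    (hw : ∑ n, α n = 2 * Real.pi * w) {z : Fin N → ℝ} (hz : ∀ y, slopeForm α z y = 0) :
    ∃ a b, z = linearSlope α a b := by
  have hsin : ∀ n, Real.sin (α n) ≠ 0 := fun n => sin_ne_zero_of_abs (hα n)
  have h1 : ∀ n : Fin N, (1 : ℝ) ≠ 0 := fun _ => one_ne_zero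
  have hr : LinearMap.range (planarHeights α fun _ => 1) = (stressForm α fun _ => 1).radical := by
    refine Submodule.eq_of_le_of_finrank_eq ?_ ?_
    · rintro _ ⟨a, rfl⟩
      exact planarHeights_mem_radical hsin hw h1 a
    · rw [(signature_stressForm hα hw h1).1,
        LinearMap.finrank_range_of_inj (planarHeights_injective (two_le_of_sum_eq hα hw) hsin h1)]
      simp
  let h : Heights N := fun i => i.elim 0 z
  have hs : slope (fun _ => 1) h = z := by
    ext n
    simp [slope, h]
  have hh : h ∈ LinearMap.range (planarHeights α fun _ => 1) := by
    rw [hr, mem_radical_stressForm α _ h1, hs]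
    exact fun k => hz _
  obtain ⟨a, ha⟩ := hh
  exact ⟨a.2.1, a.2.2, by rw [← slope_planarHeights h1, ha, hs]⟩

end Signature

/-! ### Slopes vanishing on the reference face -/

section Slice

/-- The slopes relative to a face: those that vanish on the folds `0` and `1`. -/
def sliceSubmodule (N : ℕ) [NeZero N] : Submodule ℝ (Fin N → ℝ) where
  carrier := {z | z 0 = 0 ∧ z 1 = 0}
  zero_mem' := ⟨rfl, rfl⟩
  add_mem' := fun ha hb => ⟨by simp [ha.1, hb.1], by simp [ha.2, hb.2]⟩
  smul_mem' := fun c a ha => ⟨by simp [ha.1], by simp [ha.2]⟩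

/-- The slopes relative to a face, as a normed space. -/
abbrev Slice (N : ℕ) [NeZero N] : Type := sliceSubmodule N

variable {N : ℕ} [NeZero N]

/-- The inclusion of the slice. -/
def sliceIncl : Slice N →L[ℝ] (Fin N → ℝ) := (sliceSubmodule N).subtypeL

/-- The coordinates on the slice. -/
def sliceCoord (n : Fin N) : Slice N →L[ℝ] ℝ :=
  (ContinuousLinearMap.proj n).comp sliceIncl

theorem sliceCoord_apply (n : Fin N) (y : Slice N) : sliceCoord n y = y.1 n := rfl

end Slice

/-! ### Lengths of projected folds -/

section ProjNorm

variable {N : ℕ}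

/-- The length of the horizontal projection of a unit vector of slope `z n`. -/
def projNorm (z : Fin N → ℝ) (n : Fin N) : ℝ := √(1 - z n ^ 2)

theorem projNorm_pos {z : Fin N → ℝ} {n : Fin N} (h : |z n| < 1) : 0 < projNorm z n := by
  refine Real.sqrt_pos.2 ?_
  have := (sq_lt_one_iff_abs_lt_one (z n)).2 h
  linarith

theorem projNorm_sq {z : Fin N → ℝ} {n : Fin N} (h : |z n| < 1) :
    projNorm z n ^ 2 = 1 - z n ^ 2 := by
  refine Real.sq_sqrt ?_
  have := (sq_lt_one_iff_abs_lt_one (z n)).2 h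
  linarith

theorem contDiffAt_projNorm (n : Fin N) : ContDiffAt ℝ ⊤ (fun z : Fin N → ℝ => projNorm z n) 0 := by
  refine ContDiffAt.sqrt (by fun_prop) (by simp)

theorem cos_ne_of_abs {x : ℝ} (h : 0 < |x| ∧ |x| < Real.pi) : Real.cos x ≠ -1 ∧ Real.cos x ≠ 1 := by
  have hs := sin_ne_zero_of_abs h
  have := Real.sin_sq_add_cos_sq x
  constructor <;> intro h <;> apply hs <;> rw [h] at this <;> nlinarith

end ProjNorm

/-! ### The closing defect as a quadratic form with variable coefficients -/

section ProjectedAngles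

variable {N : ℕ} [NeZero N] (α : Fin N → ℝ) (z : Fin N → ℝ)

/-- The cosine of the angle between the horizontal projections of consecutive folds. -/
def projCos (n : Fin N) : ℝ :=
  (Real.cos (α n) - z n * z (n + 1)) / (projNorm z n * projNorm z (n + 1))

/-- The signed angle between the horizontal projections of consecutive folds. -/
def projAngle (n : Fin N) : ℝ := SignType.sign (α n) * Real.arccos (projCos α z n)

/-- The common factor of the coefficients of `angleForm`. -/
def angleFactor (n : Fin N) : ℝ :=
  -2 * SignType.sign (α n) * dslope Real.arccos (Real.cos (α n)) (projCos α z n) /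
    (projNorm z n * projNorm z (n + 1))

/-- The symmetric bilinear form, depending on the slopes, whose quadratic form is minus twice the
total change of the projected angles. -/
def angleForm (z : Slice N) : Slice N →L[ℝ] Slice N →L[ℝ] ℝ :=
  ∑ n, ((-angleFactor α z.1 n / 2) • ((sliceCoord n).smulRight (sliceCoord (n + 1)) +
        (sliceCoord (n + 1)).smulRight (sliceCoord n)) +
      (angleFactor α z.1 n * (Real.cos (α n) / (1 + projNorm z.1 n * projNorm z.1 (n + 1)))) •
      ((1 - z.1 (n + 1) ^ 2) • (sliceCoord n).smulRight (sliceCoord n) +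
        (sliceCoord (n + 1)).smulRight (sliceCoord (n + 1))))

theorem angleForm_apply (z x y : Slice N) : angleForm α z x y =
    ∑ n, (-angleFactor α z.1 n / 2 * (x.1 n * y.1 (n + 1) + x.1 (n + 1) * y.1 n) +
      angleFactor α z.1 n * (Real.cos (α n) / (1 + projNorm z.1 n * projNorm z.1 (n + 1))) *
      ((1 - z.1 (n + 1) ^ 2) * (x.1 n * y.1 n) + x.1 (n + 1) * y.1 (n + 1))) := by
  simp [angleForm, sliceCoord_apply, mul_add]

theorem angleForm_comm (z x y : Slice N) : angleForm α z x y = angleForm α z y x := by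
  rw [angleForm_apply, angleForm_apply]
  exact Finset.sum_congr rfl fun n _ => by ring

variable {α}

theorem sign_mul_arccos_cos {x : ℝ} (h : 0 < |x| ∧ |x| < Real.pi) :
    SignType.sign x * Real.arccos (Real.cos x) = x := by
  rw [← Real.cos_abs, Real.arccos_cos h.1.le h.2.le, mul_comm, abs_mul_sign]

theorem projAngle_eq_of_zero (hα : ∀ n, 0 < |α n| ∧ |α n| < Real.pi) {z : Fin N → ℝ} {n : Fin N}
    (h0 : z n = 0) (h1 : z (n + 1) = 0) : projAngle α z n = α n := by
  have : projCos α z n = Real.cos (α n) := by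
    simp [projCos, projNorm, h0, h1]
  rw [projAngle, this, sign_mul_arccos_cos (hα n)]

/-- The change of arccos is the change of the cosine times a divided difference. With r, r' the
projected lengths, the cosine changes by (cos α_n (1 - r r') - z_n z_{n+1}) / (r r'), and 1 - r r' =
(z_n² (1 - z_{n+1}²) + z_{n+1}²) / (1 + r r'). This identity explains the asymmetric coefficients of
`angleForm`. -/
theorem angleForm_self (hα : ∀ n, 0 < |α n| ∧ |α n| < Real.pi) {z : Slice N}
    (hz : ∀ n, |z.1 n| < 1) :
    angleForm α z z z = -2 * (∑ n, projAngle α z.1 n - ∑ n, α n) := by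
  rw [angleForm_apply, ← Finset.sum_sub_distrib, Finset.mul_sum]
  refine Finset.sum_congr rfl fun n _ => ?_
  have e1 : projAngle α z.1 n - α n = SignType.sign (α n) *
      ((projCos α z.1 n - Real.cos (α n)) *
        dslope Real.arccos (Real.cos (α n)) (projCos α z.1 n)) := by
    rw [← smul_eq_mul (projCos α z.1 n - _), sub_smul_dslope, mul_sub, sign_mul_arccos_cos (hα n)]
    rfl
  rw [e1, angleFactor]
  simp only [projCos]
  have p1 := projNorm_pos (hz n)
  have p2 := projNorm_pos (hz (n + 1))
  have q1 := projNorm_sq (hz n)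
  have q2 := projNorm_sq (hz (n + 1))
  set D := dslope Real.arccos (Real.cos (α n)) _
  set r := projNorm z.1 n
  set r' := projNorm z.1 (n + 1)
  have p3 : 1 + r * r' ≠ 0 := by positivity
  have q3 : z.1 n ^ 2 = 1 - r ^ 2 := by linarith
  have q4 : z.1 (n + 1) ^ 2 = 1 - r' ^ 2 := by linarith
  have q5 : z.1 n * z.1 n = 1 - r ^ 2 := by linarith
  have q6 : z.1 (n + 1) * z.1 (n + 1) = 1 - r' ^ 2 := by linarith
  rw [q4, q5, q6]
  field_simp
  ring

/-- The derivative of arccos at cos α_n is -1/|sin α_n|, and the sign of α_n removes the absolute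
value. -/
theorem angleFactor_zero (n : Fin N) (hα : ∀ n, 0 < |α n| ∧ |α n| < Real.pi) :
    angleFactor α 0 n = 2 / Real.sin (α n) := by
  have hs := sin_ne_zero_of_abs (hα n)
  have h1 : projCos α 0 n = Real.cos (α n) := by simp [projCos, projNorm]
  rw [angleFactor, h1, dslope_same, (Real.hasDerivAt_arccos (cos_ne_of_abs (hα n)).1 (cos_ne_of_abs (hα n)).2).deriv,
    ← Real.abs_sin_eq_sqrt_one_sub_cos_sq]
  have h2 : ((SignType.sign (α n) : ℝ)) / |Real.sin (α n)| = 1 / Real.sin (α n) := by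
    rcases lt_or_gt_of_ne (abs_pos.1 (hα n).1) with h | h
    · have hα' := (hα n).2
      rw [abs_of_neg h] at hα'
      have := Real.sin_neg_of_neg_of_neg_pi_lt h (by linarith)
      rw [sign_neg h, abs_of_neg this]
      simp [neg_div_neg_eq]
    · have hα' := (hα n).2
      rw [abs_of_pos h] at hα'
      have := Real.sin_pos_of_pos_of_lt_pi h hα'
      rw [sign_pos h, abs_of_pos this]
      simp
  simp only [projNorm, Pi.zero_apply]
  norm_num
  rw [show ∀ a b : ℝ, 2 * a * b⁻¹ = 2 * (a / b) from fun a b => by ring, h2]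
  ring

theorem angleForm_zero (hα : ∀ n, 0 < |α n| ∧ |α n| < Real.pi) (x y : Slice N) :
    angleForm α 0 x y = slopeForm α x.1 y.1 := by
  rw [angleForm_apply, slopeForm]
  refine Finset.sum_congr rfl fun n _ => ?_
  have hs := sin_ne_zero_of_abs (hα n)
  rw [Submodule.coe_zero, angleFactor_zero n hα, Real.cot_eq_cos_div_sin]
  simp only [projNorm, Pi.zero_apply]
  norm_num
  field_simp
  ring

theorem analyticAt_arccos {x : ℝ} (h1 : x ≠ -1) (h2 : x ≠ 1) : AnalyticAt ℝ Real.arccos x :=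
  (Real.contDiffAt_arccos h1 h2 (n := ⊤)).analyticAt

theorem contDiffAt_projCos (n : Fin N) :
    ContDiffAt ℝ ⊤ (fun z : Fin N → ℝ => projCos α z n) 0 := by
  refine ContDiffAt.div (by fun_prop)
    ((contDiffAt_projNorm n).mul (contDiffAt_projNorm (n + 1))) (by simp [projNorm])

theorem contDiffAt_projAngle (hα : ∀ n, 0 < |α n| ∧ |α n| < Real.pi) (n : Fin N) :
    ContDiffAt ℝ ⊤ (fun z : Fin N → ℝ => projAngle α z n) 0 := by
  have h1 : projCos α 0 n = Real.cos (α n) := by simp [projCos, projNorm]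
  refine contDiffAt_const.mul
    (ContDiffAt.comp (g := Real.arccos) (0 : Fin N → ℝ) ?_ (contDiffAt_projCos n))
  rw [h1]
  exact Real.contDiffAt_arccos (cos_ne_of_abs (hα n)).1 (cos_ne_of_abs (hα n)).2

theorem contDiffAt_angleFactor (hα : ∀ n, 0 < |α n| ∧ |α n| < Real.pi) (n : Fin N) :
    ContDiffAt ℝ ⊤ (fun z : Fin N → ℝ => angleFactor α z n) 0 := by
  have h1 : projCos α 0 n = Real.cos (α n) := by simp [projCos, projNorm]
  refine ContDiffAt.div (contDiffAt_const.mul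
    (ContDiffAt.comp (0 : Fin N → ℝ) ?_ (contDiffAt_projCos n)))
    ((contDiffAt_projNorm n).mul (contDiffAt_projNorm (n + 1))) (by simp [projNorm])
  rw [h1]
  -- The divided difference of an analytic function is analytic: its power series is the shifted
  -- one.
  obtain ⟨p, hp⟩ := analyticAt_arccos (cos_ne_of_abs (hα n)).1 (cos_ne_of_abs (hα n)).2
  exact hp.has_fpower_series_dslope_fslope.analyticAt.contDiffAt

theorem analyticAt_angleForm (hα : ∀ n, 0 < |α n| ∧ |α n| < Real.pi) :
    AnalyticAt ℝ (angleForm α) 0 := by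
  have hc : ∀ {f : (Fin N → ℝ) → ℝ}, ContDiffAt ℝ ⊤ f 0 →
      ContDiffAt ℝ ⊤ (fun z : Slice N => f z.1) 0 := fun hf =>
    ContDiffAt.comp (0 : Slice N) (g := _) hf sliceIncl.contDiff.contDiffAt
  have hz : ∀ n, ContDiffAt ℝ ⊤ (fun z : Slice N => z.1 n) 0 := fun n =>
    (sliceCoord n).contDiff.contDiffAt
  refine ContDiffAt.analyticAt (ContDiffAt.sum fun n _ => ?_)
  have h1 := hc (contDiffAt_angleFactor hα n)
  have h2 := hc (contDiffAt_projNorm n)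
  have h3 := hc (contDiffAt_projNorm (n + 1))
  refine ContDiffAt.add (ContDiffAt.smul (h1.neg.div_const 2) contDiffAt_const) ?_
  refine ContDiffAt.smul (h1.mul (contDiffAt_const.div (contDiffAt_const.add (h2.mul h3)) ?_))
    (ContDiffAt.add (ContDiffAt.smul (contDiffAt_const.sub ((hz (n + 1)).pow 2)) contDiffAt_const)
      contDiffAt_const)
  simp [projNorm]

/-- Every vector of slopes is a linear function plus an element of the slice. -/
theorem exists_linearSlope_add_slice (hN : 2 ≤ N) (hα : ∀ n, Real.sin (α n) ≠ 0) (z : Fin N → ℝ) :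
    z - linearSlope α (z 0) ((z 1 - Real.cos (α 0) * z 0) / Real.sin (α 0)) ∈ sliceSubmodule N := by
  constructor
  · simp [linearSlope]
  · simp only [Pi.sub_apply, linearSlope, polarAngle_one α hN]
    field_simp [hα 0]
    ring

/-- The slice is a complement of the linear slopes, which are in the radical. So a vector orthogonal
to the slice is orthogonal to everything, hence linear, and a linear slope vanishing on folds 0 and
1 is zero. -/
theorem slopeForm_slice_nondegenerate (hα : ∀ n, 0 < |α n| ∧ |α n| < Real.pi) {w : ℤ}
    (hw : ∑ n, α n = 2 * Real.pi * w) (x : Slice N) (hx : ∀ y : Slice N, slopeForm α x.1 y.1 = 0) :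
    x = 0 := by
  have hsin : ∀ n, Real.sin (α n) ≠ 0 := fun n => sin_ne_zero_of_abs (hα n)
  have hN := two_le_of_sum_eq hα hw
  obtain ⟨a, b, hab⟩ := eq_linearSlope_of_slopeForm_eq_zero hα hw (z := x.1) fun y => by
    have h := hx ⟨_, exists_linearSlope_add_slice hN hsin y⟩
    have h2 := slopeForm_linearSlope α hsin hw (y 0)
      ((y 1 - Real.cos (α 0) * y 0) / Real.sin (α 0)) x.1
    rw [slopeForm_comm] at h2
    rw [← add_zero (slopeForm α x.1 y), ← sub_add_cancel y (linearSlope α (y 0)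
      ((y 1 - Real.cos (α 0) * y 0) / Real.sin (α 0))), slopeForm_add_right, h2]
    simpa using h
  obtain ⟨rfl, rfl⟩ := eq_zero_of_linearSlope hN hsin
    (by rw [← hab]; exact x.2.1) (by rw [← hab]; exact x.2.2)
  ext n
  rw [hab]
  simp [linearSlope]

end ProjectedAngles

/-! ### Heights as slice plus affine functions -/

section Coordinates

variable {N : ℕ} [NeZero N] {α L : Fin N → ℝ}

/-- Linear coordinates on the heights: the slopes relative to a face, and the affine functions. -/
def heightsEquiv (hN : 2 ≤ N) (hα : ∀ n, Real.sin (α n) ≠ 0) (hL : ∀ n, L n ≠ 0) :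
    Heights N ≃L[ℝ] Slice N × (ℝ × ℝ × ℝ) :=
  LinearEquiv.toContinuousLinearEquiv
  { toFun := fun h => (⟨_, exists_linearSlope_add_slice hN hα (slope L h)⟩,
      (h none, slope L h 0, (slope L h 1 - Real.cos (α 0) * slope L h 0) / Real.sin (α 0)))
    map_add' := fun h k => by
      refine Prod.ext (Subtype.ext ?_) (Prod.ext ?_ (Prod.ext ?_ ?_))
      · ext n; simp [slope_add, linearSlope]; ring
      · simp
      · simp [slope_add]
      · simp [slope_add]; ring
    map_smul' := fun c h => by
      refine Prod.ext (Subtype.ext ?_) (Prod.ext ?_ (Prod.ext ?_ ?_))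
      · ext n; simp [slope_smul, linearSlope]; ring
      · simp
      · simp [slope_smul]
      · simp [slope_smul]; ring
    invFun := fun p i => planarHeights α L p.2 i + i.elim 0 fun n => L n * p.1.1 n
    left_inv := fun h => by
      ext (_ | n)
      · simp [planarHeights]
      · have := hL n
        simp only [planarHeights, LinearMap.coe_mk, AddHom.coe_mk, Option.elim, Pi.sub_apply]
        rw [add_assoc, ← mul_add, add_sub_cancel, slope]
        field_simp
        ring
    right_inv := fun p => by
      have hs : slope L (fun i => planarHeights α L p.2 i +
          i.elim 0 fun n => L n * p.1.1 n) = linearSlope α p.2.2.1 p.2.2.2 + p.1.1 := by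
        ext n
        have := hL n
        simp [slope, planarHeights]
        field_simp
        ring
      have h0 := p.1.2.1
      have h1 := p.1.2.2
      have e0 : (linearSlope α p.2.2.1 p.2.2.2 + p.1.1) 0 = p.2.2.1 := by
        simp [linearSlope, h0]
      have e1 : ((linearSlope α p.2.2.1 p.2.2.2 + p.1.1) 1 - Real.cos (α 0) * p.2.2.1) /
          Real.sin (α 0) = p.2.2.2 := by
        have := hα 0
        simp [linearSlope, h1, polarAngle_one α hN]
        field_simp
        ring
      refine Prod.ext (Subtype.ext ?_) (Prod.ext ?_ (Prod.ext ?_ ?_))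
      · simp only [hs, e0, e1]
        simp
      · simp [planarHeights]
      · simp only [hs, e0]
      · simp only [hs, e0, e1] }

theorem heightsEquiv_symm_apply (hN : 2 ≤ N) (hα : ∀ n, Real.sin (α n) ≠ 0) (hL : ∀ n, L n ≠ 0)
    (p : Slice N × (ℝ × ℝ × ℝ)) (i : Vertex N) : (heightsEquiv hN hα hL).symm p i =
      planarHeights α L p.2 i + i.elim 0 fun n => L n * p.1.1 n := rfl

theorem slope_heightsEquiv_symm (hN : 2 ≤ N) (hα : ∀ n, Real.sin (α n) ≠ 0) (hL : ∀ n, L n ≠ 0)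
    (p : Slice N × (ℝ × ℝ × ℝ)) : slope L ((heightsEquiv hN hα hL).symm p) =
      linearSlope α p.2.2.1 p.2.2.2 + p.1.1 := by
  ext n
  have := hL n
  simp [slope, planarHeights, heightsEquiv_symm_apply]
  field_simp
  ring

theorem stressForm_heightsEquiv_symm (hN : 2 ≤ N) (hα : ∀ n, Real.sin (α n) ≠ 0)
    (hL : ∀ n, L n ≠ 0) {w : ℤ} (hw : ∑ n, α n = 2 * Real.pi * w) (p : Slice N × (ℝ × ℝ × ℝ)) :
    stressForm α L ((heightsEquiv hN hα hL).symm p) = slopeForm α p.1.1 p.1.1 := by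
  rw [stressForm_apply α L hL, slope_heightsEquiv_symm, slopeForm_add_left, slopeForm_add_right,
    slopeForm_linearSlope α hα hw, slopeForm_linearSlope α hα hw, slopeForm_comm α p.1.1,
    slopeForm_add_left, slopeForm_linearSlope α hα hw]
  ring

end Coordinates

/-! ### Orthonormal frames in space -/

section Frames

/-- The matrix with rows f, g, f × g satisfies F Fᵀ = 1, and for square matrices this gives Fᵀ F =
1, which is the expansion. -/
theorem orthonormal_expand {f g : Fin 3 → ℝ} (hf : f ⬝ᵥ f = 1) (hg : g ⬝ᵥ g = 1) (hfg : f ⬝ᵥ g = 0)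
    (u : Fin 3 → ℝ) :
    u = (f ⬝ᵥ u) • f + (g ⬝ᵥ u) • g + ((crossProduct f g) ⬝ᵥ u) • crossProduct f g := by
  let F : Matrix (Fin 3) (Fin 3) ℝ := Matrix.of ![f, g, crossProduct f g]
  have h1 : F * Fᵀ = 1 := by
    have hh : crossProduct f g ⬝ᵥ crossProduct f g = 1 := by
      rw [cross_dot_cross, hf, hg, hfg, dotProduct_comm g f, hfg]; ring
    have h2 := dot_self_cross f g
    have h3 := dot_cross_self f g
    have hv : ∀ i j, (![f, g, crossProduct f g] i) ⬝ᵥ (![f, g, crossProduct f g] j) =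
        (1 : Matrix (Fin 3) (Fin 3) ℝ) i j := by
      intro i j
      fin_cases i <;> fin_cases j <;>
        simp [hf, hg, hfg, hh, h2, h3, dotProduct_comm g f,
          dotProduct_comm (crossProduct f g) f, dotProduct_comm (crossProduct f g) g]
    ext i j
    exact hv i j
  have h2 : Fᵀ * F = 1 := mul_eq_one_comm.1 h1
  have h3 : Fᵀ *ᵥ (F *ᵥ u) = u := by rw [Matrix.mulVec_mulVec, h2, Matrix.one_mulVec]
  conv_lhs => rw [← h3]
  ext i
  simp [F, Matrix.mulVec, dotProduct, Fin.sum_univ_three]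
  ring

theorem orthonormal_combination_dot {f g : Fin 3 → ℝ} (hf : f ⬝ᵥ f = 1) (hg : g ⬝ᵥ g = 1)
    (hfg : f ⬝ᵥ g = 0) (a b c a' b' c' : ℝ) :
    (a • f + b • g + c • crossProduct f g) ⬝ᵥ (a' • f + b' • g + c' • crossProduct f g) =
      a * a' + b * b' + c * c' := by
  have hh : crossProduct f g ⬝ᵥ crossProduct f g = 1 := by
    rw [cross_dot_cross, hf, hg, hfg, dotProduct_comm g f, hfg]; ring
  simp only [dotProduct_add, add_dotProduct, dotProduct_smul, smul_dotProduct, hf, hg, hfg, hh,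
    dotProduct_comm g f, dot_self_cross, dot_cross_self, dotProduct_comm (crossProduct f g) f,
    dotProduct_comm (crossProduct f g) g, smul_eq_mul]
  ring

end Frames

/-! ### Closed chains of unit vectors -/

section Chain

variable {N : ℕ} [NeZero N]

theorem cyclic_induction {P : Fin N → Prop} (h0 : P 0) (hs : ∀ n, n + 1 ≠ 0 → P n → P (n + 1))
    (n : Fin N) : P n := by
  obtain ⟨k, hk⟩ := n
  induction k with
  | zero => exact h0
  | succ k ih =>
    have h1 : (⟨k, by omega⟩ : Fin N) + 1 = ⟨k + 1, hk⟩ := by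
      ext
      rw [Fin.val_add, Fin.val_one', Nat.add_mod_mod, Nat.mod_eq_of_lt hk]
    rw [← h1]
    refine hs _ ?_ (ih _)
    rw [h1]
    intro h
    simpa using congrArg Fin.val h

theorem exists_add_one_eq_zero : ∃ n : Fin N, n + 1 = 0 := ⟨-1, by simp⟩

/-- Multiplying the turns once around the cycle leads back to `d 0`; the step at the wrap is the
closing condition. -/
theorem exp_polarAngle_of_chain {β : Fin N → ℝ} {d : Fin N → ℂ} (h0 : d 0 = 1)
    (hd : ∀ n, d (n + 1) = d n * Complex.exp (β n * Complex.I)) :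
    (∀ n, d n = Complex.exp (polarAngle β n * Complex.I)) ∧
      Complex.exp ((∑ n, β n : ℝ) * Complex.I) = 1 := by
  have h1 : ∀ n, d n = Complex.exp (polarAngle β n * Complex.I) := by
    refine cyclic_induction (by simp [h0]) fun n hn ih => ?_
    rcases polarAngle_add_one β n with ⟨_, h⟩ | ⟨h, _⟩
    · rw [hd, ih, h, ← Complex.exp_add]
      push_cast; ring_nf
    · exact absurd h hn
  refine ⟨h1, ?_⟩
  obtain ⟨n, hn⟩ := exists_add_one_eq_zero (N := N)
  rcases polarAngle_add_one β n with ⟨h, _⟩ | ⟨_, h⟩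
  · exact absurd hn h
  · rw [← h]
    push_cast
    rw [add_mul, Complex.exp_add, ← h1, ← hd, hn, h0]

/-- The exponential determines a total turn only up to multiples of 2π; closeness to the unfolded
state singles out the winding w. -/
theorem eq_of_exp_eq_one {x : ℝ} {w : ℤ} (h : Complex.exp (x * Complex.I) = 1)
    (hx : |x - 2 * Real.pi * w| < 2 * Real.pi) : x = 2 * Real.pi * w := by
  obtain ⟨k, hk⟩ := Complex.exp_eq_one_iff.1 h
  have hk' : x = k * (2 * Real.pi) := by
    have := congrArg Complex.im hk
    simpa using this
  have h2 : |(k : ℝ) - w| < 1 := by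
    have : x - 2 * Real.pi * w = (2 * Real.pi) * ((k : ℝ) - w) := by rw [hk']; ring
    rw [this, abs_mul, abs_of_pos Real.two_pi_pos] at hx
    nlinarith [Real.pi_pos]
  have h3 : k = w := by
    have : |k - w| < 1 := by exact_mod_cast h2
    have := Int.abs_lt_one_iff.1 this
    omega
  rw [hk', h3]; ring

variable {α : Fin N → ℝ}

theorem cos_projAngle (hα : ∀ n, 0 < |α n| ∧ |α n| < Real.pi) {z : Fin N → ℝ} {n : Fin N}
    (h : |projCos α z n| ≤ 1) : Real.cos (projAngle α z n) = projCos α z n := by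
  rw [abs_le] at h
  rw [projAngle]
  rcases lt_or_gt_of_ne (abs_pos.1 (hα n).1) with h0 | h0
  · rw [sign_neg h0]
    simp [Real.cos_arccos h.1 h.2]
  · rw [sign_pos h0]
    simp [Real.cos_arccos h.1 h.2]

theorem sin_projAngle (hα : ∀ n, 0 < |α n| ∧ |α n| < Real.pi) (z : Fin N → ℝ) (n : Fin N) :
    Real.sin (projAngle α z n) = SignType.sign (α n) * √(1 - projCos α z n ^ 2) := by
  rw [projAngle]
  rcases lt_or_gt_of_ne (abs_pos.1 (hα n).1) with h0 | h0
  · rw [sign_neg h0]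
    simp [Real.sin_arccos]
  · rw [sign_pos h0]
    simp [Real.sin_arccos]

/-- The horizontal projections of a chain of unit vectors are determined by the slopes. -/
theorem chain_of_slopes (hα : ∀ n, 0 < |α n| ∧ |α n| < Real.pi) {z x y : Fin N → ℝ}
    (hz : ∀ n, |z n| < 1) (h0x : x 0 = 1) (h0y : y 0 = 0)
    (h1 : ∀ n, x n * x n + y n * y n + z n * z n = 1)
    (h2 : ∀ n, x n * x (n + 1) + y n * y (n + 1) + z n * z (n + 1) = Real.cos (α n))
    (h3 : ∀ n, 0 < α n * (x n * y (n + 1) - y n * x (n + 1))) :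
    (∀ n, x n = projNorm z n * Real.cos (polarAngle (projAngle α z) n) ∧
      y n = projNorm z n * Real.sin (polarAngle (projAngle α z) n)) ∧
      Complex.exp ((∑ n, projAngle α z n : ℝ) * Complex.I) = 1 := by
  have hr := fun n => projNorm_pos (hz n)
  have hr2 : ∀ n, projNorm z n ^ 2 = x n ^ 2 + y n ^ 2 := fun n => by
    rw [projNorm_sq (hz n)]; linarith [h1 n]
  have hc : ∀ n, projNorm z n * projNorm z (n + 1) * projCos α z n =
      x n * x (n + 1) + y n * y (n + 1) := fun n => by
    have := (hr n).ne'
    have := (hr (n + 1)).ne'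
    rw [projCos]
    field_simp
    linarith [h2 n]
  -- Lagrange's identity. It bounds `projCos` by 1 and gives the sine of the turn up to sign; the
  -- orientation hypothesis `h3` fixes the sign.
  have hlag : ∀ n, (projNorm z n * projNorm z (n + 1)) ^ 2 =
      (x n * x (n + 1) + y n * y (n + 1)) ^ 2 + (x n * y (n + 1) - y n * x (n + 1)) ^ 2 :=
    fun n => by
      rw [mul_pow, hr2, hr2]; ring
  have hcos : ∀ n, |projCos α z n| ≤ 1 := fun n => by
    have hp := mul_pos (hr n) (hr (n + 1))
    rw [← sq_le_one_iff_abs_le_one]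
    have h4 := hlag n
    rw [← hc n, mul_pow _ (projCos α z n)] at h4
    have h5 : 0 < (projNorm z n * projNorm z (n + 1)) ^ 2 := by positivity
    nlinarith [sq_nonneg (x n * y (n + 1) - y n * x (n + 1))]
  have hsin : ∀ n, projNorm z n * projNorm z (n + 1) * Real.sin (projAngle α z n) =
      x n * y (n + 1) - y n * x (n + 1) := fun n => by
    have hp := mul_pos (hr n) (hr (n + 1))
    have h4 : projNorm z n * projNorm z (n + 1) * √(1 - projCos α z n ^ 2) =
        |x n * y (n + 1) - y n * x (n + 1)| := by
      rw [← Real.sqrt_sq_eq_abs, ← abs_of_pos hp, ← Real.sqrt_sq_eq_abs,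
        ← Real.sqrt_mul (sq_nonneg _)]
      congr 1
      have := hlag n
      rw [← hc n] at this
      linear_combination this
    rw [sin_projAngle hα, mul_left_comm, h4]
    rcases lt_or_gt_of_ne (abs_pos.1 (hα n).1) with h0 | h0
    · have : x n * y (n + 1) - y n * x (n + 1) < 0 := by
        by_contra h
        nlinarith [h3 n]
      rw [sign_neg h0, abs_of_neg this]; simp
    · have : 0 < x n * y (n + 1) - y n * x (n + 1) := by
        by_contra h
        nlinarith [h3 n]
      rw [sign_pos h0, abs_of_pos this]; simp
  -- The normalised projections, as unit complex numbers; consecutive ones differ by the factor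
  -- exp(iβ_n).
  let d : Fin N → ℂ := fun n => ⟨x n / projNorm z n, y n / projNorm z n⟩
  have hz0 : projNorm z 0 = 1 := by
    have := hr2 0
    rw [h0x, h0y] at this
    nlinarith [hr 0]
  obtain ⟨h4, h5⟩ := exp_polarAngle_of_chain (β := projAngle α z) (d := d)
    (by apply Complex.ext <;> simp [d, h0x, h0y, hz0]) fun n => by
      have := (hr n).ne'
      have := (hr (n + 1)).ne'
      have e1 := hc n
      rw [← cos_projAngle hα (hcos n)] at e1
      have e2 := hsin n
      have e3 := hr2 n
      apply Complex.ext
      · rw [Complex.mul_re, Complex.exp_ofReal_mul_I_re, Complex.exp_ofReal_mul_I_im]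
        simp only [d]
        field_simp
        apply mul_left_cancel₀ (pow_ne_zero 2 (hr n).ne')
        linear_combination x n * projNorm z n * e1 * (-1) + y n * projNorm z n * e2 +
          projNorm z n * x (n + 1) * e3
      · rw [Complex.mul_im, Complex.exp_ofReal_mul_I_re, Complex.exp_ofReal_mul_I_im]
        simp only [d]
        field_simp
        apply mul_left_cancel₀ (pow_ne_zero 2 (hr n).ne')
        linear_combination y n * projNorm z n * e1 * (-1) - x n * projNorm z n * e2 +
          projNorm z n * y (n + 1) * e3
  refine ⟨fun n => ?_, h5⟩
  have h6 := h4 n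
  have h7 := congrArg Complex.re h6
  have h8 := congrArg Complex.im h6
  rw [Complex.exp_ofReal_mul_I_re] at h7
  rw [Complex.exp_ofReal_mul_I_im] at h8
  have := (hr n).ne'
  constructor
  · rw [← h7]; simp only [d]; field_simp
  · rw [← h8]; simp only [d]; field_simp

end Chain

/-! ### Configurations as relations between fold directions -/

section Config

variable {N : ℕ} [NeZero N] {α L : Fin N → ℝ}

/-- The direction of the `n`-th fold. -/
def foldDir (L : Fin N → ℝ) (X : Placement N) (n : Fin N) : Fin 3 → ℝ :=
  fun i => (X (some n) i - X none i) / L n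

theorem dist_sq_eq (x y : Space) : dist x y ^ 2 = ∑ i, (x i - y i) ^ 2 := by
  rw [EuclideanSpace.dist_eq, Real.sq_sqrt (by positivity)]
  simp [Real.dist_eq, sq_abs]

theorem foldDir_flatState (hL : ∀ n, 0 < L n) (n : Fin N) : foldDir L (flatState α L) n =
    ![Real.cos (polarAngle α n), Real.sin (polarAngle α n), 0] := by
  have := (hL n).ne'
  ext i
  fin_cases i <;> simp [foldDir, flatState, this]

theorem foldDir_flatState_dot {w : ℤ} (hw : ∑ n, α n = 2 * Real.pi * w) (hL : ∀ n, 0 < L n)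
    (n : Fin N) :
    foldDir L (flatState α L) n ⬝ᵥ foldDir L (flatState α L) n = 1 ∧
    foldDir L (flatState α L) n ⬝ᵥ foldDir L (flatState α L) (n + 1) = Real.cos (α n) := by
  simp only [foldDir_flatState hL, dotProduct, Fin.sum_univ_three]
  obtain ⟨h1, h2⟩ := exp_polarAngle_add_one α w hw n
  rw [h1, h2, Real.cos_add, Real.sin_add]
  have h3 := Real.sin_sq_add_cos_sq (polarAngle α n)
  constructor
  · simp; linarith
  · simp; linear_combination Real.cos (α n) * h3

/-- Law of cosines: once the folds have the right lengths, the length of a rim edge is equivalent to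
the cosine of the angle between its two folds. -/
theorem mem_configSpace_iff {w : ℤ} (hw : ∑ n, α n = 2 * Real.pi * w) (hL : ∀ n, 0 < L n)
    (X : Placement N) : X ∈ configSpace α L ↔ ∀ n, foldDir L X n ⬝ᵥ foldDir L X n = 1 ∧
      foldDir L X n ⬝ᵥ foldDir L X (n + 1) = Real.cos (α n) := by
  have hsq : ∀ (Y : Placement N) (n : Fin N), dist (Y (some n)) (Y none) ^ 2 =
      L n ^ 2 * (foldDir L Y n ⬝ᵥ foldDir L Y n) := fun Y n => by
    have := (hL n).ne'
    rw [dist_sq_eq]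
    simp only [dotProduct, Fin.sum_univ_three, foldDir]
    field_simp
  have hsq' : ∀ (Y : Placement N) (n : Fin N), dist (Y (some n)) (Y (some (n + 1))) ^ 2 =
      L n ^ 2 * (foldDir L Y n ⬝ᵥ foldDir L Y n) +
      L (n + 1) ^ 2 * (foldDir L Y (n + 1) ⬝ᵥ foldDir L Y (n + 1)) -
      2 * (L n * L (n + 1)) * (foldDir L Y n ⬝ᵥ foldDir L Y (n + 1)) := fun Y n => by
    have := (hL n).ne'
    have := (hL (n + 1)).ne'
    rw [dist_sq_eq]
    simp only [dotProduct, Fin.sum_univ_three, foldDir]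
    field_simp
    ring
  have hd : ∀ a b c d : Space, dist a b = dist c d ↔ dist a b ^ 2 = dist c d ^ 2 :=
    fun a b c d => (sq_eq_sq₀ dist_nonneg dist_nonneg).symm
  have hflat := foldDir_flatState_dot (α := α) hw hL
  simp only [configSpace, Set.mem_ofPred_eq, hd, hsq, hsq', (hflat _).1, (hflat _).2]
  constructor
  · rintro ⟨h1, h2⟩
    have h3 : ∀ n, foldDir L X n ⬝ᵥ foldDir L X n = 1 := fun n =>
      mul_left_cancel₀ (pow_ne_zero 2 (hL n).ne') (h1 n)
    refine fun n => ⟨h3 n, ?_⟩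
    have h4 := h2 n
    rw [h3, h3] at h4
    have h5 : 2 * (L n * L (n + 1)) ≠ 0 :=
      mul_ne_zero two_ne_zero (mul_ne_zero (hL n).ne' (hL _).ne')
    exact mul_left_cancel₀ h5 (by linarith)
  · intro h
    refine ⟨fun n => by rw [(h n).1], fun n => by rw [(h n).1, (h n).2, (h _).1]⟩

end Config

/-! ### The chart of the reduced configuration space -/

section Chart

variable {N : ℕ} [NeZero N]

/-- The projection onto the slice that forgets the folds `0` and `1`. -/
def sliceProj : (Fin N → ℝ) →L[ℝ] Slice N :=
  LinearMap.toContinuousLinearMap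
  { toFun := fun z => ⟨fun n => if n = 0 ∨ n = 1 then 0 else z n, by simp [sliceSubmodule]⟩
    map_add' := fun z y => by
      ext n
      by_cases h : n = 0 ∨ n = 1 <;> simp [h]
    map_smul' := fun c z => by
      ext n
      by_cases h : n = 0 ∨ n = 1 <;> simp [h] }

theorem sliceProj_apply {z : Fin N → ℝ} (h0 : z 0 = 0) (h1 : z 1 = 0) (n : Fin N) :
    (sliceProj z).1 n = z n := by
  change (if n = 0 ∨ n = 1 then 0 else z n) = z n
  split_ifs with h
  · rcases h with rfl | rfl <;> simp [h0, h1]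
  · rfl

variable (α L : Fin N → ℝ)

/-- The second vector of the frame attached to the face between the folds `0` and `1`; the first one
is the direction of fold `0`. -/
def faceDir (X : Placement N) : Fin 3 → ℝ :=
  (Real.sin (α 0))⁻¹ • (foldDir L X 1 - Real.cos (α 0) • foldDir L X 0)

/-- The slopes of the folds relative to the plane of the face between the folds `0` and `1`. -/
def faceSlope (X : Placement N) (n : Fin N) : ℝ :=
  crossProduct (foldDir L X 0) (faceDir α L X) ⬝ᵥ foldDir L X n

/-- Coordinates on the reduced configuration space: the slopes relative to a face, the height of the
hub and the tilt of the face. -/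
def reducedChart (X : Placement N) : Slice N × (ℝ × ℝ × ℝ) :=
  (sliceProj (faceSlope α L X), (X none 2, foldDir L X 0 2, faceDir α L X 2))

/-- The frame of a face with a given tilt: the first vector. -/
def tiltDir (a : ℝ × ℝ × ℝ) : Fin 3 → ℝ := ![√(1 - a.2.1 ^ 2), 0, a.2.1]

/-- The first component of `tiltDir'`. -/
def tiltShift (a : ℝ × ℝ × ℝ) : ℝ := -(a.2.1 * a.2.2) / √(1 - a.2.1 ^ 2)

/-- The frame of a face with a given tilt: the second vector. -/
def tiltDir' (a : ℝ × ℝ × ℝ) : Fin 3 → ℝ :=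
  ![tiltShift a, √(1 - a.2.2 ^ 2 - tiltShift a ^ 2), a.2.2]

/-- The direction of a fold in terms of the slopes and the tilt. -/
def chartDir (p : Slice N × (ℝ × ℝ × ℝ)) (n : Fin N) : Fin 3 → ℝ :=
  (projNorm p.1.1 n * Real.cos (polarAngle (projAngle α p.1.1) n)) • tiltDir p.2 +
    (projNorm p.1.1 n * Real.sin (polarAngle (projAngle α p.1.1) n)) • tiltDir' p.2 +
    p.1.1 n • crossProduct (tiltDir p.2) (tiltDir' p.2)

/-- The placement with given coordinates. -/
def reducedChartInv (p : Slice N × (ℝ × ℝ × ℝ)) : Placement N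
  | none => !₂[0, 0, p.2.1]
  | some n => !₂[L n * chartDir α p n 0, L n * chartDir α p n 1, p.2.1 + L n * chartDir α p n 2]

variable {α L}

theorem foldDir_reducedChartInv (hL : ∀ n, 0 < L n) (p : Slice N × (ℝ × ℝ × ℝ)) (n : Fin N) :
    foldDir L (reducedChartInv α L p) n = chartDir α p n := by
  have := (hL n).ne'
  ext i
  fin_cases i <;> simp [foldDir, reducedChartInv, this]

theorem placement_eq (hL : ∀ n, 0 < L n) {X Y : Placement N} (h0 : X none = Y none)
    (h : ∀ n, foldDir L X n = foldDir L Y n) : X = Y := by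
  funext v
  rcases v with _ | n
  · exact h0
  · ext i
    have h1 := congrFun (h n) i
    have := (hL n).ne'
    simp only [foldDir, h0] at h1
    field_simp at h1
    linarith

/-- Fold 0 has no second component, so the third components of the two frame vectors determine all
others up to the signs of square roots; `tiltShift` is the value forced by orthogonality. -/
theorem tilt_orthonormal {a : ℝ × ℝ × ℝ} (h1 : a.2.1 ^ 2 < 1) (h2 : a.2.2 ^ 2 + tiltShift a ^ 2 < 1) :
    tiltDir a ⬝ᵥ tiltDir a = 1 ∧ tiltDir' a ⬝ᵥ tiltDir' a = 1 ∧ tiltDir a ⬝ᵥ tiltDir' a = 0 := by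
  have e1 : √(1 - a.2.1 ^ 2) * √(1 - a.2.1 ^ 2) = 1 - a.2.1 ^ 2 :=
    Real.mul_self_sqrt (by linarith)
  have e2 : √(1 - a.2.2 ^ 2 - tiltShift a ^ 2) * √(1 - a.2.2 ^ 2 - tiltShift a ^ 2) =
    1 - a.2.2 ^ 2 - tiltShift a ^ 2 := Real.mul_self_sqrt (by linarith)
  have e3 : √(1 - a.2.1 ^ 2) * tiltShift a = -(a.2.1 * a.2.2) := by
    have : √(1 - a.2.1 ^ 2) ≠ 0 := (Real.sqrt_pos.2 (by linarith)).ne'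
    rw [tiltShift]; field_simp
  refine ⟨?_, ?_, ?_⟩
  · simp [tiltDir, dotProduct, Fin.sum_univ_three, e1]; ring
  · simp [tiltDir', dotProduct, Fin.sum_univ_three, e2]; ring
  · simp [tiltDir, tiltDir', dotProduct, Fin.sum_univ_three, e3]

theorem face_orthonormal (hα : Real.sin (α 0) ≠ 0) {X : Placement N}
    (h0 : foldDir L X 0 ⬝ᵥ foldDir L X 0 = 1) (h1 : foldDir L X 1 ⬝ᵥ foldDir L X 1 = 1)
    (h01 : foldDir L X 0 ⬝ᵥ foldDir L X 1 = Real.cos (α 0)) :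
    faceDir α L X ⬝ᵥ faceDir α L X = 1 ∧ foldDir L X 0 ⬝ᵥ faceDir α L X = 0 := by
  have h2 := Real.sin_sq_add_cos_sq (α 0)
  constructor
  · simp only [faceDir, dotProduct_smul, smul_dotProduct, dotProduct_sub, sub_dotProduct, h0, h1, h01,
      dotProduct_comm (foldDir L X 1) (foldDir L X 0), smul_eq_mul]
    field_simp
    linear_combination -h2
  · simp only [faceDir, dotProduct_smul, dotProduct_sub, h0, h01, smul_eq_mul]
    ring

theorem faceDir_eq (hα : Real.sin (α 0) ≠ 0) (X : Placement N) :
    foldDir L X 1 = Real.cos (α 0) • foldDir L X 0 + Real.sin (α 0) • faceDir α L X := by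
  rw [faceDir, smul_smul, mul_inv_cancel₀ hα, one_smul, add_sub_cancel]

theorem faceSlope_zero (X : Placement N) : faceSlope α L X 0 = 0 := by
  rw [faceSlope, dotProduct_comm, dot_self_cross]

theorem faceSlope_one (hα : Real.sin (α 0) ≠ 0) (X : Placement N) : faceSlope α L X 1 = 0 := by
  rw [faceSlope, dotProduct_comm, faceDir_eq hα, add_dotProduct, smul_dotProduct, smul_dotProduct,
    dot_self_cross, dot_cross_self]
  simp

theorem sliceProj_faceSlope (hα : Real.sin (α 0) ≠ 0) (X : Placement N) :
    (sliceProj (faceSlope α L X)).1 = faceSlope α L X :=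
  funext fun n => sliceProj_apply (faceSlope_zero X) (faceSlope_one hα X) n

/-- The orientation of the `n`-th face relative to the face between the folds `0` and `1`. -/
def faceDet (α L : Fin N → ℝ) (X : Placement N) (n : Fin N) : ℝ :=
  foldDir L X 0 ⬝ᵥ foldDir L X n * (faceDir α L X ⬝ᵥ foldDir L X (n + 1)) -
    faceDir α L X ⬝ᵥ foldDir L X n * (foldDir L X 0 ⬝ᵥ foldDir L X (n + 1))

/-- In the frame of the reference face the folds form a chain to which `chain_of_slopes` applies.
Hypotheses `h1`, `h2`, `h3` are open conditions that hold near the unfolded state; `h3` selects the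
winding w. -/
theorem config_chain {w : ℤ} (hα : ∀ n, 0 < |α n| ∧ |α n| < Real.pi)
    (hw : ∑ n, α n = 2 * Real.pi * w) (hL : ∀ n, 0 < L n) {X : Placement N}
    (hX : X ∈ configSpace α L) (h1 : ∀ n, |faceSlope α L X n| < 1)
    (h2 : ∀ n, 0 < α n * faceDet α L X n)
    (h3 : |∑ n, projAngle α (faceSlope α L X) n - 2 * Real.pi * w| < 2 * Real.pi) :
    ∑ n, projAngle α (faceSlope α L X) n = 2 * Real.pi * w ∧
    ∀ n, foldDir L X n =
      (projNorm (faceSlope α L X) n * Real.cos (polarAngle (projAngle α (faceSlope α L X)) n)) •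
        foldDir L X 0 +
      (projNorm (faceSlope α L X) n * Real.sin (polarAngle (projAngle α (faceSlope α L X)) n)) •
        faceDir α L X +
      faceSlope α L X n • crossProduct (foldDir L X 0) (faceDir α L X) := by
  have hs : Real.sin (α 0) ≠ 0 := sin_ne_zero_of_abs (hα 0)
  rw [mem_configSpace_iff hw hL] at hX
  have h01 := (hX 0).2
  rw [zero_add] at h01
  obtain ⟨o1, o2⟩ := face_orthonormal hs (hX 0).1 (hX 1).1 h01
  have hexp := fun n => orthonormal_expand (hX 0).1 o1 o2 (foldDir L X n)
  have hdot : ∀ m n, foldDir L X m ⬝ᵥ foldDir L X n =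
      foldDir L X 0 ⬝ᵥ foldDir L X m * (foldDir L X 0 ⬝ᵥ foldDir L X n) +
      faceDir α L X ⬝ᵥ foldDir L X m * (faceDir α L X ⬝ᵥ foldDir L X n) +
      faceSlope α L X m * faceSlope α L X n := fun m n => by
    conv_lhs => rw [hexp m, hexp n]
    exact orthonormal_combination_dot (hX 0).1 o1 o2 _ _ _ _ _ _
  obtain ⟨c1, c2⟩ := chain_of_slopes hα (z := faceSlope α L X)
    (x := fun n => foldDir L X 0 ⬝ᵥ foldDir L X n) (y := fun n => faceDir α L X ⬝ᵥ foldDir L X n)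
    h1 (hX 0).1 (by rw [dotProduct_comm]; exact o2)
    (fun n => by rw [← hdot]; exact (hX n).1)
    (fun n => by rw [← hdot]; exact (hX n).2) h2
  refine ⟨eq_of_exp_eq_one c2 h3, fun n => ?_⟩
  rw [← (c1 n).1, ← (c1 n).2]
  exact hexp n

/-- Slopes and frame determine every fold by `config_chain`. The frame is recovered from its two
tilts: fold 0 stays in the vertical plane, and `h4`, `h5` say that the positive square roots are the
right ones. -/
theorem reducedChart_left_inv {w : ℤ} (hα : ∀ n, 0 < |α n| ∧ |α n| < Real.pi)
    (hw : ∑ n, α n = 2 * Real.pi * w) (hL : ∀ n, 0 < L n) {X : Placement N}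
    (hX : X ∈ reducedConfigSpace α L) (h1 : ∀ n, |faceSlope α L X n| < 1)
    (h2 : ∀ n, 0 < α n * faceDet α L X n)
    (h3 : |∑ n, projAngle α (faceSlope α L X) n - 2 * Real.pi * w| < 2 * Real.pi)
    (h4 : 0 < foldDir L X 0 0) (h5 : 0 < faceDir α L X 1) :
    angleForm α (reducedChart α L X).1 (reducedChart α L X).1 (reducedChart α L X).1 = 0 ∧
      reducedChartInv α L (reducedChart α L X) = X := by
  have hs : Real.sin (α 0) ≠ 0 := sin_ne_zero_of_abs (hα 0)
  obtain ⟨hXc, hx0, hy0, hy1⟩ := hX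
  obtain ⟨e1, e2⟩ := config_chain hα hw hL hXc h1 h2 h3
  have hpr : (reducedChart α L X).1.1 = faceSlope α L X := sliceProj_faceSlope hs X
  rw [mem_configSpace_iff hw hL] at hXc
  have h01 := (hXc 0).2
  rw [zero_add] at h01
  obtain ⟨o1, o2⟩ := face_orthonormal hs (hXc 0).1 (hXc 1).1 h01
  have hu1 : foldDir L X 0 1 = 0 := by simp [foldDir, hy0, hy1]
  have o0 := (hXc 0).1
  simp only [dotProduct, Fin.sum_univ_three, hu1] at o0 o1 o2
  have hf1 : tiltDir (reducedChart α L X).2 = foldDir L X 0 := by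
    have : √(1 - foldDir L X 0 2 ^ 2) = foldDir L X 0 0 := by
      rw [Real.sqrt_eq_iff_mul_self_eq_of_pos h4]; linarith
    ext i
    fin_cases i
    · simpa [tiltDir, reducedChart] using this
    · simp [tiltDir, hu1]
    · simp [tiltDir, reducedChart]
  have hsh : tiltShift (reducedChart α L X).2 = faceDir α L X 0 := by
    have h6 : √(1 - (reducedChart α L X).2.2.1 ^ 2) = foldDir L X 0 0 := congrFun hf1 0
    rw [tiltShift, h6, div_eq_iff h4.ne']
    simp only [reducedChart]
    linarith
  have hf2 : tiltDir' (reducedChart α L X).2 = faceDir α L X := by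
    have : √(1 - faceDir α L X 2 ^ 2 - faceDir α L X 0 ^ 2) = faceDir α L X 1 := by
      rw [Real.sqrt_eq_iff_mul_self_eq_of_pos h5]; linarith
    ext i
    fin_cases i
    · simpa [tiltDir'] using hsh
    · change √(1 - faceDir α L X 2 ^ 2 - tiltShift (reducedChart α L X).2 ^ 2) = _
      rw [hsh]; exact this
    · simp [tiltDir', reducedChart]
  constructor
  · rw [angleForm_self hα (by rw [hpr]; exact h1), hpr, e1, hw]; ring
  · refine placement_eq hL ?_ fun n => ?_
    · ext i
      fin_cases i <;> simp [reducedChartInv, reducedChart, hx0, hy0]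
    · rw [foldDir_reducedChartInv hL, chartDir, hpr, hf1, hf2]
      exact (e2 n).symm

/-- The equation `hp` says that the turns add up to 2πw, so the folds built from partial sums also
fit together at the wrap. As the slopes of folds 0 and 1 vanish, the turn between them is α_0 and
the reference face is recovered. -/
theorem reducedChart_right_inv {w : ℤ} (hα : ∀ n, 0 < |α n| ∧ |α n| < Real.pi)
    (hw : ∑ n, α n = 2 * Real.pi * w) (hL : ∀ n, 0 < L n) {p : Slice N × (ℝ × ℝ × ℝ)}
    (hp : angleForm α p.1 p.1 p.1 = 0) (h1 : ∀ n, |p.1.1 n| < 1)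
    (h2 : ∀ n, |projCos α p.1.1 n| < 1) (h3 : p.2.2.1 ^ 2 < 1)
    (h4 : p.2.2.2 ^ 2 + tiltShift p.2 ^ 2 < 1) :
    reducedChartInv α L p ∈ reducedConfigSpace α L ∧
      reducedChart α L (reducedChartInv α L p) = p := by
  have hs : Real.sin (α 0) ≠ 0 := sin_ne_zero_of_abs (hα 0)
  have hN := two_le_of_sum_eq hα hw
  obtain ⟨o1, o2, o3⟩ := tilt_orthonormal h3 h4
  have hβ : ∑ n, projAngle α p.1.1 n = 2 * Real.pi * w := by
    rw [angleForm_self hα h1, hw] at hp; linarith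
  have hu := foldDir_reducedChartInv (α := α) hL p
  have p0 : p.1.1 0 = 0 := p.1.2.1
  have p1 : p.1.1 1 = 0 := p.1.2.2
  have hβ0 : projAngle α p.1.1 0 = α 0 := projAngle_eq_of_zero hα p0 (by rw [zero_add]; exact p1)
  have hu0 : chartDir α p 0 = tiltDir p.2 := by
    simp [chartDir, p0, projNorm]
  have hu1 : chartDir α p 1 = Real.cos (α 0) • tiltDir p.2 + Real.sin (α 0) • tiltDir' p.2 := by
    simp [chartDir, p1, projNorm, polarAngle_one _ hN, hβ0]
  have hm : faceDir α L (reducedChartInv α L p) = tiltDir' p.2 := by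
    rw [faceDir, hu, hu, hu0, hu1, add_sub_cancel_left, smul_smul, inv_mul_cancel₀ hs, one_smul]
  have hsl : faceSlope α L (reducedChartInv α L p) = p.1.1 := by
    ext n
    rw [faceSlope, hm, hu, hu, hu0]
    have := orthonormal_combination_dot o1 o2 o3 0 0 1
      (projNorm p.1.1 n * Real.cos (polarAngle (projAngle α p.1.1) n))
      (projNorm p.1.1 n * Real.sin (polarAngle (projAngle α p.1.1) n)) (p.1.1 n)
    simpa [chartDir] using this
  refine ⟨⟨?_, ?_, ?_, ?_⟩, ?_⟩
  · rw [mem_configSpace_iff hw hL]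
    intro n
    rw [hu, hu, chartDir, chartDir, orthonormal_combination_dot o1 o2 o3,
      orthonormal_combination_dot o1 o2 o3]
    have q1 := projNorm_sq (h1 n)
    have r1 := (projNorm_pos (h1 n)).ne'
    have r2 := (projNorm_pos (h1 (n + 1))).ne'
    have s1 := Real.sin_sq_add_cos_sq (polarAngle (projAngle α p.1.1) n)
    constructor
    · linear_combination q1 + projNorm p.1.1 n ^ 2 * s1
    · obtain ⟨k1, k2⟩ := exp_polarAngle_add_one _ w hβ n
      have k3 := cos_projAngle hα (h2 n).le
      rw [projCos] at k3
      rw [k1, k2, Real.cos_add, Real.sin_add]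
      field_simp at k3
      linear_combination projNorm p.1.1 n * projNorm p.1.1 (n + 1) *
        Real.cos (projAngle α p.1.1 n) * s1 + k3
  · simp [reducedChartInv]
  · simp [reducedChartInv]
  · simp [reducedChartInv, hu0, tiltDir]
  · refine Prod.ext ?_ (Prod.ext ?_ (Prod.ext ?_ ?_))
    · refine Subtype.ext ?_
      simp only [reducedChart]
      rw [sliceProj_faceSlope hs, hsl]
    · simp [reducedChart, reducedChartInv]
    · simp only [reducedChart]
      rw [hu, hu0]; rfl
    · simp only [reducedChart]
      rw [hm]; rfl

end Chart

/-! ### Analyticity of the chart and of its inverse -/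

section ChartAnalytic

variable {N : ℕ} [NeZero N] {α L : Fin N → ℝ}

theorem contDiff_coord (v : Vertex N) (i : Fin 3) :
    ContDiff ℝ ⊤ (fun X : Placement N => X v i) := by fun_prop

theorem contDiff_foldDir (n : Fin N) (i : Fin 3) :
    ContDiff ℝ ⊤ (fun X : Placement N => foldDir L X n i) := by
  unfold foldDir; fun_prop

theorem contDiff_faceDir (i : Fin 3) :
    ContDiff ℝ ⊤ (fun X : Placement N => faceDir α L X i) := by
  have := contDiff_foldDir (L := L) 0 i
  have := contDiff_foldDir (L := L) 1 i
  simp only [faceDir, Pi.smul_apply, Pi.sub_apply, smul_eq_mul]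
  fun_prop

theorem contDiff_faceSlope (n : Fin N) :
    ContDiff ℝ ⊤ (fun X : Placement N => faceSlope α L X n) := by
  have h := contDiff_foldDir (L := L)
  have h' := contDiff_faceDir (α := α) (L := L)
  simp only [faceSlope, cross_apply, dotProduct, Fin.sum_univ_three]
  simp
  fun_prop

theorem contDiff_faceDet (n : Fin N) :
    ContDiff ℝ ⊤ (fun X : Placement N => faceDet α L X n) := by
  have h := contDiff_foldDir (L := L)
  have h' := contDiff_faceDir (α := α) (L := L)
  simp only [faceDet, dotProduct, Fin.sum_univ_three]
  fun_prop

theorem contDiff_reducedChart : ContDiff ℝ ⊤ (reducedChart α L) := by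
  have h := contDiff_foldDir (L := L)
  have h' := contDiff_faceDir (α := α) (L := L)
  refine ContDiff.prodMk (sliceProj.contDiff.comp (contDiff_pi.2 contDiff_faceSlope)) ?_
  fun_prop

theorem contDiff_polarAngle_comp {E : Type*} [NormedAddCommGroup E] [NormedSpace ℝ E]
    {β : E → Fin N → ℝ} {x : E} (h : ∀ n, ContDiffAt ℝ ⊤ (fun y => β y n) x) (n : Fin N) :
    ContDiffAt ℝ ⊤ (fun y => polarAngle (β y) n) x := by
  unfold polarAngle
  exact ContDiffAt.sum fun k _ => h k

theorem contDiffAt_tiltShift : ContDiffAt ℝ ⊤ tiltShift 0 :=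
  ContDiffAt.div (by fun_prop) (ContDiffAt.sqrt (by fun_prop) (by simp)) (by simp)

theorem contDiffAt_tiltDir (i : Fin 3) : ContDiffAt ℝ ⊤ (fun a => tiltDir a i) 0 := by
  fin_cases i
  · exact ContDiffAt.sqrt (by fun_prop) (by simp)
  · exact contDiffAt_const
  · change ContDiffAt ℝ ⊤ (fun a : ℝ × ℝ × ℝ => a.2.1) 0
    fun_prop

theorem contDiffAt_tiltDir' (i : Fin 3) : ContDiffAt ℝ ⊤ (fun a => tiltDir' a i) 0 := by
  fin_cases i
  · exact contDiffAt_tiltShift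
  · have := contDiffAt_tiltShift
    exact ContDiffAt.sqrt (by fun_prop) (by simp [tiltShift])
  · change ContDiffAt ℝ ⊤ (fun a : ℝ × ℝ × ℝ => a.2.2) 0
    fun_prop

theorem contDiffAt_comp_slice {f : (Fin N → ℝ) → ℝ} (hf : ContDiffAt ℝ ⊤ f 0) :
    ContDiffAt ℝ ⊤ (fun p : Slice N × (ℝ × ℝ × ℝ) => f p.1.1) 0 :=
  ContDiffAt.comp (0 : Slice N × (ℝ × ℝ × ℝ)) (g := f) (f := fun p => p.1.1) hf
    (sliceIncl.contDiff.comp contDiff_fst).contDiffAt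

theorem contDiffAt_comp_tilt {f : ℝ × ℝ × ℝ → ℝ} (hf : ContDiffAt ℝ ⊤ f 0) :
    ContDiffAt ℝ ⊤ (fun p : Slice N × (ℝ × ℝ × ℝ) => f p.2) 0 :=
  ContDiffAt.comp (0 : Slice N × (ℝ × ℝ × ℝ)) (g := f) (f := Prod.snd) hf
    contDiff_snd.contDiffAt

theorem contDiffAt_chartDir (hα : ∀ n, 0 < |α n| ∧ |α n| < Real.pi) (n : Fin N) (i : Fin 3) :
    ContDiffAt ℝ ⊤ (fun p => chartDir α p n i) 0 := by
  have h1 := contDiffAt_comp_slice (contDiffAt_projNorm n)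
  have h2 := contDiff_polarAngle_comp
    (fun n => contDiffAt_comp_slice (contDiffAt_projAngle hα n)) n
  have h3 : ContDiffAt ℝ ⊤ (fun p : Slice N × (ℝ × ℝ × ℝ) => p.1.1 n) 0 :=
    contDiffAt_comp_slice (f := fun z => z n) (by fun_prop)
  have h4 := fun i => contDiffAt_comp_tilt (N := N) (contDiffAt_tiltDir i)
  have h5 := fun i => contDiffAt_comp_tilt (N := N) (contDiffAt_tiltDir' i)
  have h6 : ContDiffAt ℝ ⊤ (fun p : Slice N × (ℝ × ℝ × ℝ) =>
      crossProduct (tiltDir p.2) (tiltDir' p.2) i) 0 := by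
    simp only [cross_apply]
    fin_cases i
    · exact ((h4 1).mul (h5 2)).sub ((h4 2).mul (h5 1))
    · exact ((h4 2).mul (h5 0)).sub ((h4 0).mul (h5 2))
    · exact ((h4 0).mul (h5 1)).sub ((h4 1).mul (h5 0))
  simp only [chartDir, Pi.add_apply, Pi.smul_apply, smul_eq_mul]
  exact (((h1.mul h2.cos).mul (h4 i)).add ((h1.mul h2.sin).mul (h5 i))).add (h3.mul h6)

theorem contDiffAt_reducedChartInv (hα : ∀ n, 0 < |α n| ∧ |α n| < Real.pi) :
    ContDiffAt ℝ ⊤ (reducedChartInv α L) 0 := by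
  rw [contDiffAt_pi]
  rintro (_ | n)
  · rw [contDiffAt_euclidean]
    intro i
    fin_cases i
    · exact contDiffAt_const
    · exact contDiffAt_const
    · change ContDiffAt ℝ ⊤ (fun p : Slice N × (ℝ × ℝ × ℝ) => p.2.1) 0
      fun_prop
  · rw [contDiffAt_euclidean]
    have h := contDiffAt_chartDir hα n
    intro i
    fin_cases i
    · exact contDiffAt_const.mul (h 0)
    · exact contDiffAt_const.mul (h 1)
    · exact ContDiffAt.add (f := fun p : Slice N × (ℝ × ℝ × ℝ) => p.2.1) (by fun_prop)
        (contDiffAt_const.mul (h 2))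

end ChartAnalytic

/-! ### The chart at the unfolded state -/

section ChartFlat

variable {N : ℕ} [NeZero N] {α L : Fin N → ℝ} {w : ℤ}

theorem faceDir_flatState (hα : ∀ n, 0 < |α n| ∧ |α n| < Real.pi)
    (hw : ∑ n, α n = 2 * Real.pi * w) (hL : ∀ n, 0 < L n) :
    faceDir α L (flatState α L) = ![0, 1, 0] := by
  have hs : Real.sin (α 0) ≠ 0 := sin_ne_zero_of_abs (hα 0)
  rw [faceDir, foldDir_flatState hL, foldDir_flatState hL, polarAngle_zero,
    polarAngle_one _ (two_le_of_sum_eq hα hw)]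
  ext i
  fin_cases i <;> simp [hs]

theorem foldDir_flatState_zero (hL : ∀ n, 0 < L n) :
    foldDir L (flatState α L) 0 = ![1, 0, 0] := by
  rw [foldDir_flatState hL]; simp

theorem faceSlope_flatState (hα : ∀ n, 0 < |α n| ∧ |α n| < Real.pi)
    (hw : ∑ n, α n = 2 * Real.pi * w) (hL : ∀ n, 0 < L n) :
    faceSlope α L (flatState α L) = 0 := by
  ext n
  rw [faceSlope, faceDir_flatState hα hw hL, foldDir_flatState_zero hL, foldDir_flatState hL]
  simp [cross_apply]

theorem faceDet_flatState (hα : ∀ n, 0 < |α n| ∧ |α n| < Real.pi)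
    (hw : ∑ n, α n = 2 * Real.pi * w) (hL : ∀ n, 0 < L n) (n : Fin N) :
    faceDet α L (flatState α L) n = Real.sin (α n) := by
  rw [faceDet, faceDir_flatState hα hw hL, foldDir_flatState_zero hL, foldDir_flatState hL,
    foldDir_flatState hL]
  obtain ⟨h1, h2⟩ := exp_polarAngle_add_one α w hw n
  simp only [h1, h2, Real.cos_add, Real.sin_add]
  have := Real.sin_sq_add_cos_sq (polarAngle α n)
  simp [dotProduct, Fin.sum_univ_three]
  linear_combination Real.sin (α n) * this

theorem mul_sin_pos {x : ℝ} (h : 0 < |x| ∧ |x| < Real.pi) : 0 < x * Real.sin x := by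
  rcases lt_or_gt_of_ne (abs_pos.1 h.1) with h0 | h0
  · rw [abs_of_neg h0] at h
    exact mul_pos_of_neg_of_neg h0 (Real.sin_neg_of_neg_of_neg_pi_lt h0 (by linarith))
  · rw [abs_of_pos h0] at h
    exact mul_pos h0 (Real.sin_pos_of_pos_of_lt_pi h0 h.2)

theorem flatState_mem : flatState α L ∈ reducedConfigSpace α L := by
  refine ⟨⟨fun _ => rfl, fun _ => rfl⟩, ?_, ?_, ?_⟩ <;> simp [flatState]

theorem reducedChart_flatState (hα : ∀ n, 0 < |α n| ∧ |α n| < Real.pi)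
    (hw : ∑ n, α n = 2 * Real.pi * w) (hL : ∀ n, 0 < L n) :
    reducedChart α L (flatState α L) = 0 := by
  rw [reducedChart, faceSlope_flatState hα hw hL, foldDir_flatState_zero hL,
    faceDir_flatState hα hw hL]
  simp [flatState]

theorem projAngle_zero (hα : ∀ n, 0 < |α n| ∧ |α n| < Real.pi) : projAngle α 0 = α :=
  funext fun _ => projAngle_eq_of_zero hα rfl rfl

theorem reducedChartInv_zero (hα : ∀ n, 0 < |α n| ∧ |α n| < Real.pi) (hL : ∀ n, 0 < L n) :
    reducedChartInv α L 0 = flatState α L := by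
  refine placement_eq hL ?_ fun n => ?_
  · ext i; fin_cases i <;> simp [reducedChartInv, flatState]
  · rw [foldDir_reducedChartInv hL, foldDir_flatState hL, chartDir]
    ext i
    fin_cases i <;> simp [tiltDir, tiltDir', tiltShift, projNorm, projAngle_zero hα, cross_apply]

/-- Near the flat state, the face slopes are small and the faces keep their orientations. -/
theorem eventually_chart (hα : ∀ n, 0 < |α n| ∧ |α n| < Real.pi)
    (hw : ∑ n, α n = 2 * Real.pi * w) (hL : ∀ n, 0 < L n) :
    ∀ᶠ X in 𝓝 (flatState α L), (∀ n, |faceSlope α L X n| < 1) ∧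
      (∀ n, 0 < α n * faceDet α L X n) ∧
      |∑ n, projAngle α (faceSlope α L X) n - 2 * Real.pi * w| < 2 * Real.pi ∧
      0 < foldDir L X 0 0 ∧ 0 < faceDir α L X 1 := by
  have hsl : ∀ n, ContinuousAt (fun X => faceSlope α L X n) (flatState α L) := fun n =>
    (contDiff_faceSlope n).continuous.continuousAt
  refine .and (eventually_all.2 fun n => ?_) (.and (eventually_all.2 fun n => ?_)
    (.and ?_ (.and ?_ ?_)))
  · refine (hsl n).abs.eventually_lt continuousAt_const ?_
    rw [faceSlope_flatState hα hw hL]; simp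
  · refine continuousAt_const.eventually_lt (f := fun _ => (0 : ℝ)) (ContinuousAt.mul
      continuousAt_const (contDiff_faceDet n).continuous.continuousAt) ?_
    rw [faceDet_flatState hα hw hL]
    exact mul_sin_pos (hα n)
  · have h0 : faceSlope α L (flatState α L) = 0 := faceSlope_flatState hα hw hL
    have hc : ∀ n, ContinuousAt (fun X => projAngle α (faceSlope α L X) n) (flatState α L) :=
      fun n => ContinuousAt.comp (g := fun z => projAngle α z n)
        (by rw [h0]; exact (contDiffAt_projAngle hα n).continuousAt)
        (continuousAt_pi.2 hsl)
    refine ContinuousAt.eventually_lt (ContinuousAt.abs (ContinuousAt.sub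
      (tendsto_finsetSum _ fun n _ => hc n) continuousAt_const)) continuousAt_const ?_
    rw [h0, projAngle_zero hα, hw]
    simpa using Real.pi_pos
  · refine continuousAt_const.eventually_lt (contDiff_foldDir 0 0).continuous.continuousAt ?_
    rw [foldDir_flatState_zero hL]; simp
  · refine continuousAt_const.eventually_lt (contDiff_faceDir 1).continuous.continuousAt ?_
    rw [faceDir_flatState hα hw hL]; simp

/-- The reduced configuration space in coordinates. -/
theorem isGermIso_reducedChart (hα : ∀ n, 0 < |α n| ∧ |α n| < Real.pi)
    (hw : ∑ n, α n = 2 * Real.pi * w) (hL : ∀ n, 0 < L n) :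
    IsGermIso (reducedConfigSpace α L) (flatState α L)
      ({z : Slice N | angleForm α z z z = 0} ×ˢ (Set.univ : Set (ℝ × ℝ × ℝ))) (0, 0)
      (reducedChart α L) (reducedChartInv α L) := by
  have hl : ∀ᶠ X in 𝓝[reducedConfigSpace α L] (flatState α L),
      angleForm α (reducedChart α L X).1 (reducedChart α L X).1 (reducedChart α L X).1 = 0 ∧
        reducedChartInv α L (reducedChart α L X) = X := by
    filter_upwards [(eventually_chart hα hw hL).filter_mono nhdsWithin_le_nhds,
      self_mem_nhdsWithin] with X h hX
    exact reducedChart_left_inv hα hw hL hX h.1 h.2.1 h.2.2.1 h.2.2.2.1 h.2.2.2.2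
  have hr : ∀ᶠ p in 𝓝[{z : Slice N | angleForm α z z z = 0} ×ˢ (Set.univ : Set (ℝ × ℝ × ℝ))] (0, 0),
      reducedChartInv α L p ∈ reducedConfigSpace α L ∧
        reducedChart α L (reducedChartInv α L p) = p := by
    have h1 : ∀ᶠ p : Slice N × (ℝ × ℝ × ℝ) in 𝓝 0, ∀ n, |p.1.1 n| < 1 := by
      refine eventually_all.2 fun n => ?_
      refine ContinuousAt.eventually_lt (ContinuousAt.abs (contDiffAt_comp_slice
        (f := fun z => z n) (by fun_prop)).continuousAt) continuousAt_const (by simp)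
    have h2 : ∀ᶠ p : Slice N × (ℝ × ℝ × ℝ) in 𝓝 0, ∀ n, |projCos α p.1.1 n| < 1 := by
      refine eventually_all.2 fun n => ?_
      refine ContinuousAt.eventually_lt (ContinuousAt.abs (contDiffAt_comp_slice
        (contDiffAt_projCos n)).continuousAt) continuousAt_const ?_
      simp only [Prod.fst_zero, Submodule.coe_zero, projCos, projNorm, Pi.zero_apply]
      have h3 := Real.abs_cos_le_one (α n)
      have h4 := cos_ne_of_abs (hα n)
      simp only [mul_zero, sub_zero, ne_eq, OfNat.ofNat_ne_zero, not_false_eq_true, zero_pow,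
        Real.sqrt_one, mul_one, div_one]
      refine lt_of_le_of_ne h3 fun h5 => ?_
      rcases eq_or_eq_neg_of_abs_eq h5 with h | h
      · exact h4.2 h
      · exact h4.1 h
    have h3 : ∀ᶠ p : Slice N × (ℝ × ℝ × ℝ) in 𝓝 0, p.2.2.1 ^ 2 < 1 :=
      ContinuousAt.eventually_lt (by fun_prop) continuousAt_const (by simp)
    have h4 : ∀ᶠ p : Slice N × (ℝ × ℝ × ℝ) in 𝓝 0, p.2.2.2 ^ 2 + tiltShift p.2 ^ 2 < 1 := by
      have := (contDiffAt_comp_tilt (N := N) contDiffAt_tiltShift).continuousAt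
      exact ContinuousAt.eventually_lt (by fun_prop) continuousAt_const (by simp [tiltShift])
    filter_upwards [h1.filter_mono nhdsWithin_le_nhds, h2.filter_mono nhdsWithin_le_nhds,
      h3.filter_mono nhdsWithin_le_nhds, h4.filter_mono nhdsWithin_le_nhds,
      self_mem_nhdsWithin] with p g1 g2 g3 g4 hp
    exact reducedChart_right_inv hα hw hL hp.1 g1 g2 g3 g4
  exact
    { mem_left := flatState_mem
      mem_right := ⟨by simp, trivial⟩
      analyticAt_toFun := contDiff_reducedChart.contDiffAt.analyticAt
      analyticAt_invFun := (contDiffAt_reducedChartInv hα).analyticAt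
      map_base := reducedChart_flatState hα hw hL
      inv_base := reducedChartInv_zero hα hL
      mapsTo := hl.mono fun X h => ⟨h.1, trivial⟩
      inv_mapsTo := hr.mono fun p h => h.1
      left_inv := hl.mono fun X h => h.2
      right_inv := hr.mono fun p h => h.2 }

end ChartFlat

/-! ### Splitting off in-plane rigid motions -/

section PlanarMotions

variable {N : ℕ} [NeZero N] {α L : Fin N → ℝ}

/-- The horizontal distance from the hub to the end of fold `0`. -/
def baseNorm (X : Placement N) : ℝ :=
  √((X (some 0) 0 - X none 0) ^ 2 + (X (some 0) 1 - X none 1) ^ 2)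

/-- The cosine of the azimuth of fold `0`. -/
def baseCos (X : Placement N) : ℝ := (X (some 0) 0 - X none 0) / baseNorm X

/-- The sine of the azimuth of fold `0`. -/
def baseSin (X : Placement N) : ℝ := (X (some 0) 1 - X none 1) / baseNorm X

/-- Normalise a placement by a rigid motion in the plane, and record that motion. -/
def planarNormalize (X : Placement N) : Placement N × EuclideanSpace ℝ (Fin 3) :=
  (fun v => !₂[baseCos X * (X v 0 - X none 0) + baseSin X * (X v 1 - X none 1),
      -baseSin X * (X v 0 - X none 0) + baseCos X * (X v 1 - X none 1), X v 2],
    !₂[X none 0, X none 1, baseSin X])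

/-- Apply a rigid motion in the plane. -/
def planarMove (p : Placement N × EuclideanSpace ℝ (Fin 3)) : Placement N :=
  fun v => !₂[p.2 0 + √(1 - p.2 2 ^ 2) * p.1 v 0 - p.2 2 * p.1 v 1,
    p.2 1 + p.2 2 * p.1 v 0 + √(1 - p.2 2 ^ 2) * p.1 v 1, p.1 v 2]

theorem mem_configSpace_of_dist_eq {X Y : Placement N}
    (h : ∀ u v, dist (Y u) (Y v) = dist (X u) (X v)) (hX : X ∈ configSpace α L) :
    Y ∈ configSpace α L :=
  ⟨fun n => (h _ _).trans (hX.1 n), fun n => (h _ _).trans (hX.2 n)⟩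

theorem dist_eq_of_sum_sq_eq {a b c d : Space}
    (h : ∑ i, (a i - b i) ^ 2 = ∑ i, (c i - d i) ^ 2) : dist a b = dist c d := by
  rw [← sq_eq_sq₀ dist_nonneg dist_nonneg, dist_sq_eq, dist_sq_eq, h]

theorem baseCos_sq_add_baseSin_sq {X : Placement N} (h : 0 < X (some 0) 0 - X none 0) :
    baseCos X ^ 2 + baseSin X ^ 2 = 1 := by
  have h1 : 0 < (X (some 0) 0 - X none 0) ^ 2 + (X (some 0) 1 - X none 1) ^ 2 := by positivity
  have h2 : baseNorm X ^ 2 = _ := Real.sq_sqrt h1.le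
  have h3 : baseNorm X ≠ 0 := (Real.sqrt_pos.2 h1).ne'
  rw [baseCos, baseSin]
  field_simp
  rw [h2]

theorem planarNormalize_mem {X : Placement N} (h : 0 < X (some 0) 0 - X none 0)
    (hX : X ∈ configSpace α L) : (planarNormalize X).1 ∈ reducedConfigSpace α L := by
  have h1 := baseCos_sq_add_baseSin_sq h
  refine ⟨mem_configSpace_of_dist_eq (fun u v => dist_eq_of_sum_sq_eq ?_) hX, ?_, ?_, ?_⟩
  · simp only [Fin.sum_univ_three, planarNormalize]
    simp
    linear_combination ((X u 0 - X v 0) ^ 2 + (X u 1 - X v 1) ^ 2) * h1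
  · simp [planarNormalize]
  · simp [planarNormalize]
  · simp [planarNormalize, baseCos, baseSin]
    ring

/-- A rotation is recorded by its sine alone. The cosine comes back as the positive root of 1 -
sin², which is correct while fold 0 points towards positive first coordinates. -/
theorem planarMove_planarNormalize {X : Placement N} (h : 0 < X (some 0) 0 - X none 0) :
    planarMove (planarNormalize X) = X := by
  have h1 := baseCos_sq_add_baseSin_sq h
  have h3 : 0 < baseCos X := div_pos h (Real.sqrt_pos.2 (by positivity))
  have h2 : √(1 - baseSin X ^ 2) = baseCos X := by
    rw [← h1, add_sub_cancel_right, Real.sqrt_sq h3.le]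
  funext v
  ext i
  fin_cases i <;> simp [planarMove, planarNormalize, h2]
  · linear_combination (X v 0 - X none 0) * h1
  · linear_combination (X v 1 - X none 1) * h1

theorem planarMove_mem {p : Placement N × EuclideanSpace ℝ (Fin 3)} (hp : p.1 ∈ configSpace α L)
    (hs : p.2 2 ^ 2 < 1) : planarMove p ∈ configSpace α L := by
  have h1 : √(1 - p.2 2 ^ 2) ^ 2 = 1 - p.2 2 ^ 2 := Real.sq_sqrt (by linarith)
  refine mem_configSpace_of_dist_eq (fun u v => dist_eq_of_sum_sq_eq ?_) hp
  simp only [Fin.sum_univ_three, planarMove]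
  simp
  linear_combination ((p.1 u 0 - p.1 v 0) ^ 2 + (p.1 u 1 - p.1 v 1) ^ 2) * h1

theorem planarNormalize_planarMove {p : Placement N × EuclideanSpace ℝ (Fin 3)}
    (hp : p.1 ∈ reducedConfigSpace α L) (hs : p.2 2 ^ 2 < 1) (hx : 0 < p.1 (some 0) 0) :
    planarNormalize (planarMove p) = p := by
  obtain ⟨-, h1, h2, h3⟩ := hp
  have hc : √(1 - p.2 2 ^ 2) ^ 2 = 1 - p.2 2 ^ 2 := Real.sq_sqrt (by linarith)
  have hn : baseNorm (planarMove p) = p.1 (some 0) 0 := by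
    rw [baseNorm, Real.sqrt_eq_iff_mul_self_eq_of_pos hx]
    simp [planarMove, h1, h2, h3]
    linear_combination -p.1 (some 0) 0 ^ 2 * hc
  have hbc : baseCos (planarMove p) = √(1 - p.2 2 ^ 2) := by
    rw [baseCos, hn, div_eq_iff hx.ne']
    simp [planarMove, h1, h2, h3]
  have hbs : baseSin (planarMove p) = p.2 2 := by
    rw [baseSin, hn, div_eq_iff hx.ne']
    simp [planarMove, h1, h2, h3]
  refine Prod.ext (funext fun v => ?_) ?_
  · ext i
    simp only [planarNormalize, hbc, hbs]
    fin_cases i <;> simp [planarMove, h1, h2]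
    · linear_combination p.1 v 0 * hc
    · linear_combination p.1 v 1 * hc
  · ext i
    simp only [planarNormalize, hbs]
    fin_cases i <;> simp [planarMove, h1, h2]

theorem contDiffAt_placement {E : Type*} [NormedAddCommGroup E] [NormedSpace ℝ E]
    {f : E → Placement N} {x : E} (h0 : ∀ v, ContDiffAt ℝ ⊤ (fun y => f y v 0) x)
    (h1 : ∀ v, ContDiffAt ℝ ⊤ (fun y => f y v 1) x)
    (h2 : ∀ v, ContDiffAt ℝ ⊤ (fun y => f y v 2) x) : ContDiffAt ℝ ⊤ f x := by
  rw [contDiffAt_pi]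
  intro v
  rw [contDiffAt_euclidean]
  intro i
  fin_cases i
  exacts [h0 v, h1 v, h2 v]

theorem flatState_base :
    flatState α L (some 0) 0 - flatState α L none 0 = L 0 ∧
      flatState α L (some 0) 1 - flatState α L none 1 = 0 := by
  simp [flatState]

/-- The configuration space is locally the product of the reduced configuration space and the rigid
motions in the plane. -/
theorem isGermIso_planarNormalize (hL : ∀ n, 0 < L n) :
    IsGermIso (configSpace α L) (flatState α L)
      (reducedConfigSpace α L ×ˢ (Set.univ : Set (EuclideanSpace ℝ (Fin 3)))) (flatState α L, 0)
      planarNormalize planarMove := by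
  obtain ⟨b1, b2⟩ := flatState_base (α := α) (L := L)
  have hL0 := hL 0
  have hbn : baseNorm (flatState α L) = L 0 := by
    rw [baseNorm, b1, b2]
    simp [Real.sqrt_sq hL0.le]
  have hc1 : ∀ (v : Vertex N) (i : Fin 3) (Y : Placement N),
      ContDiffAt ℝ ⊤ (fun X : Placement N => X v i) Y := fun v i Y =>
    (contDiff_coord v i).contDiffAt
  have hn : ContDiffAt ℝ ⊤ baseNorm (flatState α L) := by
    refine ContDiffAt.sqrt (by fun_prop) ?_
    rw [b1, b2]
    have := hL0.ne'
    simp [this]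
  have hbc : ContDiffAt ℝ ⊤ baseCos (flatState α L) :=
    ContDiffAt.div (by fun_prop) hn (by rw [hbn]; exact hL0.ne')
  have hbs : ContDiffAt ℝ ⊤ baseSin (flatState α L) :=
    ContDiffAt.div (by fun_prop) hn (by rw [hbn]; exact hL0.ne')
  have hev : ∀ᶠ X in 𝓝 (flatState α L), 0 < X (some 0) 0 - X none 0 :=
    continuousAt_const.eventually_lt (f := fun _ => (0 : ℝ))
      (((hc1 _ _ _).sub (hc1 _ _ _)).continuousAt) (by rw [b1]; exact hL0)
  have hev' : ∀ᶠ p : Placement N × EuclideanSpace ℝ (Fin 3) in 𝓝 (flatState α L, 0),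
      p.2 2 ^ 2 < 1 ∧ 0 < p.1 (some 0) 0 := by
    refine .and (ContinuousAt.eventually_lt (by fun_prop) continuousAt_const (by simp))
      (ContinuousAt.eventually_lt continuousAt_const (by fun_prop) ?_)
    simpa [flatState] using hL0
  exact
    { mem_left := flatState_mem.1
      mem_right := ⟨flatState_mem, trivial⟩
      analyticAt_toFun := by
        refine ContDiffAt.analyticAt (ContDiffAt.prodMk (contDiffAt_placement
          (fun v => ?_) (fun v => ?_) fun v => ?_) ?_)
        · exact (hbc.mul ((hc1 _ _ _).sub (hc1 _ _ _))).add (hbs.mul ((hc1 _ _ _).sub (hc1 _ _ _)))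
        · exact (hbs.neg.mul ((hc1 _ _ _).sub (hc1 _ _ _))).add
            (hbc.mul ((hc1 _ _ _).sub (hc1 _ _ _)))
        · exact hc1 _ _ _
        · rw [contDiffAt_euclidean]
          intro i
          fin_cases i
          exacts [hc1 none 0 _, hc1 none 1 _, hbs]
      analyticAt_invFun := by
        have hsq : ContDiffAt ℝ ⊤ (fun p : Placement N × EuclideanSpace ℝ (Fin 3) =>
            √(1 - p.2 2 ^ 2)) (flatState α L, 0) := ContDiffAt.sqrt (by fun_prop) (by simp)
        refine ContDiffAt.analyticAt (contDiffAt_placement (fun v => ?_) (fun v => ?_) fun v => ?_)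
        · change ContDiffAt ℝ ⊤ (fun p : Placement N × EuclideanSpace ℝ (Fin 3) =>
            p.2 0 + √(1 - p.2 2 ^ 2) * p.1 v 0 - p.2 2 * p.1 v 1) _
          fun_prop
        · change ContDiffAt ℝ ⊤ (fun p : Placement N × EuclideanSpace ℝ (Fin 3) =>
            p.2 1 + p.2 2 * p.1 v 0 + √(1 - p.2 2 ^ 2) * p.1 v 1) _
          fun_prop
        · change ContDiffAt ℝ ⊤ (fun p : Placement N × EuclideanSpace ℝ (Fin 3) => p.1 v 2) _
          fun_prop
      map_base := by
        have e1 : baseCos (flatState α L) = 1 := by rw [baseCos, hbn, b1, div_self hL0.ne']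
        have e2 : baseSin (flatState α L) = 0 := by rw [baseSin, hbn, b2, zero_div]
        refine Prod.ext (funext fun v => ?_) ?_
        · ext i
          simp only [planarNormalize, e1, e2]
          fin_cases i <;> simp [flatState]
        · ext i
          simp only [planarNormalize, e2]
          fin_cases i <;> simp [flatState]
      inv_base := by
        funext v
        ext i
        fin_cases i <;> simp [planarMove]
      mapsTo := by
        filter_upwards [hev.filter_mono nhdsWithin_le_nhds, self_mem_nhdsWithin] with X h hX
        exact ⟨planarNormalize_mem h hX, trivial⟩
      inv_mapsTo := by
        filter_upwards [hev'.filter_mono nhdsWithin_le_nhds, self_mem_nhdsWithin] with p h hp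
        exact planarMove_mem hp.1.1 h.1
      left_inv := (hev.filter_mono nhdsWithin_le_nhds).mono fun X h => planarMove_planarNormalize h
      right_inv := by
        filter_upwards [hev'.filter_mono nhdsWithin_le_nhds, self_mem_nhdsWithin] with p h hp
        exact planarNormalize_planarMove hp.1 h.1 h.2 }

end PlanarMotions

/-! ### The germ of the null-cone -/

section NullCone

variable {N : ℕ} [NeZero N] {α L : Fin N → ℝ} {w : ℤ}

/-- A chart of the slice that straightens the closing condition, tangent to the identity. -/
theorem exists_slice_chart (hα : ∀ n, 0 < |α n| ∧ |α n| < Real.pi)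
    (hw : ∑ n, α n = 2 * Real.pi * w) :
    ∃ F G : Slice N → Slice N, F 0 = 0 ∧ HasFDerivAt F (ContinuousLinearMap.id ℝ (Slice N)) 0 ∧
      IsGermIso {z : Slice N | angleForm α z z z = 0} 0
        {y : Slice N | slopeForm α y.1 y.1 = 0} 0 F G := by
  obtain ⟨F, G, hF, hG, hF0, hG0, hl, hr, hd, hS⟩ := exists_morse_chart (angleForm α)
    (analyticAt_angleForm hα) (Eventually.of_forall fun z => angleForm_comm α z) fun a ha =>
      slopeForm_slice_nondegenerate hα hw a fun b => by rw [← angleForm_zero hα, ha]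
  refine ⟨F, G, hF0, hd, ?_⟩
  have := isGermIso_of_morse_chart hF hG hF0 hG0 hl hr hS
  simpa only [angleForm_zero hα] using this

/-- The Morse map acts only on the slice. The three remaining coordinates, hub height and tilts,
become the coefficients of an affine function of heights, on which the stress form does not depend.
-/
theorem isGermIso_nullCone (hα : ∀ n, 0 < |α n| ∧ |α n| < Real.pi)
    (hw : ∑ n, α n = 2 * Real.pi * w) (hL : ∀ n, 0 < L n) {F G : Slice N → Slice N}
    (h : IsGermIso {z : Slice N | angleForm α z z z = 0} 0
        {y : Slice N | slopeForm α y.1 y.1 = 0} 0 F G)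
    (hN : 2 ≤ N) (hs : ∀ n, Real.sin (α n) ≠ 0) (hL' : ∀ n, L n ≠ 0) :
    IsGermIso (reducedConfigSpace α L) (flatState α L) (nullCone (stressForm α L)) 0
      ((heightsEquiv hN hs hL').symm ∘ Prod.map F id ∘ reducedChart α L)
      ((reducedChartInv α L ∘ Prod.map G id) ∘ heightsEquiv hN hs hL') := by
  have h1 := (isGermIso_reducedChart hα hw hL).trans
    (h.prodMap (IsGermIso.refl (Set.mem_univ (0 : ℝ × ℝ × ℝ))))
  refine h1.trans (IsGermIso.of_continuousLinearEquiv (heightsEquiv hN hs hL').symm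
    (fun p => ?_) ⟨by simp [slopeForm], trivial⟩)
  simp only [nullCone, Set.mem_ofPred_eq, stressForm_heightsEquiv_symm hN hs hL' hw, Set.mem_prod,
    Set.mem_univ, and_true]

end NullCone

/-! ### Areas of the two sides of a graph on the sphere -/

section Regions

/-- The horizontal part of a point in space, as a complex number. -/
def plane (x : Space) : ℂ := ⟨x 0, x 1⟩

theorem continuous_plane : Continuous plane := by
  have : plane = fun x : Space => Complex.equivRealProdCLM.symm (x 0, x 1) := by
    ext x; rfl
  rw [this]
  fun_prop

theorem plane_smul (r : ℝ) (x : Space) : plane (r • x) = r * plane x := by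
  apply Complex.ext <;> simp [plane]

theorem norm_sq_eq_plane (x : Space) : ‖x‖ ^ 2 = ‖plane x‖ ^ 2 + x 2 ^ 2 := by
  rw [EuclideanSpace.norm_sq_eq, ← Complex.normSq_eq_norm_sq, Complex.normSq_apply]
  simp [Fin.sum_univ_three, plane]
  ring

/-- The height of the unit sphere over the unit disc. -/
def capHeight (p : ℂ) : ℝ := √(1 - ‖p‖ ^ 2)

/-- A height function truncated to the unit ball. -/
def truncHeight (ζ : ℂ → ℝ) (p : ℂ) : ℝ := max (-capHeight p) (min (ζ p) (capHeight p))

/-- The integral of a truncated height function over the unit disc. -/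
def truncIntegral (ζ : ℂ → ℝ) : ℝ := ∫ p in Metric.ball (0 : ℂ) 1, truncHeight ζ p

theorem continuous_capHeight : Continuous capHeight := by
  unfold capHeight; fun_prop

theorem continuous_neg_capHeight : Continuous fun p => -capHeight p := continuous_capHeight.neg

theorem capHeight_nonneg (p : ℂ) : 0 ≤ capHeight p := Real.sqrt_nonneg _

theorem continuous_truncHeight {ζ : ℂ → ℝ} (h : Continuous ζ) : Continuous (truncHeight ζ) :=
  continuous_capHeight.neg.max (h.min continuous_capHeight)

theorem integrableOn_disc {f : ℂ → ℝ} (h : Continuous f) :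
    IntegrableOn f (Metric.ball (0 : ℂ) 1) :=
  (h.continuousOn.integrableOn_compact (isCompact_closedBall (0 : ℂ) 1)).mono_set
    Metric.ball_subset_closedBall

/-- Cylindrical coordinates. -/
def cylinder (x : Space) : ℂ × ℝ := (plane x, x 2)

theorem measurePreserving_cylinder : MeasurePreserving cylinder := by
  have h1 := PiLp.volume_preserving_ofLp (Fin 3)
  have h2 := volume_preserving_piFinSuccAbove (fun _ : Fin 3 => ℝ) 2
  have h3 := (Complex.volume_preserving_equiv_real_prod.symm).comp (volume_preserving_finTwoArrow ℝ)
  have h4 := ((MeasurePreserving.id (volume : Measure ℝ)).prod h3)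
  have h5 := (Measure.measurePreserving_swap (μ := (volume : Measure ℝ))
    (ν := (volume : Measure ℂ))).comp (h4.comp (h2.comp h1))
  exact h5

/-- The part of the sphere above the graph of a height function. -/
def upperRegion (ζ : ℂ → ℝ) : Set UnitSphere := {u | ζ (plane u) < (u : Space) 2}

/-- The part of the sphere below the graph of a height function. -/
def lowerRegion (ζ : ℂ → ℝ) : Set UnitSphere := {u | (u : Space) 2 < ζ (plane u)}

theorem isOpen_upperRegion {ζ : ℂ → ℝ} (h : Continuous ζ) : IsOpen (upperRegion ζ) := by
  have := continuous_plane
  exact isOpen_lt (by fun_prop) (by fun_prop)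

theorem isOpen_lowerRegion {ζ : ℂ → ℝ} (h : Continuous ζ) : IsOpen (lowerRegion ζ) := by
  have := continuous_plane
  exact isOpen_lt (by fun_prop) (by fun_prop)

/-- The spherical measure is defined through the volume of the cone over a set; the cone over the
trace of a conical set A is A within the open unit ball. -/
theorem mem_Ioo_smul_iff {A : Set Space} (hA : ∀ (r : ℝ) (x : Space), 0 < r → (r • x ∈ A ↔ x ∈ A))
    (h0 : (0 : Space) ∉ A) (x : Space) :
    x ∈ Set.Ioo (0 : ℝ) 1 • ((↑) '' {u : UnitSphere | (u : Space) ∈ A} : Set Space) ↔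
      ‖x‖ < 1 ∧ x ∈ A := by
  rw [Set.mem_smul]
  constructor
  · rintro ⟨r, hr, _, ⟨u, hu, rfl⟩, rfl⟩
    refine ⟨?_, (hA r _ hr.1).2 hu⟩
    rw [norm_smul, Real.norm_of_nonneg hr.1.le, norm_eq_of_mem_sphere, mul_one]
    exact hr.2
  · rintro ⟨h1, h2⟩
    have hx : x ≠ 0 := fun h => h0 (h ▸ h2)
    have hn : 0 < ‖x‖ := norm_pos_iff.2 hx
    refine ⟨‖x‖, ⟨hn, h1⟩, ‖x‖⁻¹ • x, ⟨⟨‖x‖⁻¹ • x, ?_⟩, ?_, rfl⟩, ?_⟩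
    · rw [mem_sphere_zero_iff_norm, norm_smul, norm_inv, norm_norm, inv_mul_cancel₀ hn.ne']
    · exact (hA _ _ (inv_pos.2 hn)).2 h2
    · rw [smul_smul, mul_inv_cancel₀ hn.ne', one_smul]

theorem norm_lt_one_iff (x : Space) :
    ‖x‖ < 1 ↔ ‖plane x‖ < 1 ∧ -capHeight (plane x) < x 2 ∧ x 2 < capHeight (plane x) := by
  rw [← abs_lt, capHeight, Real.lt_sqrt (abs_nonneg _), sq_abs,
    ← sq_lt_one_iff₀ (norm_nonneg _), norm_sq_eq_plane, ← sq_lt_one_iff₀ (norm_nonneg (plane x))]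
  constructor
  · intro h
    exact ⟨by nlinarith [sq_nonneg (x 2)], by linarith⟩
  · rintro ⟨_, h⟩
    linarith

/-- A positively homogeneous function on the plane. -/
def PosHomogeneous (ζ : ℂ → ℝ) : Prop := ∀ (r : ℝ) (p : ℂ), 0 ≤ r → ζ (r * p) = r * ζ p

variable {ζ : ℂ → ℝ}

theorem PosHomogeneous.map_zero (hζ : PosHomogeneous ζ) : ζ 0 = 0 := by
  simpa using hζ 0 0 le_rfl

/-- Area on the unit sphere is 3 times the volume of the solid cone over it, 3 being the dimension.
In cylindrical coordinates that cone lies between two graphs over the unit disc. -/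
theorem area_eq_regionBetween {f g : ℂ → ℝ} (hf : Continuous f) (hg : Continuous g)
    (hfg : ∀ p, f p ≤ g p) {A : Set Space}
    (hA : ∀ (r : ℝ) (x : Space), 0 < r → (r • x ∈ A ↔ x ∈ A)) (h0 : (0 : Space) ∉ A)
    (hm : MeasurableSet A)
    (h : ∀ x : Space, ‖plane x‖ < 1 → (-capHeight (plane x) < x 2 ∧ x 2 < capHeight (plane x) ∧ x ∈ A ↔
      f (plane x) < x 2 ∧ x 2 < g (plane x))) :
    area {u : UnitSphere | (u : Space) ∈ A} =
      ENNReal.ofReal (3 * ∫ p in Metric.ball (0 : ℂ) 1, (g p - f p)) := by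
  have hmu : MeasurableSet {u : UnitSphere | (u : Space) ∈ A} := measurable_subtype_coe hm
  rw [area, Measure.toSphere_apply' _ hmu]
  have hs : (Set.Ioo (0 : ℝ) 1 • ((↑) '' {u : UnitSphere | (u : Space) ∈ A} : Set Space)) =
      cylinder ⁻¹' regionBetween f g (Metric.ball (0 : ℂ) 1) := by
    ext x
    rw [mem_Ioo_smul_iff hA h0, norm_lt_one_iff, Set.mem_preimage, regionBetween, Set.mem_ofPred_eq,
      mem_ball_zero_iff, Set.mem_Ioo]
    simp only [cylinder]
    constructor
    · rintro ⟨⟨h1, h2, h3⟩, h4⟩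
      exact ⟨h1, (h x h1).1 ⟨h2, h3, h4⟩⟩
    · rintro ⟨h1, h2⟩
      obtain ⟨h3, h4, h5⟩ := (h x h1).2 h2
      exact ⟨⟨h1, h3, h4⟩, h5⟩
  have hreg := measurableSet_regionBetween hf.measurable hg.measurable
    (measurableSet_ball (x := (0 : ℂ)) (ε := 1))
  have hint : 0 ≤ ∫ p in Metric.ball (0 : ℂ) 1, (g p - f p) :=
    integral_nonneg fun p => sub_nonneg.2 (hfg p)
  rw [hs, measurePreserving_cylinder.measure_preimage hreg.nullMeasurableSet]
  have := volume_regionBetween_eq_integral (μ := (volume : Measure ℂ)) (integrableOn_disc hf)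
    (integrableOn_disc hg) measurableSet_ball (fun p _ => hfg p)
  rw [Measure.volume_eq_prod, this, ENNReal.ofReal_mul (by norm_num)]
  simp

theorem truncHeight_mem (ζ : ℂ → ℝ) (p : ℂ) :
    -capHeight p ≤ truncHeight ζ p ∧ truncHeight ζ p ≤ capHeight p := by
  have := capHeight_nonneg p
  exact ⟨le_max_left _ _, max_le (by linarith) (min_le_right _ _)⟩

theorem area_upperRegion (hζ : PosHomogeneous ζ) (hc : Continuous ζ) : area (upperRegion ζ) =
    ENNReal.ofReal (3 * ∫ p in Metric.ball (0 : ℂ) 1, (capHeight p - truncHeight ζ p)) := by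
  have hp := continuous_plane
  refine area_eq_regionBetween (A := {x | ζ (plane x) < x 2}) (continuous_truncHeight hc)
    continuous_capHeight (fun p => (truncHeight_mem ζ p).2) ?_ ?_ ?_ ?_
  · intro r x hr
    simp only [Set.mem_ofPred_eq, plane_smul, hζ _ _ hr.le, PiLp.smul_apply, smul_eq_mul]
    exact mul_lt_mul_iff_right₀ hr
  · have : plane 0 = 0 := by apply Complex.ext <;> simp [plane]
    simp [this, hζ.map_zero]
  · exact (isOpen_lt (by fun_prop) (by fun_prop)).measurableSet
  · intro x hx
    simp only [truncHeight, Set.mem_ofPred_eq, max_lt_iff, min_lt_iff]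
    constructor
    · rintro ⟨h1, h2, h3⟩
      exact ⟨⟨h1, .inl h3⟩, h2⟩
    · rintro ⟨⟨h1, h2⟩, h3⟩
      exact ⟨h1, h3, h2.resolve_right h3.not_gt⟩

theorem area_lowerRegion (hζ : PosHomogeneous ζ) (hc : Continuous ζ) : area (lowerRegion ζ) =
    ENNReal.ofReal (3 * ∫ p in Metric.ball (0 : ℂ) 1, (truncHeight ζ p - -capHeight p)) := by
  have hp := continuous_plane
  refine area_eq_regionBetween (A := {x | x 2 < ζ (plane x)}) continuous_neg_capHeight
    (continuous_truncHeight hc) (fun p => (truncHeight_mem ζ p).1) ?_ ?_ ?_ ?_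
  · intro r x hr
    simp only [Set.mem_ofPred_eq, plane_smul, hζ _ _ hr.le, PiLp.smul_apply, smul_eq_mul]
    exact mul_lt_mul_iff_right₀ hr
  · have : plane 0 = 0 := by apply Complex.ext <;> simp [plane]
    simp [this, hζ.map_zero]
  · exact (isOpen_lt (by fun_prop) (by fun_prop)).measurableSet
  · intro x hx
    simp only [truncHeight, Set.mem_ofPred_eq, lt_max_iff, lt_min_iff]
    constructor
    · rintro ⟨h1, h2, h3⟩
      exact ⟨h1, .inr ⟨h3, h2⟩⟩
    · rintro ⟨h1, h2⟩
      have := h2.resolve_left (by linarith)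
      exact ⟨h1, this.2, this.1⟩

/-- This is half the volume 4π/3 of the unit ball. -/
theorem integral_capHeight : ∫ p in Metric.ball (0 : ℂ) 1, capHeight p = 2 * Real.pi / 3 := by
  have h2 : volume (Metric.ball (0 : Space) 1) =
      ENNReal.ofReal (∫ p in Metric.ball (0 : ℂ) 1, (capHeight p - -capHeight p)) := by
    have hb : Metric.ball (0 : Space) 1 =
        cylinder ⁻¹' regionBetween (fun p => -capHeight p) capHeight (Metric.ball (0 : ℂ) 1) := by
      ext x
      rw [mem_ball_zero_iff, norm_lt_one_iff]
      simp [regionBetween, cylinder]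
    have hc := continuous_capHeight
    rw [hb, measurePreserving_cylinder.measure_preimage (measurableSet_regionBetween
      continuous_neg_capHeight.measurable hc.measurable measurableSet_ball).nullMeasurableSet]
    exact volume_regionBetween_eq_integral (μ := (volume : Measure ℂ)) (integrableOn_disc continuous_neg_capHeight)
      (integrableOn_disc hc) measurableSet_ball
      (fun p _ => by have := capHeight_nonneg p; linarith)
  rw [EuclideanSpace.volume_ball_fin_three] at h2
  have h3 : ∫ p in Metric.ball (0 : ℂ) 1, (capHeight p - -capHeight p) =
      2 * ∫ p in Metric.ball (0 : ℂ) 1, capHeight p := by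
    rw [← integral_const_mul]
    congr 1; ext p; ring
  have h4 : 0 ≤ ∫ p in Metric.ball (0 : ℂ) 1, capHeight p := integral_nonneg capHeight_nonneg
  rw [h3, ENNReal.ofReal_one, one_pow, one_mul,
    ENNReal.ofReal_eq_ofReal_iff (by positivity) (by positivity)] at h2
  linarith

/-- The area equals 2π minus three times the truncated integral. -/
theorem area_upperRegion_lt_iff (hζ : PosHomogeneous ζ) (hc : Continuous ζ) :
    area (upperRegion ζ) < ENNReal.ofReal (2 * Real.pi) ↔ 0 < truncIntegral ζ := by
  rw [area_upperRegion hζ hc, ENNReal.ofReal_lt_ofReal_iff (by positivity),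
    integral_sub (integrableOn_disc continuous_capHeight)
      (integrableOn_disc (continuous_truncHeight hc)), integral_capHeight, truncIntegral]
  constructor <;> intro h <;> linarith

theorem area_lowerRegion_lt_iff (hζ : PosHomogeneous ζ) (hc : Continuous ζ) :
    area (lowerRegion ζ) < ENNReal.ofReal (2 * Real.pi) ↔ truncIntegral ζ < 0 := by
  rw [area_lowerRegion hζ hc, ENNReal.ofReal_lt_ofReal_iff (by positivity),
    integral_sub (integrableOn_disc (continuous_truncHeight hc))
      (integrableOn_disc continuous_neg_capHeight), integral_neg, integral_capHeight, truncIntegral]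
  constructor <;> intro h <;> linarith

/-- Radial projection of a half-space to a region above or below a graph. -/
theorem isPreconnected_region (hζ : PosHomogeneous ζ) (hc : Continuous ζ) (σ : ℝ) :
    IsPreconnected {u : UnitSphere | 0 < σ * ((u : Space) 2 - ζ (plane u))} := by
  let V : Set (ℂ × ℝ) := {q | 0 < σ * q.2}
  have hV : IsPreconnected V := by
    refine Convex.isPreconnected ?_
    have : V = (σ • LinearMap.snd ℝ ℂ ℝ) ⁻¹' Set.Ioi 0 := by ext q; simp [V]
    rw [this]
    exact (convex_Ioi 0).linear_preimage _
  -- The shear by ζ carries the convex half-space to the open cone on one side of the graph;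
  -- normalising to length 1 maps this cone onto the region of the sphere.
  let lift : ℂ × ℝ → Space := fun q => !₂[q.1.re, q.1.im, ζ q.1 + q.2]
  have hlift : Continuous lift := by
    refine (PiLp.continuous_toLp 2 _).comp (continuous_pi fun i => ?_)
    fin_cases i
    · exact Complex.continuous_re.comp continuous_fst
    · exact Complex.continuous_im.comp continuous_fst
    · exact (hc.comp continuous_fst).add continuous_snd
  have hpl : ∀ q, plane (lift q) = q.1 := fun q => by apply Complex.ext <;> simp [plane, lift]
  have hne : ∀ q ∈ V, lift q ≠ 0 := by
    intro q hq h0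
    have h1 := hpl q
    have h2 : (lift q) 2 = 0 := by rw [h0]; rfl
    have h3 : q.1 = 0 := by
      rw [← h1, h0]; apply Complex.ext <;> simp [plane]
    simp only [lift, h3, hζ.map_zero] at h2
    simp at h2
    simp [V, h2] at hq
  let f : V → UnitSphere := fun q => ⟨‖lift q‖⁻¹ • lift q, by
    rw [mem_sphere_zero_iff_norm, norm_smul, norm_inv, norm_norm,
      inv_mul_cancel₀ (norm_ne_zero_iff.2 (hne q q.2))]⟩
  have hf : Continuous f := by
    refine Continuous.subtype_mk ?_ _
    refine Continuous.smul (Continuous.inv₀ ?_ fun q : V => norm_ne_zero_iff.2 (hne q.1 q.2)) ?_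
    · exact (hlift.comp continuous_subtype_val).norm
    · exact hlift.comp continuous_subtype_val
  have hVu : IsPreconnected (Set.univ : Set V) := by
    have := isPreconnected_iff_preconnectedSpace.1 hV
    exact isPreconnected_univ
  have himg : f '' Set.univ = {u : UnitSphere | 0 < σ * ((u : Space) 2 - ζ (plane u))} := by
    ext u
    simp only [Set.image_univ, Set.mem_range, Set.mem_ofPred_eq]
    constructor
    · rintro ⟨⟨q, hq⟩, rfl⟩
      have hn : 0 < ‖lift q‖⁻¹ := inv_pos.2 (norm_pos_iff.2 (hne q hq))
      have hq' : 0 < σ * q.2 := hq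
      simp only [f, plane_smul, hpl, hζ _ _ hn.le, PiLp.smul_apply, smul_eq_mul]
      have : (lift q) 2 = ζ q.1 + q.2 := rfl
      rw [this, ← mul_sub, add_sub_cancel_left, mul_left_comm]
      exact mul_pos hn hq'
    · intro hu
      refine ⟨⟨(plane u, (u : Space) 2 - ζ (plane u)), hu⟩, ?_⟩
      have hl : lift (plane u, (u : Space) 2 - ζ (plane u)) = u := by
        ext i
        fin_cases i <;> simp [lift, plane]
      refine Subtype.ext ?_
      simp only [f, hl, norm_eq_of_mem_sphere, inv_one, one_smul]
  rw [← himg]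
  exact hVu.image f hf.continuousOn

theorem isPreconnected_upperRegion (hζ : PosHomogeneous ζ) (hc : Continuous ζ) :
    IsPreconnected (upperRegion ζ) := by
  convert isPreconnected_region hζ hc 1 using 1
  ext u; simp [upperRegion]

theorem isPreconnected_lowerRegion (hζ : PosHomogeneous ζ) (hc : Continuous ζ) :
    IsPreconnected (lowerRegion ζ) := by
  convert isPreconnected_region hζ hc (-1) using 1
  ext u; simp [lowerRegion]

theorem disjoint_regions : Disjoint (upperRegion ζ) (lowerRegion ζ) := by
  rw [Set.disjoint_left]
  intro u h1 h2
  exact lt_asymm (show ζ (plane u) < (u : Space) 2 from h1) h2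

theorem connectedComponentIn_eq_of_separated {X : Type*} [TopologicalSpace X] {S A B : Set X}
    (hS : S = A ∪ B) (hA : IsOpen A) (hB : IsOpen B) (hAB : Disjoint A B)
    (hc : IsPreconnected A) {x : X} (hx : x ∈ A) : connectedComponentIn S x = A := by
  subst hS
  refine Set.Subset.antisymm ?_ (hc.subset_connectedComponentIn hx Set.subset_union_left)
  exact isPreconnected_connectedComponentIn.subset_left_of_subset_union hA hB hAB
    (connectedComponentIn_subset _ _)
    ⟨x, mem_connectedComponentIn (Or.inl hx), hx⟩

variable {N : ℕ} [NeZero N] {X : Placement N}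

theorem compl_vertexTrace (hT : vertexTrace X = {u : UnitSphere | (u : Space) 2 = ζ (plane u)}) :
    (vertexTrace X)ᶜ = upperRegion ζ ∪ lowerRegion ζ := by
  rw [hT]
  ext u
  simp only [Set.mem_compl_iff, Set.mem_ofPred_eq, Set.mem_union, upperRegion, lowerRegion]
  rw [← ne_eq, ne_iff_lt_or_gt, or_comm]

theorem upperPiece_eq (hζ : PosHomogeneous ζ) (hc : Continuous ζ)
    (hT : vertexTrace X = {u : UnitSphere | (u : Space) 2 = ζ (plane u)}) : upperPiece X = upperRegion ζ := by
  refine connectedComponentIn_eq_of_separated (compl_vertexTrace hT) (isOpen_upperRegion hc)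
    (isOpen_lowerRegion hc) disjoint_regions (isPreconnected_upperRegion hζ hc) ?_
  have : plane (northPole : Space) = 0 := by apply Complex.ext <;> simp [plane, northPole]
  simp only [upperRegion, Set.mem_ofPred_eq, this, hζ.map_zero]
  simp [northPole]

theorem lowerPiece_eq (hζ : PosHomogeneous ζ) (hc : Continuous ζ)
    (hT : vertexTrace X = {u : UnitSphere | (u : Space) 2 = ζ (plane u)}) : lowerPiece X = lowerRegion ζ := by
  refine connectedComponentIn_eq_of_separated ((compl_vertexTrace hT).trans (Set.union_comm _ _))
    (isOpen_lowerRegion hc) (isOpen_upperRegion hc) disjoint_regions.symm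
    (isPreconnected_lowerRegion hζ hc) ?_
  have : plane (southPole : Space) = 0 := by apply Complex.ext <;> simp [plane, southPole]
  simp only [lowerRegion, Set.mem_ofPred_eq, this, hζ.map_zero]
  simp [southPole]

/-- If the faces form the graph of a function, the popped state is read off from an integral. -/
theorem popped_iff (hζ : PosHomogeneous ζ) (hc : Continuous ζ)
    (hT : vertexTrace X = {u : UnitSphere | (u : Space) 2 = ζ (plane u)}) :
    (PoppedUp X ↔ truncIntegral ζ < 0) ∧ (PoppedDown X ↔ 0 < truncIntegral ζ) := by
  rw [PoppedUp, PoppedDown, upperPiece_eq hζ hc hT, lowerPiece_eq hζ hc hT]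
  exact ⟨area_lowerRegion_lt_iff hζ hc, area_upperRegion_lt_iff hζ hc⟩

end Regions

/-! ### Integrals over the disc and the effect of truncation -/

section DiscIntegrals

variable {ζ ℓ : ℂ → ℝ}

/-- Polar coordinates: one factor r from homogeneity and one from the Jacobian give ∫ r² dr = 1/3.
-/
theorem integral_disc_of_posHomogeneous (hζ : PosHomogeneous ζ) :
    ∫ p in Metric.ball (0 : ℂ) 1, ζ p =
      1 / 3 * ∫ θ in (0 : ℝ)..(2 * Real.pi), ζ (Complex.exp (θ * Complex.I)) := by
  rw [← integral_indicator measurableSet_ball, ← Complex.integral_comp_polarCoord_symm]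
  have h1 : ∀ q ∈ polarCoord.target,
      q.1 • (Metric.ball (0 : ℂ) 1).indicator ζ (Complex.polarCoord.symm q) =
        (Set.Ioo (0 : ℝ) 1).indicator (fun r => r ^ 2) q.1 *
          ζ (Complex.exp (q.2 * Complex.I)) := by
    rintro ⟨r, θ⟩ hq
    have hr : 0 < r := by
      simp only [polarCoord_target, Set.mem_prod, Set.mem_Ioi] at hq
      exact hq.1
    have he : Complex.polarCoord.symm (r, θ) = r * Complex.exp (θ * Complex.I) := by
      rw [Complex.polarCoord_symm_apply, Complex.exp_mul_I]
      simp
    have hn : ‖(r : ℂ) * Complex.exp (θ * Complex.I)‖ = r := by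
      rw [norm_mul, Complex.norm_exp_ofReal_mul_I, mul_one, Complex.norm_real,
        Real.norm_of_nonneg hr.le]
    simp only [he, smul_eq_mul]
    by_cases h : r < 1
    · rw [Set.indicator_of_mem (by rw [mem_ball_zero_iff, hn]; exact h),
        Set.indicator_of_mem (show r ∈ Set.Ioo (0 : ℝ) 1 from ⟨hr, h⟩), hζ _ _ hr.le]
      ring
    · rw [Set.indicator_of_notMem (by rw [mem_ball_zero_iff, hn]; exact h),
        Set.indicator_of_notMem (fun h' => h h'.2)]
      simp
  have hm : MeasurableSet polarCoord.target := polarCoord.open_target.measurableSet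
  rw [setIntegral_congr_fun hm h1, polarCoord_target, Measure.volume_eq_prod,
    setIntegral_prod_mul (f := (Set.Ioo (0 : ℝ) 1).indicator fun r => r ^ 2)
      (g := fun θ : ℝ => ζ (Complex.exp (θ * Complex.I)))]
  congr 1
  · rw [setIntegral_indicator measurableSet_Ioo,
      Set.inter_eq_self_of_subset_right Set.Ioo_subset_Ioi_self, ← integral_Ioc_eq_integral_Ioo,
      ← intervalIntegral.integral_of_le zero_le_one, integral_pow]
    norm_num
  · have hper : Function.Periodic (fun θ : ℝ => ζ (Complex.exp (θ * Complex.I)))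
        (2 * Real.pi) := by
      intro θ
      have : ((θ + 2 * Real.pi : ℝ) : ℂ) * Complex.I =
          θ * Complex.I + 2 * Real.pi * Complex.I := by push_cast; ring
      simp only [this, Complex.exp_periodic _]
    have h2 := hper.intervalIntegral_add_eq (-Real.pi) 0
    rw [zero_add, show -Real.pi + 2 * Real.pi = Real.pi by ring] at h2
    rw [← h2, intervalIntegral.integral_of_le (by linarith [Real.pi_pos]),
      integral_Ioc_eq_integral_Ioo]

theorem integral_disc_of_odd (h : ∀ p, ℓ (-p) = -ℓ p) :
    ∫ p in Metric.ball (0 : ℂ) 1, ℓ p = 0 := by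
  rw [← integral_indicator measurableSet_ball]
  have h1 := integral_neg_eq_self ((Metric.ball (0 : ℂ) 1).indicator ℓ) volume
  have h2 : (fun p => (Metric.ball (0 : ℂ) 1).indicator ℓ (-p)) =
      fun p => -(Metric.ball (0 : ℂ) 1).indicator ℓ p := by
    ext p
    by_cases hp : p ∈ Metric.ball (0 : ℂ) 1
    · rw [Set.indicator_of_mem hp, Set.indicator_of_mem (by simpa using hp), h]
    · rw [Set.indicator_of_notMem hp, Set.indicator_of_notMem (by simpa using hp), neg_zero]
  rw [h2, integral_neg] at h1
  linarith

theorem capHeight_neg (p : ℂ) : capHeight (-p) = capHeight p := by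
  rw [capHeight, norm_neg, capHeight]

theorem truncHeight_odd (h : ∀ p, ℓ (-p) = -ℓ p) (p : ℂ) :
    truncHeight ℓ (-p) = -truncHeight ℓ p := by
  have := capHeight_nonneg p
  rw [truncHeight, truncHeight, h, capHeight_neg]
  grind

theorem abs_truncHeight_sub_le (ζ ℓ : ℂ → ℝ) (p : ℂ) :
    |truncHeight ζ p - truncHeight ℓ p| ≤ |ζ p - ℓ p| := by
  rw [truncHeight, truncHeight]
  grind

theorem truncHeight_eq_self {ε : ℝ} {p : ℂ} (h : |ζ p| ≤ ε) (hε : ε ≤ capHeight p) :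
    truncHeight ζ p = ζ p := by
  rw [truncHeight, min_eq_left (by grind), max_eq_right (by grind)]

/-- Truncating to the unit ball hardly changes the integral of a nearly linear height. -/
theorem abs_truncIntegral_sub_le (hζ : Continuous ζ) (hℓ : Continuous ℓ)
    (hodd : ∀ p, ℓ (-p) = -ℓ p) {ε δ : ℝ} (hε : ε ^ 2 ≤ 1) (hδ : 0 ≤ δ)
    (h1 : ∀ p, |ζ p| ≤ ε * ‖p‖) (h2 : ∀ p, |ℓ p| ≤ ε * ‖p‖) (h3 : ∀ p, |ζ p - ℓ p| ≤ δ * ‖p‖) :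
    |truncIntegral ζ - ∫ p in Metric.ball (0 : ℂ) 1, ζ p| ≤ 2 * δ * Real.pi * ε ^ 2 := by
  -- For ‖p‖ < r the sphere has height more than ε, so neither ζ nor ℓ is truncated there.
  set r := √(1 - ε ^ 2) with hr
  have hr2 : r ^ 2 = 1 - ε ^ 2 := Real.sq_sqrt (by linarith)
  have hr1 : r ≤ 1 := by nlinarith [Real.sqrt_nonneg (1 - ε ^ 2)]
  -- Subtracting the same expression for the odd function ℓ does not change the integral. What
  -- remains is at most 2δ and lives on the annulus outside radius r, of area πε². The factor δ
  -- makes the error small relative to the deviation from linearity, whatever the tilt.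
  let D : ℂ → ℝ := fun p => (truncHeight ζ p - ζ p) - (truncHeight ℓ p - ℓ p)
  have hD : truncIntegral ζ - ∫ p in Metric.ball (0 : ℂ) 1, ζ p =
      ∫ p in Metric.ball (0 : ℂ) 1, D p := by
    have i1 := integrableOn_disc (continuous_truncHeight hζ)
    have i2 := integrableOn_disc hζ
    have i3 := integrableOn_disc (continuous_truncHeight hℓ)
    have i4 := integrableOn_disc hℓ
    rw [show ∫ p in Metric.ball (0 : ℂ) 1, D p = _ from integral_sub (i1.sub i2) (i3.sub i4)]
    rw [integral_sub i1 i2, integral_sub i3 i4, integral_disc_of_odd hodd,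
      integral_disc_of_odd (truncHeight_odd hodd), truncIntegral]
    ring
  have hsub : Metric.ball (0 : ℂ) r ⊆ Metric.ball (0 : ℂ) 1 := Metric.ball_subset_ball hr1
  have hzero : ∀ p ∈ Metric.ball (0 : ℂ) 1, p ∉ Metric.ball (0 : ℂ) 1 \ Metric.ball (0 : ℂ) r →
      D p = 0 := by
    intro p hp hp'
    have hpr : ‖p‖ < r := by
      by_contra h
      exact hp' ⟨hp, by simpa using h⟩
    have hp1 : ‖p‖ ≤ 1 := hpr.le.trans hr1
    have hcap : ε * ‖p‖ ≤ capHeight p := by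
      refine Real.le_sqrt_of_sq_le ?_
      nlinarith [norm_nonneg p, mul_le_mul_of_nonneg_left (pow_le_one₀ (n := 2) (norm_nonneg p) hp1)
        (sq_nonneg ε)]
    simp only [D, truncHeight_eq_self (h1 p) hcap, truncHeight_eq_self (h2 p) hcap, sub_self]
  have hbound : ∀ p ∈ Metric.ball (0 : ℂ) 1 \ Metric.ball (0 : ℂ) r, ‖D p‖ ≤ 2 * δ := by
    intro p hp
    have hp1 : ‖p‖ ≤ 1 := (mem_ball_zero_iff.1 hp.1).le
    have h4 := abs_truncHeight_sub_le ζ ℓ p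
    have h5 := h3 p
    have h6 : δ * ‖p‖ ≤ δ := mul_le_of_le_one_right hδ hp1
    rw [Real.norm_eq_abs]
    simp only [D]
    grind
  rw [hD, setIntegral_eq_of_subset_of_forall_sdiff_eq_zero measurableSet_ball Set.sdiff_subset
    (fun p hp => hzero p hp.1 hp.2)]
  have hvol : (volume : Measure ℂ).real (Metric.ball (0 : ℂ) 1 \ Metric.ball (0 : ℂ) r) =
      Real.pi * ε ^ 2 := by
    have hb : ∀ s : ℝ, 0 ≤ s → (volume : Measure ℂ).real (Metric.ball (0 : ℂ) s) =
        s ^ 2 * Real.pi := by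
      intro s hs
      rw [Measure.real, Complex.volume_ball, ENNReal.toReal_mul, ENNReal.toReal_pow,
        ENNReal.toReal_ofReal hs]
      simp
    rw [measureReal_sdiff hsub measurableSet_ball, hb _ zero_le_one, hb _ (Real.sqrt_nonneg _), hr2]
    ring
  have := norm_setIntegral_le_of_norm_le_const (μ := (volume : Measure ℂ))
    (s := Metric.ball (0 : ℂ) 1 \ Metric.ball (0 : ℂ) r) (f := D) (C := 2 * δ)
    ((measure_mono Set.sdiff_subset).trans_lt measure_ball_lt_top) hbound
  rw [hvol, Real.norm_eq_abs] at this
  linarith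

end DiscIntegrals

/-! ### Piecewise linear functions on a fan of sectors -/

section Fan

/-- The cross product of the direction of polar angle `a` with a point of the plane. -/
def cross (a : ℝ) (p : ℂ) : ℝ := Real.cos a * p.im - Real.sin a * p.re

theorem continuous_cross (a : ℝ) : Continuous (cross a) := by
  unfold cross; fun_prop

theorem cross_smul (a r : ℝ) (p : ℂ) : cross a (r * p) = r * cross a p := by
  simp [cross]; ring

theorem cross_add (a : ℝ) (p q : ℂ) : cross a (p + q) = cross a p + cross a q := by
  simp [cross]; ring

theorem cross_exp (a θ : ℝ) : cross a (Complex.exp (θ * Complex.I)) = Real.sin (θ - a) := by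
  rw [cross, Complex.exp_ofReal_mul_I_im, Complex.exp_ofReal_mul_I_re, Real.sin_sub]
  ring

theorem abs_cross_le (a : ℝ) (p : ℂ) : |cross a p| ≤ ‖p‖ := by
  refine abs_le_of_sq_le_sq ?_ (norm_nonneg p)
  rw [← Complex.normSq_eq_norm_sq, Complex.normSq_apply, cross]
  nlinarith [sq_nonneg (Real.cos a * p.re + Real.sin a * p.im), Real.sin_sq_add_cos_sq a]

/-- Cramer's rule in the basis of two directions at angle b. -/
theorem smul_exp_add_smul_exp (a b : ℝ) (p : ℂ) :
    (Real.sin b : ℂ) * p = ((-cross (a + b) p : ℝ) : ℂ) * Complex.exp (a * Complex.I) +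
      (cross a p : ℂ) * Complex.exp ((a + b : ℝ) * Complex.I) := by
  have h1 : Real.cos (a + b) = _ := Real.cos_add a b
  have h2 : Real.sin (a + b) = _ := Real.sin_add a b
  have h3 := Real.sin_sq_add_cos_sq a
  apply Complex.ext
  · simp only [Complex.add_re, Complex.re_ofReal_mul, Complex.exp_ofReal_mul_I_re, cross, h1, h2]
    linear_combination (-Real.sin b * p.re) * h3
  · simp only [Complex.add_im, Complex.im_ofReal_mul, Complex.exp_ofReal_mul_I_im, cross, h1, h2]
    linear_combination (-Real.sin b * p.im) * h3

variable {N : ℕ} [NeZero N] (β h : Fin N → ℝ)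

/-- The linear interpolation of heights over the sector from fold `n` to fold `n + 1`. -/
def fanPiece (n : Fin N) (p : ℂ) : ℝ :=
  (h (n + 1) * cross (polarAngle β n) p - h n * cross (polarAngle β n + β n) p) / Real.sin (β n)

/-- The piecewise linear interpolation of heights at the points `exp (polarAngle β n * I)`. -/
def fanHeight (p : ℂ) : ℝ :=
  ∑ n, if toIocMod Real.two_pi_pos 0 p.arg ∈ Set.Ioc (polarAngle β n) (polarAngle β n + β n)
    then fanPiece β h n p else 0

/-- The closed sector between the folds `n` and `n + 1`. -/
def sector (n : Fin N) : Set ℂ :=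
  {p | 0 ≤ cross (polarAngle β n) p ∧ cross (polarAngle β n + β n) p ≤ 0}

theorem isClosed_sector (n : Fin N) : IsClosed (sector β n) :=
  (isClosed_le continuous_const (continuous_cross _)).inter
    (isClosed_le (continuous_cross _) continuous_const)

theorem continuous_fanPiece (n : Fin N) : Continuous (fanPiece β h n) := by
  have := continuous_cross
  unfold fanPiece; fun_prop

theorem fanPiece_smul (n : Fin N) (r : ℝ) (p : ℂ) :
    fanPiece β h n (r * p) = r * fanPiece β h n p := by
  simp only [fanPiece, cross_smul]; ring

theorem fanPiece_combination {n : Fin N} (hs : Real.sin (β n) ≠ 0) (s t : ℝ) :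
    fanPiece β h n (s * Complex.exp (polarAngle β n * Complex.I) +
      t * Complex.exp ((polarAngle β n + β n : ℝ) * Complex.I)) = s * h n + t * h (n + 1) := by
  rw [fanPiece, cross_add, cross_smul, cross_smul, cross_exp, cross_exp, cross_add, cross_smul,
    cross_smul, cross_exp, cross_exp, div_eq_iff hs]
  simp only [sub_self, Real.sin_zero, add_sub_cancel_left, sub_add_cancel_left, Real.sin_neg]
  ring

/-- The partial sums of the angles. -/
def partialAngle (k : ℕ) : ℝ := ∑ n : Fin N with n.val < k, β n

variable {β}

theorem partialAngle_val (n : Fin N) : partialAngle β n.val = polarAngle β n := by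
  rw [partialAngle, polarAngle]
  congr 1
  ext m
  simp

theorem partialAngle_val_add_one (n : Fin N) :
    partialAngle β (n.val + 1) = polarAngle β n + β n := by
  have : (Finset.univ.filter fun m : Fin N => m.val < n.val + 1) =
      insert n (Finset.univ.filter fun m : Fin N => m.val < n.val) := by
    ext m
    simp only [Finset.mem_filter, Finset.mem_univ, true_and, Finset.mem_insert, Fin.ext_iff]
    omega
  rw [← partialAngle_val, partialAngle, partialAngle, this, Finset.sum_insert (by simp), add_comm]

theorem partialAngle_zero : partialAngle β 0 = 0 := by simp [partialAngle]

theorem partialAngle_card : partialAngle β N = ∑ n, β n := by simp [partialAngle]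

theorem monotone_partialAngle (hβ : ∀ n, 0 < β n) : Monotone (partialAngle β) := by
  intro i j hij
  refine Finset.sum_le_sum_of_subset_of_nonneg ?_ fun n _ _ => (hβ n).le
  intro n hn
  simp only [Finset.mem_filter, Finset.mem_univ, true_and] at hn ⊢
  omega

theorem polarAngle_nonneg_and_le (hβ : ∀ n, 0 < β n ∧ β n < Real.pi)
    (hsum : ∑ n, β n = 2 * Real.pi) (n : Fin N) :
    0 ≤ polarAngle β n ∧ polarAngle β n + β n ≤ 2 * Real.pi := by
  have hm := monotone_partialAngle fun n => (hβ n).1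
  rw [← partialAngle_val_add_one, ← partialAngle_val, ← hsum, ← partialAngle_card,
    ← partialAngle_zero (β := β)]
  exact ⟨hm (Nat.zero_le _), hm n.2⟩

theorem exists_mem_Ioc (hβ : ∀ n, 0 < β n ∧ β n < Real.pi)
    (hsum : ∑ n, β n = 2 * Real.pi) {θ : ℝ} (hθ : θ ∈ Set.Ioc 0 (2 * Real.pi)) :
    ∃ n, θ ∈ Set.Ioc (polarAngle β n) (polarAngle β n + β n) := by
  have hm := monotone_partialAngle fun n => (hβ n).1
  have h := hm.biUnion_Ico_Ioc_map_succ 0 N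
  rw [partialAngle_zero, partialAngle_card, hsum] at h
  rw [← h] at hθ
  simp only [Set.mem_iUnion, Set.mem_Ico, exists_prop] at hθ
  obtain ⟨i, hi, hθ⟩ := hθ
  refine ⟨⟨i, hi.2⟩, ?_⟩
  rw [← partialAngle_val_add_one, ← partialAngle_val]
  exact hθ

theorem eq_of_mem_Ioc (hβ : ∀ n, 0 < β n ∧ β n < Real.pi) {θ : ℝ} {m n : Fin N}
    (hm : θ ∈ Set.Ioc (polarAngle β m) (polarAngle β m + β m))
    (hn : θ ∈ Set.Ioc (polarAngle β n) (polarAngle β n + β n)) : m = n := by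
  have hmono := monotone_partialAngle fun n => (hβ n).1
  by_contra hne
  rw [← partialAngle_val_add_one, ← partialAngle_val] at hm hn
  have := hmono.pairwise_disjoint_on_Ioc_succ (fun h => hne (Fin.ext h) : m.val ≠ n.val)
  exact Set.disjoint_left.1 this hm hn

theorem toIocMod_arg {r θ : ℝ} (hr : 0 < r) (hθ : θ ∈ Set.Ioc 0 (2 * Real.pi)) :
    toIocMod Real.two_pi_pos 0 (r * Complex.exp (θ * Complex.I)).arg = θ := by
  rw [Complex.exp_mul_I, ← Complex.ofReal_cos, ← Complex.ofReal_sin]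
  have := Complex.arg_mul_cos_add_sin_mul_I_eq_toIocMod hr θ
  push_cast at this ⊢
  rw [this, toIocMod_toIocMod, toIocMod_eq_self]
  simpa using hθ

/-- The half-open intervals partition (0, 2π], so exactly one summand of `fanHeight` survives.
Arguments are normalised to (0, 2π] so that they start at fold 0. -/
theorem fanHeight_of_mem_Ioc (hβ : ∀ n, 0 < β n ∧ β n < Real.pi)
    (hsum : ∑ n, β n = 2 * Real.pi) {r θ : ℝ} (hr : 0 < r) {n : Fin N}
    (hθ : θ ∈ Set.Ioc (polarAngle β n) (polarAngle β n + β n)) :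
    fanHeight β h (r * Complex.exp (θ * Complex.I)) =
      fanPiece β h n (r * Complex.exp (θ * Complex.I)) := by
  have hb := polarAngle_nonneg_and_le hβ hsum n
  rw [fanHeight, toIocMod_arg hr ⟨hb.1.trans_lt hθ.1, hθ.2.trans hb.2⟩,
    Finset.sum_eq_single n, if_pos hθ]
  · intro m _ hm
    rw [if_neg fun h' => hm (eq_of_mem_Ioc hβ h' hθ)]
  · simp

theorem exists_polar {p : ℂ} (hp : p ≠ 0) : ∃ r θ : ℝ, 0 < r ∧ θ ∈ Set.Ioc 0 (2 * Real.pi) ∧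
    p = r * Complex.exp (θ * Complex.I) := by
  refine ⟨‖p‖, toIocMod Real.two_pi_pos 0 p.arg, norm_pos_iff.2 hp, ?_, ?_⟩
  · simpa using toIocMod_mem_Ioc Real.two_pi_pos 0 p.arg
  · conv_lhs => rw [← Complex.norm_mul_exp_arg_mul_I p]
    congr 1
    rw [toIocMod]
    have := Complex.exp_periodic.sub_zsmul_eq (x := (p.arg : ℂ) * Complex.I)
      (toIocDiv Real.two_pi_pos 0 p.arg)
    rw [← this]
    congr 1
    simp only [zsmul_eq_mul]
    push_cast
    ring

theorem exp_polarAngle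
    (hsum : ∑ n, β n = 2 * Real.pi) (n : Fin N) : Complex.exp ((polarAngle β n + β n : ℝ) * Complex.I) =
    Complex.exp (polarAngle β (n + 1) * Complex.I) := by
  have := exp_polarAngle_add_one β 1 (by simpa using hsum) n
  rw [Complex.exp_mul_I, Complex.exp_mul_I, ← Complex.ofReal_cos, ← Complex.ofReal_sin,
    ← Complex.ofReal_cos, ← Complex.ofReal_sin, this.1, this.2]

theorem mem_sector_of_mem_Ioc (hβ : ∀ n, 0 < β n ∧ β n < Real.pi) {r θ : ℝ} (hr : 0 < r) {n : Fin N}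
    (hθ : θ ∈ Set.Ioc (polarAngle β n) (polarAngle β n + β n)) :
    (r : ℂ) * Complex.exp (θ * Complex.I) ∈ sector β n := by
  have := hβ n
  have h1 : 0 ≤ Real.sin (θ - polarAngle β n) :=
    Real.sin_nonneg_of_nonneg_of_le_pi (by linarith [hθ.1]) (by linarith [hθ.2])
  have h2 : Real.sin (θ - (polarAngle β n + β n)) ≤ 0 :=
    Real.sin_nonpos_of_nonpos_of_neg_pi_le (by linarith [hθ.2]) (by linarith [hθ.1])
  refine ⟨?_, ?_⟩
  · rw [cross_smul, cross_exp]; positivity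
  · rw [cross_smul, cross_exp]; exact mul_nonpos_of_nonneg_of_nonpos hr.le h2

theorem exists_mem_sector (hβ : ∀ n, 0 < β n ∧ β n < Real.pi)
    (hsum : ∑ n, β n = 2 * Real.pi) (p : ℂ) : ∃ n, p ∈ sector β n := by
  by_cases hp : p = 0
  · exact ⟨0, by simp [hp, sector, cross]⟩
  · obtain ⟨r, θ, hr, hθ, rfl⟩ := exists_polar hp
    obtain ⟨n, hn⟩ := exists_mem_Ioc hβ hsum hθ
    exact ⟨n, mem_sector_of_mem_Ioc hβ hr hn⟩

/-- An angle of a closed sector lies in the half-open interval of that sector, or it is the angle of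
the first side of the sector. -/
theorem mem_Ioc_or_of_mem_sector (hβ : ∀ n, 0 < β n ∧ β n < Real.pi)
    (hsum : ∑ n, β n = 2 * Real.pi) {r θ : ℝ} (hr : 0 < r) (hθ : θ ∈ Set.Ioc 0 (2 * Real.pi))
    {n : Fin N} (hp : (r : ℂ) * Complex.exp (θ * Complex.I) ∈ sector β n) :
    θ ∈ Set.Ioc (polarAngle β n) (polarAngle β n + β n) ∨
      Complex.exp (θ * Complex.I) = Complex.exp (polarAngle β n * Complex.I) := by
  obtain ⟨h1, h2⟩ := hp
  rw [cross_smul, cross_exp] at h1 h2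
  have h1 : 0 ≤ Real.sin (θ - polarAngle β n) := nonneg_of_mul_nonneg_right h1 hr
  have h2 : Real.sin (θ - (polarAngle β n + β n)) ≤ 0 := by
    by_contra h
    exact absurd h2 (not_le.2 (mul_pos hr (not_le.1 h)))
  have hb := polarAngle_nonneg_and_le hβ hsum n
  have hbn := hβ n
  have hpi := Real.pi_pos
  rcases lt_trichotomy θ (polarAngle β n) with hlt | heq | hgt
  · exfalso
    have h3 : θ - polarAngle β n ≤ -Real.pi := by
      by_contra h
      exact absurd h1 (not_le.2 (Real.sin_neg_of_neg_of_neg_pi_lt (by linarith) (by linarith)))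
    have h4 : 0 < Real.sin (θ - (polarAngle β n + β n) + 2 * Real.pi) :=
      Real.sin_pos_of_pos_of_lt_pi (by linarith [hθ.1]) (by linarith)
    rw [Real.sin_add_two_pi] at h4
    linarith
  · right; rw [heq]
  · by_cases hle : θ ≤ polarAngle β n + β n
    · exact .inl ⟨hgt, hle⟩
    · right
      have h3 : Real.pi ≤ θ - (polarAngle β n + β n) := by
        by_contra h
        exact absurd h2 (not_le.2 (Real.sin_pos_of_pos_of_lt_pi (by linarith) (by linarith)))
      have h4 : ¬ θ - polarAngle β n < 2 * Real.pi := by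
        intro h
        have : Real.sin (θ - polarAngle β n - 2 * Real.pi) < 0 :=
          Real.sin_neg_of_neg_of_neg_pi_lt (by linarith) (by linarith)
        rw [Real.sin_sub_two_pi] at this
        linarith
      -- The exceptional case: the direction of fold 0 has normalised angle 2π, but it is also the
      -- first side, at angle 0, of the first sector.
      have h5 : θ = 2 * Real.pi := le_antisymm hθ.2 (by linarith)
      have h6 : polarAngle β n = 0 := by linarith [hb.1]
      rw [h5, h6]
      push_cast
      rw [Complex.exp_two_pi_mul_I]
      simp

theorem fanHeight_smul_exp_polarAngle (hβ : ∀ n, 0 < β n ∧ β n < Real.pi)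
    (hsum : ∑ n, β n = 2 * Real.pi) {r : ℝ} (hr : 0 < r) (n : Fin N) :
    fanHeight β h (r * Complex.exp (polarAngle β n * Complex.I)) = r * h n := by
  have hb := hβ (n - 1)
  have hs : Real.sin (β (n - 1)) ≠ 0 := (Real.sin_pos_of_pos_of_lt_pi hb.1 hb.2).ne'
  -- Sectors are open on the left, so the direction of fold n is counted as the end of sector n - 1.
  have h1 := fanHeight_of_mem_Ioc h hβ hsum hr (n := n - 1)
    (θ := polarAngle β (n - 1) + β (n - 1)) ⟨by linarith, le_rfl⟩
  have h2 := fanPiece_combination β h hs 0 r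
  rw [Complex.ofReal_zero, zero_mul, zero_add] at h2
  rw [h2, exp_polarAngle hsum, sub_add_cancel, zero_mul, zero_add] at h1
  exact h1

/-- On each closed sector the height is the linear interpolation. -/
theorem fanHeight_eq (hβ : ∀ n, 0 < β n ∧ β n < Real.pi)
    (hsum : ∑ n, β n = 2 * Real.pi) {n : Fin N} {p : ℂ} (hp : p ∈ sector β n) :
    fanHeight β h p = fanPiece β h n p := by
  by_cases hp0 : p = 0
  · simp [hp0, fanHeight, fanPiece, cross]
  · obtain ⟨r, θ, hr, hθ, rfl⟩ := exists_polar hp0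
    rcases mem_Ioc_or_of_mem_sector hβ hsum hr hθ hp with h1 | h1
    · exact fanHeight_of_mem_Ioc h hβ hsum hr h1
    · have hb := hβ n
      have hs : Real.sin (β n) ≠ 0 := (Real.sin_pos_of_pos_of_lt_pi hb.1 hb.2).ne'
      have h2 := fanPiece_combination β h hs r 0
      rw [Complex.ofReal_zero, zero_mul, add_zero, zero_mul, add_zero] at h2
      rw [h1, fanHeight_smul_exp_polarAngle h hβ hsum hr, h2]

/-- The closed sectors form a finite closed cover of the plane, and the function is linear on each
of them. -/
theorem continuous_fanHeight (hβ : ∀ n, 0 < β n ∧ β n < Real.pi)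
    (hsum : ∑ n, β n = 2 * Real.pi) : Continuous (fanHeight β h) := by
  refine (locallyFinite_of_finite (sector β)).continuous ?_ (isClosed_sector β) fun n => ?_
  · exact Set.eq_univ_of_forall fun p => Set.mem_iUnion.2 (exists_mem_sector hβ hsum p)
  · exact (continuous_fanPiece β h n).continuousOn.congr fun p hp => fanHeight_eq h hβ hsum hp

theorem posHomogeneous_fanHeight (hβ : ∀ n, 0 < β n ∧ β n < Real.pi)
    (hsum : ∑ n, β n = 2 * Real.pi) : PosHomogeneous (fanHeight β h) := by
  intro r p hr
  obtain ⟨n, hn⟩ := exists_mem_sector hβ hsum p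
  have : (r : ℂ) * p ∈ sector β n := by
    obtain ⟨h1, h2⟩ := hn
    refine ⟨?_, ?_⟩
    · rw [cross_smul]; positivity
    · rw [cross_smul]; exact mul_nonpos_of_nonneg_of_nonpos hr h2
  rw [fanHeight_eq h hβ hsum hn, fanHeight_eq h hβ hsum this, fanPiece_smul]

/-- The faces of the fan form the graph of `fanHeight`. -/
theorem exists_combination_iff (hβ : ∀ n, 0 < β n ∧ β n < Real.pi)
    (hsum : ∑ n, β n = 2 * Real.pi) (p : ℂ) (z : ℝ) :
    (∃ n : Fin N, ∃ s t : ℝ, 0 ≤ s ∧ 0 ≤ t ∧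
      p = s * Complex.exp (polarAngle β n * Complex.I) +
        t * Complex.exp (polarAngle β (n + 1) * Complex.I) ∧ z = s * h n + t * h (n + 1)) ↔
      z = fanHeight β h p := by
  have hs : ∀ n, 0 < Real.sin (β n) := fun n => Real.sin_pos_of_pos_of_lt_pi (hβ n).1 (hβ n).2
  constructor
  · rintro ⟨n, s, t, h0s, h0t, hp, rfl⟩
    rw [← exp_polarAngle hsum] at hp
    have hsn := hs n
    have hmem : p ∈ sector β n := by
      rw [hp]
      refine ⟨?_, ?_⟩
      · rw [cross_add, cross_smul, cross_smul, cross_exp, cross_exp, sub_self, Real.sin_zero,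
          add_sub_cancel_left]
        positivity
      · rw [cross_add, cross_smul, cross_smul, cross_exp, cross_exp, sub_self, Real.sin_zero,
          sub_add_cancel_left, Real.sin_neg]
        nlinarith
    rw [fanHeight_eq h hβ hsum hmem, hp, fanPiece_combination β h hsn.ne']
  · rintro rfl
    obtain ⟨n, hn⟩ := exists_mem_sector hβ hsum p
    have hsn := hs n
    refine ⟨n, -cross (polarAngle β n + β n) p / Real.sin (β n),
      cross (polarAngle β n) p / Real.sin (β n), div_nonneg (neg_nonneg.2 hn.2) hsn.le,
      div_nonneg hn.1 hsn.le, ?_, ?_⟩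
    · have := smul_exp_add_smul_exp (polarAngle β n) (β n) p
      rw [← exp_polarAngle hsum]
      have hc : (Real.sin (β n) : ℂ) ≠ 0 := Complex.ofReal_ne_zero.2 hsn.ne'
      rw [← mul_right_inj' hc, this]
      push_cast at hc ⊢
      field_simp
    · rw [fanHeight_eq h hβ hsum hn, fanPiece]
      ring

theorem abs_fanHeight_le (hβ : ∀ n, 0 < β n ∧ β n < Real.pi)
    (hsum : ∑ n, β n = 2 * Real.pi) {σ M : ℝ} (hσ : 0 < σ) (hβσ : ∀ n, σ ≤ Real.sin (β n))
    (hM : ∀ n, |h n| ≤ M) (p : ℂ) : |fanHeight β h p| ≤ 2 * M / σ * ‖p‖ := by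
  obtain ⟨n, hn⟩ := exists_mem_sector hβ hsum p
  have hM0 : 0 ≤ M := (abs_nonneg _).trans (hM 0)
  have h1 : |h (n + 1) * cross (polarAngle β n) p - h n * cross (polarAngle β n + β n) p| ≤
      2 * M * ‖p‖ := by
    refine (abs_sub _ _).trans ?_
    rw [abs_mul, abs_mul]
    have := mul_le_mul (hM (n + 1)) (abs_cross_le (polarAngle β n) p) (abs_nonneg _) hM0
    have := mul_le_mul (hM n) (abs_cross_le (polarAngle β n + β n) p) (abs_nonneg _) hM0
    linarith
  have hs := hβσ n
  rw [fanHeight_eq h hβ hsum hn, fanPiece, abs_div, abs_of_pos (hσ.trans_le hs), div_mul_eq_mul_div]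
  exact div_le_div₀ (by positivity) h1 hσ hs

/-- Subtracting a linear function. -/
theorem fanHeight_sub_linear (hβ : ∀ n, 0 < β n ∧ β n < Real.pi)
    (hsum : ∑ n, β n = 2 * Real.pi) (a b : ℝ) (p : ℂ) :
    fanHeight β h p - (a * p.re + b * p.im) = fanHeight β (h - linearSlope β a b) p := by
  obtain ⟨n, hn⟩ := exists_mem_sector hβ hsum p
  have hs : Real.sin (β n) ≠ 0 := (Real.sin_pos_of_pos_of_lt_pi (hβ n).1 (hβ n).2).ne'
  have he := exp_polarAngle_add_one β 1 (by simpa using hsum) n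
  have h1 : Real.cos (polarAngle β n + β n) = _ := Real.cos_add (polarAngle β n) (β n)
  have h2 : Real.sin (polarAngle β n + β n) = _ := Real.sin_add (polarAngle β n) (β n)
  have h3 := Real.sin_sq_add_cos_sq (polarAngle β n)
  rw [fanHeight_eq _ hβ hsum hn, fanHeight_eq _ hβ hsum hn, fanPiece, fanPiece, eq_div_iff hs,
    sub_mul, div_mul_cancel₀ _ hs]
  simp only [Pi.sub_apply, linearSlope, he.1, he.2, cross, h1, h2]
  linear_combination (Real.sin (β n) * (a * p.re + b * p.im)) * h3

/-- On a sector the function is a combination of sin(θ - θ_n) and sin(θ_n + β_n - θ), each with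
integral 1 - cos β_n. The coefficient (1 - cos β_n)/sin β_n is tan(β_n/2). -/
theorem integral_fanHeight (hβ : ∀ n, 0 < β n ∧ β n < Real.pi)
    (hsum : ∑ n, β n = 2 * Real.pi) :
    ∫ p in Metric.ball (0 : ℂ) 1, fanHeight β h p =
    1 / 3 * ∑ n, (1 - Real.cos (β n)) / Real.sin (β n) * (h n + h (n + 1)) := by
  rw [integral_disc_of_posHomogeneous (posHomogeneous_fanHeight h hβ hsum)]
  congr 1
  have hc : Continuous fun θ : ℝ => fanHeight β h (Complex.exp (θ * Complex.I)) :=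
    (continuous_fanHeight h hβ hsum).comp (by fun_prop)
  have h1 := intervalIntegral.sum_integral_adjacent_intervals (μ := volume) (n := N)
    (a := partialAngle β) (f := fun θ : ℝ => fanHeight β h (Complex.exp (θ * Complex.I)))
    fun k _ => hc.intervalIntegrable _ _
  rw [partialAngle_zero, partialAngle_card, hsum] at h1
  rw [← h1, ← Fin.sum_univ_eq_sum_range (fun k => ∫ θ in partialAngle β k..partialAngle β (k + 1),
    fanHeight β h (Complex.exp (θ * Complex.I)))]
  refine Finset.sum_congr rfl fun n _ => ?_
  rw [partialAngle_val_add_one, partialAngle_val]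
  have hb := hβ n
  have h2 : Set.EqOn (fun θ : ℝ => fanHeight β h (Complex.exp (θ * Complex.I)))
      (fun θ : ℝ => (h (n + 1) * Real.sin (θ - polarAngle β n) -
        h n * Real.sin (θ - (polarAngle β n + β n))) / Real.sin (β n))
      (Set.Ioc (polarAngle β n) (polarAngle β n + β n)) := by
    intro θ hθ
    have := fanHeight_of_mem_Ioc h hβ hsum one_pos hθ
    rw [Complex.ofReal_one, one_mul] at this
    simp only [this, fanPiece, cross_exp]
  rw [intervalIntegral.integral_of_le (by linarith), setIntegral_congr_fun measurableSet_Ioc h2,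
    ← intervalIntegral.integral_of_le (by linarith), intervalIntegral.integral_div,
    intervalIntegral.integral_sub (Continuous.intervalIntegrable (by fun_prop) _ _)
      (Continuous.intervalIntegrable (by fun_prop) _ _),
    intervalIntegral.integral_const_mul, intervalIntegral.integral_const_mul,
    intervalIntegral.integral_comp_sub_right (fun x => Real.sin x),
    intervalIntegral.integral_comp_sub_right (fun x => Real.sin x), integral_sin, integral_sin]
  simp only [sub_self, add_sub_cancel_left, sub_add_cancel_left, Real.cos_zero, Real.cos_neg]
  ring

end Fan

/-! ### The trace near the unfolded state as a graph -/

section Trace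

variable {N : ℕ} [NeZero N] {α L : Fin N → ℝ}

/-- The horizontal part of the direction of a fold. -/
def foldPlane (L : Fin N → ℝ) (X : Placement N) (n : Fin N) : ℂ :=
  ⟨foldDir L X n 0, foldDir L X n 1⟩

/-- The angle between the horizontal parts of consecutive folds. -/
def turnAngle (L : Fin N → ℝ) (X : Placement N) (n : Fin N) : ℝ :=
  (foldPlane L X (n + 1) / foldPlane L X n).arg

/-- The height of the half-line of a fold over the unit circle. -/
def foldHeight (L : Fin N → ℝ) (X : Placement N) (n : Fin N) : ℝ :=
  foldDir L X n 2 / ‖foldPlane L X n‖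

/-- The unit normal of the face between the folds `0` and `1`. -/
def faceNormal (α L : Fin N → ℝ) (X : Placement N) : Fin 3 → ℝ :=
  crossProduct (foldDir L X 0) (faceDir α L X)

theorem continuous_foldDir (n : Fin N) (i : Fin 3) :
    Continuous (fun X : Placement N => foldDir L X n i) :=
  (contDiff_foldDir n i).continuous

theorem continuous_foldPlane (n : Fin N) : Continuous (fun X : Placement N => foldPlane L X n) := by
  have : (fun X : Placement N => foldPlane L X n) = fun X =>
      Complex.equivRealProdCLM.symm (foldDir L X n 0, foldDir L X n 1) := by
    ext X; rfl
  rw [this]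
  have := continuous_foldDir (L := L) n
  fun_prop

theorem continuous_faceNormal (i : Fin 3) : Continuous (fun X => faceNormal α L X i) := by
  have h1 := fun i => (contDiff_faceDir (α := α) (L := L) i).continuous
  have h2 := continuous_foldDir (L := L) 0
  fin_cases i <;> simp only [faceNormal, cross_apply] <;> simp <;> fun_prop

theorem foldPlane_flatState (hL : ∀ n, 0 < L n) (n : Fin N) :
    foldPlane L (flatState α L) n = Complex.exp (polarAngle α n * Complex.I) := by
  rw [foldPlane, foldDir_flatState hL]
  apply Complex.ext
  · rw [Complex.exp_ofReal_mul_I_re]; simp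
  · rw [Complex.exp_ofReal_mul_I_im]; simp

theorem norm_foldPlane_flatState (hL : ∀ n, 0 < L n) (n : Fin N) :
    ‖foldPlane L (flatState α L) n‖ = 1 := by
  rw [foldPlane_flatState hL, Complex.norm_exp_ofReal_mul_I]

theorem foldHeight_flatState (hL : ∀ n, 0 < L n) (n : Fin N) :
    foldHeight L (flatState α L) n = 0 := by
  rw [foldHeight, foldDir_flatState hL]; simp

theorem continuousAt_foldHeight (hL : ∀ n, 0 < L n) (n : Fin N) :
    ContinuousAt (fun X => foldHeight L X n) (flatState α L) :=
  (continuous_foldDir n 2).continuousAt.div (continuous_foldPlane n).norm.continuousAt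
    (by rw [norm_foldPlane_flatState hL]; exact one_ne_zero)

theorem faceNormal_flatState (hα : ∀ n, 0 < |α n| ∧ |α n| < Real.pi)
    (hw : ∑ n, α n = 2 * Real.pi * (1 : ℤ)) (hL : ∀ n, 0 < L n) :
    faceNormal α L (flatState α L) = ![0, 0, 1] := by
  rw [faceNormal, faceDir_flatState hα hw hL, foldDir_flatState_zero hL]
  ext i
  fin_cases i <;> simp [cross_apply]

theorem turn_flatState (hw : ∑ n, α n = 2 * Real.pi * (1 : ℤ)) (hL : ∀ n, 0 < L n) (n : Fin N) :
    foldPlane L (flatState α L) (n + 1) / foldPlane L (flatState α L) n =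
      Complex.exp (α n * Complex.I) := by
  rw [foldPlane_flatState hL, foldPlane_flatState hL,
    ← exp_polarAngle (by simpa using hw), ← Complex.exp_sub]
  congr 1
  push_cast
  ring

theorem turnAngle_flatState (hpos : ∀ n, 0 < α n ∧ α n < Real.pi)
    (hw : ∑ n, α n = 2 * Real.pi * (1 : ℤ)) (hL : ∀ n, 0 < L n) (n : Fin N) :
    turnAngle L (flatState α L) n = α n := by
  have := hpos n
  rw [turnAngle, turn_flatState hw hL, Complex.arg_exp_mul_I, toIocMod_eq_self]
  constructor <;> linarith

theorem continuousAt_turnAngle (hpos : ∀ n, 0 < α n ∧ α n < Real.pi)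
    (hw : ∑ n, α n = 2 * Real.pi * (1 : ℤ)) (hL : ∀ n, 0 < L n) (n : Fin N) :
    ContinuousAt (fun X => turnAngle L X n) (flatState α L) := by
  have hne : foldPlane L (flatState α L) n ≠ 0 := by
    rw [foldPlane_flatState hL]; exact Complex.exp_ne_zero _
  refine ContinuousAt.comp (g := Complex.arg)
    (f := fun X => foldPlane L X (n + 1) / foldPlane L X n) (Complex.continuousAt_arg ?_)
    ((continuous_foldPlane (n + 1)).continuousAt.div (continuous_foldPlane n).continuousAt hne)
  rw [turn_flatState hw hL, Complex.mem_slitPlane_iff, Complex.exp_ofReal_mul_I_im]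
  exact .inr (Real.sin_pos_of_pos_of_lt_pi (hpos n).1 (hpos n).2).ne'

/-- Close to the unfolded state, the projections of the folds go around the origin once. -/
theorem foldPlane_eq {X : Placement N} (h0 : foldDir L X 0 1 = 0) (h1 : 0 < foldDir L X 0 0)
    (hne : ∀ n, foldPlane L X n ≠ 0) (h2 : |∑ n, turnAngle L X n - 2 * Real.pi| < 2 * Real.pi) :
    ∑ n, turnAngle L X n = 2 * Real.pi ∧ ∀ n, foldPlane L X n =
      ‖foldPlane L X n‖ * Complex.exp (polarAngle (turnAngle L X) n * Complex.I) := by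
  have hn : ∀ n, (‖foldPlane L X n‖ : ℂ) ≠ 0 := fun n =>
    Complex.ofReal_ne_zero.2 (norm_ne_zero_iff.2 (hne n))
  have hz : foldPlane L X 0 = (foldDir L X 0 0 : ℝ) := by
    apply Complex.ext <;> simp [foldPlane, h0]
  obtain ⟨hd, hs⟩ := exp_polarAngle_of_chain (β := turnAngle L X)
    (d := fun n => foldPlane L X n / ‖foldPlane L X n‖)
    (by
      rw [hz, Complex.norm_real, Real.norm_of_nonneg h1.le, div_self]
      exact Complex.ofReal_ne_zero.2 h1.ne')
    (fun n => by
      have := Complex.norm_mul_exp_arg_mul_I (foldPlane L X (n + 1) / foldPlane L X n)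
      rw [norm_div] at this
      push_cast at this
      have h3 := hn n
      have h4 := hn (n + 1)
      have h5 := hne n
      rw [turnAngle]
      field_simp at this ⊢
      linear_combination -this)
  refine ⟨?_, fun n => ?_⟩
  · have := eq_of_exp_eq_one (w := 1) hs (by simpa using h2)
    simpa using this
  · rw [← hd n, mul_div_cancel₀ _ (hn n)]

/-- The trace of a placement close to the unfolded state is the graph of a function. -/
theorem vertexTrace_eq {X : Placement N} (hL : ∀ n, 0 < L n) (hne : ∀ n, foldPlane L X n ≠ 0)
    (hβ : ∀ n, 0 < turnAngle L X n ∧ turnAngle L X n < Real.pi)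
    (hsum : ∑ n, turnAngle L X n = 2 * Real.pi)
    (hX : ∀ n, foldPlane L X n =
      ‖foldPlane L X n‖ * Complex.exp (polarAngle (turnAngle L X) n * Complex.I)) :
    vertexTrace X = {u : UnitSphere |
      (u : Space) 2 = fanHeight (turnAngle L X) (foldHeight L X) (plane u)} := by
  have hn : ∀ n, 0 < ‖foldPlane L X n‖ := fun n => norm_pos_iff.2 (hne n)
  have hpl : ∀ n, plane (X (some n) - X none) = (L n * ‖foldPlane L X n‖ : ℝ) *
      Complex.exp (polarAngle (turnAngle L X) n * Complex.I) := by
    intro n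
    rw [Complex.ofReal_mul, mul_assoc, ← hX]
    have := (hL n).ne'
    apply Complex.ext
    · rw [Complex.re_ofReal_mul]; simp [plane, foldPlane, foldDir]; field_simp
    · rw [Complex.im_ofReal_mul]; simp [plane, foldPlane, foldDir]; field_simp
  have hz : ∀ n, (X (some n) - X none) 2 = (L n * ‖foldPlane L X n‖) * foldHeight L X n := by
    intro n
    have h1 := (hL n).ne'
    have h2 := (hn n).ne'
    simp only [foldHeight, foldDir, PiLp.sub_apply]
    field_simp
  have hpadd : ∀ x y : Space, plane (x + y) = plane x + plane y := by
    intro x y; apply Complex.ext <;> simp [plane]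
  have hext : ∀ x y : Space, x = y ↔ plane x = plane y ∧ x 2 = y 2 := by
    refine fun x y => ⟨fun h => h ▸ ⟨rfl, rfl⟩, fun ⟨h, h2⟩ => ?_⟩
    have h0 := congrArg Complex.re h
    have h1 := congrArg Complex.im h
    ext i
    fin_cases i
    exacts [h0, h1, h2]
  ext u
  rw [Set.mem_ofPred_eq, ← exists_combination_iff (foldHeight L X) hβ hsum]
  refine exists_congr fun n => ⟨?_, ?_⟩
  · rintro ⟨s, t, hs, ht, hu⟩
    have hLn := hL n
    have hLn' := hL (n + 1)
    refine ⟨s * (L n * ‖foldPlane L X n‖), t * (L (n + 1) * ‖foldPlane L X (n + 1)‖),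
      by positivity, by positivity, ?_, ?_⟩
    · rw [hu, hpadd, plane_smul, plane_smul, hpl, hpl]
      push_cast
      ring
    · rw [hu]
      simp only [PiLp.add_apply, PiLp.smul_apply, smul_eq_mul, hz]
      ring
  · rintro ⟨s, t, hs, ht, hu, hu2⟩
    have hc : ∀ n, 0 < L n * ‖foldPlane L X n‖ := fun n => mul_pos (hL n) (hn n)
    have h1 := hc n
    have h2 := hc (n + 1)
    refine ⟨s / (L n * ‖foldPlane L X n‖), t / (L (n + 1) * ‖foldPlane L X (n + 1)‖),
      by positivity, by positivity, (hext _ _).2 ⟨?_, ?_⟩⟩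
    · rw [hu, hpadd, plane_smul, plane_smul, hpl, hpl, ← mul_assoc, ← mul_assoc,
        ← Complex.ofReal_mul, ← Complex.ofReal_mul, div_mul_cancel₀ _ h1.ne',
        div_mul_cancel₀ _ h2.ne']
    · rw [hu2]
      simp only [PiLp.add_apply, PiLp.smul_apply, smul_eq_mul, hz]
      rw [← mul_assoc (s / _), ← mul_assoc (t / _), div_mul_cancel₀ _ h1.ne',
        div_mul_cancel₀ _ h2.ne']

/-- The heights of the folds relative to the plane of the face between the folds `0` and `1`. -/
theorem foldHeight_sub_linearSlope {X : Placement N} (hne : ∀ n, foldPlane L X n ≠ 0)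
    (hX : ∀ n, foldPlane L X n =
      ‖foldPlane L X n‖ * Complex.exp (polarAngle (turnAngle L X) n * Complex.I))
    (hν : faceNormal α L X 2 ≠ 0) :
    foldHeight L X - linearSlope (turnAngle L X) (-faceNormal α L X 0 / faceNormal α L X 2)
        (-faceNormal α L X 1 / faceNormal α L X 2) =
      fun n => (faceNormal α L X 2 * ‖foldPlane L X n‖)⁻¹ * faceSlope α L X n := by
  ext n
  have hn : ‖foldPlane L X n‖ ≠ 0 := norm_ne_zero_iff.2 (hne n)
  have h1 := congrArg Complex.re (hX n)
  have h2 := congrArg Complex.im (hX n)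
  rw [Complex.re_ofReal_mul, Complex.exp_ofReal_mul_I_re] at h1
  rw [Complex.im_ofReal_mul, Complex.exp_ofReal_mul_I_im] at h2
  have h3 : faceSlope α L X n = faceNormal α L X 0 * (foldPlane L X n).re +
      faceNormal α L X 1 * (foldPlane L X n).im + faceNormal α L X 2 * foldDir L X n 2 := by
    rw [faceSlope, ← faceNormal]
    simp [dotProduct, Fin.sum_univ_three, foldPlane]
  rw [h3, h1, h2, Pi.sub_apply, foldHeight, linearSlope]
  field_simp
  ring

end Trace

/-! ### Planar placements -/

section Unfolded

variable {N : ℕ} [NeZero N] {α L : Fin N → ℝ}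

/-- Modulo fold 0, fold 1 is sin α_0 times the second frame vector, so the triple product is that
multiple of the normal component of fold n. -/
theorem det_folds (hα : Real.sin (α 0) ≠ 0) (X : Placement N) (n : Fin N) :
    (Matrix.of ![foldDir L X 0, foldDir L X 1, foldDir L X n]).det =
      Real.sin (α 0) * faceSlope α L X n := by
  rw [Matrix.det_fin_three, faceSlope, faceDir]
  simp [cross_apply, dotProduct, Fin.sum_univ_three]
  field_simp
  ring

/-- A fold with nonzero slope is independent of folds 0 and 1, so the placement spans space. If all
slopes vanish, every fold lies in the plane of the reference face. -/
theorem unfolded_iff {w : ℤ} (hα : ∀ n, 0 < |α n| ∧ |α n| < Real.pi)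
    (hw : ∑ n, α n = 2 * Real.pi * w) (hL : ∀ n, 0 < L n) {X : Placement N}
    (hX : X ∈ configSpace α L) : Unfolded X ↔ faceSlope α L X = 0 := by
  have hs : Real.sin (α 0) ≠ 0 := sin_ne_zero_of_abs (hα 0)
  have hsub : ∀ n, X (some n) - X none = L n • WithLp.toLp 2 (foldDir L X n) := by
    intro n
    ext i
    have := (hL n).ne'
    simp [foldDir]
    field_simp
  have hspan : ∀ n, WithLp.toLp 2 (foldDir L X n) ∈ vectorSpan ℝ (Set.range X) := by
    intro n
    have h1 : X (some n) - X none ∈ vectorSpan ℝ (Set.range X) :=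
      vsub_mem_vectorSpan ℝ (Set.mem_range_self _) (Set.mem_range_self _)
    rw [hsub] at h1
    have := Submodule.smul_mem _ (L n)⁻¹ h1
    rwa [smul_smul, inv_mul_cancel₀ (hL n).ne', one_smul] at this
  rw [Unfolded, coplanar_iff_finrank_le_two]
  constructor
  · intro h
    ext n
    by_contra hne
    have hdet := det_folds (L := L) hs X n
    have hli : LinearIndependent ℝ ![foldDir L X 0, foldDir L X 1, foldDir L X n] := by
      refine Matrix.linearIndependent_rows_of_det_ne_zero
        (A := Matrix.of ![foldDir L X 0, foldDir L X 1, foldDir L X n]) ?_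
      rw [hdet]
      exact mul_ne_zero hs hne
    have hli' := hli.map' (WithLp.linearEquiv 2 ℝ (Fin 3 → ℝ)).symm.toLinearMap
      (LinearEquiv.ker _)
    have h1 := finrank_span_eq_card hli'
    have h2 : Submodule.span ℝ (Set.range ((WithLp.linearEquiv 2 ℝ (Fin 3 → ℝ)).symm.toLinearMap ∘
        ![foldDir L X 0, foldDir L X 1, foldDir L X n])) ≤ vectorSpan ℝ (Set.range X) := by
      rw [Submodule.span_le]
      rintro _ ⟨i, rfl⟩
      fin_cases i
      exacts [hspan 0, hspan 1, hspan n]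
    have h3 := Submodule.finrank_mono h2
    rw [h1, Fintype.card_fin] at h3
    exact absurd (h3.trans h) (by norm_num)
  · intro h
    have hc := (mem_configSpace_iff hw hL X).1 hX
    have hz : (0 : Fin N) + 1 = 1 := zero_add 1
    obtain ⟨h1, h2⟩ := face_orthonormal hs (hc 0).1 (hc 1).1 (by simpa [hz] using (hc 0).2)
    let S : Submodule ℝ Space := Submodule.span ℝ
      (({WithLp.toLp 2 (foldDir L X 0), WithLp.toLp 2 (faceDir α L X)} : Finset Space) : Set Space)
    have hS : ∀ n, X (some n) - X none ∈ S := by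
      intro n
      rw [hsub]
      refine Submodule.smul_mem _ _ ?_
      have h3 := orthonormal_expand (hc 0).1 h1 h2 (foldDir L X n)
      have h4 : crossProduct (foldDir L X 0) (faceDir α L X) ⬝ᵥ foldDir L X n = 0 := congrFun h n
      rw [h4, zero_smul, add_zero] at h3
      rw [h3, WithLp.toLp_add, WithLp.toLp_smul, WithLp.toLp_smul]
      exact Submodule.add_mem _ (Submodule.smul_mem _ _ (Submodule.subset_span (by simp)))
        (Submodule.smul_mem _ _ (Submodule.subset_span (by simp)))
    have hle : vectorSpan ℝ (Set.range X) ≤ S := by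
      rw [vectorSpan_range_eq_span_range_vsub_right ℝ X none, Submodule.span_le]
      rintro _ ⟨i, rfl⟩
      rcases i with _ | n
      · simp
      · exact hS n
    calc _ ≤ Module.finrank ℝ S := Submodule.finrank_mono hle
      _ ≤ _ := finrank_span_finset_le_card _
      _ ≤ 2 := Finset.card_le_two

end Unfolded

/-! ### First-order control of the popped state -/

section PoppedEstimate

variable {N : ℕ} [NeZero N] {α L : Fin N → ℝ}

/-- The integral of the height of a nearly flat vertex over the unit disc is, to first order, a
third of this expression in the slopes. -/
def discMoment (α y : Fin N → ℝ) : ℝ :=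
  ∑ n, (1 - Real.cos (α n)) / Real.sin (α n) * (y n + y (n + 1))

/-- This identity links areas to the stress form: the first-order moment is minus the product with
the constant slope 1, the slopes of a pyramid. -/
theorem discMoment_eq (hα : ∀ n, Real.sin (α n) ≠ 0) (y : Fin N → ℝ) :
    discMoment α y = -slopeForm α y fun _ => 1 := by
  rw [discMoment, slopeForm, ← Finset.sum_neg_distrib]
  refine Finset.sum_congr rfl fun n _ => ?_
  have := hα n
  rw [Real.cot_eq_cos_div_sin]
  field_simp
  ring

theorem abs_sum_mul_add_sub_le (T T' c y : Fin N → ℝ) :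
    |∑ n, T' n * (c n * y n + c (n + 1) * y (n + 1)) - ∑ n, T n * (y n + y (n + 1))| ≤
      (∑ n, (|T' n * c n - T n| + |T' n * c (n + 1) - T n|)) * ‖y‖ := by
  rw [← Finset.sum_sub_distrib, Finset.sum_mul]
  refine (Finset.abs_sum_le_sum_abs _ _).trans (Finset.sum_le_sum fun n _ => ?_)
  have h1 := norm_le_pi_norm y n
  have h2 := norm_le_pi_norm y (n + 1)
  rw [Real.norm_eq_abs] at h1 h2
  calc _ = |(T' n * c n - T n) * y n + (T' n * c (n + 1) - T n) * y (n + 1)| := by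
        congr 1; ring
    _ ≤ |T' n * c n - T n| * |y n| + |T' n * c (n + 1) - T n| * |y (n + 1)| := by
        rw [← abs_mul, ← abs_mul]; exact abs_add_le _ _
    _ ≤ _ := by
        rw [add_mul]
        exact add_le_add (mul_le_mul_of_nonneg_left h1 (abs_nonneg _))
          (mul_le_mul_of_nonneg_left h2 (abs_nonneg _))

/-- A fan whose heights are, up to a linear function, a small multiple `c * y` of `y`. -/
theorem abs_truncIntegral_fanHeight_sub_le {β h c y : Fin N → ℝ} {a b σ : ℝ}
    (hβ : ∀ n, 0 < β n ∧ β n < Real.pi) (hsum : ∑ n, β n = 2 * Real.pi) (hσ : 0 < σ)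
    (hβσ : ∀ n, σ ≤ Real.sin (β n)) (hc : ∀ n, |c n| ≤ 2)
    (hy : h - linearSlope β a b = fun n => c n * y n)
    (hε : (2 * (∑ n, |h n|) / σ + |a| + |b|) ^ 2 ≤ 1) :
    |truncIntegral (fanHeight β h) - 1 / 3 * discMoment α y| ≤
      (8 / σ * Real.pi * (2 * (∑ n, |h n|) / σ + |a| + |b|) ^ 2 +
        1 / 3 * ∑ n, (|(1 - Real.cos (β n)) / Real.sin (β n) * c n -
          (1 - Real.cos (α n)) / Real.sin (α n)| +
          |(1 - Real.cos (β n)) / Real.sin (β n) * c (n + 1) -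
          (1 - Real.cos (α n)) / Real.sin (α n)|)) * ‖y‖ := by
  set ε := 2 * (∑ n, |h n|) / σ + |a| + |b| with hεdef
  let ℓ : ℂ → ℝ := fun p => a * p.re + b * p.im
  have hS : 0 ≤ ∑ n, |h n| := Finset.sum_nonneg fun n _ => abs_nonneg _
  have hS' : 0 ≤ 2 * (∑ n, |h n|) / σ := by positivity
  have hcont := continuous_fanHeight h hβ hsum
  have hℓc : Continuous ℓ := by fun_prop
  have hodd : ∀ p, ℓ (-p) = -ℓ p := fun p => by simp [ℓ]; ring
  have hsub : ∀ p, fanHeight β h p - ℓ p = fanHeight β (fun n => c n * y n) p := by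
    intro p
    rw [← hy]
    exact fanHeight_sub_linear h hβ hsum a b p
  have hM : ∀ n, |c n * y n| ≤ 2 * ‖y‖ := fun n => by
    rw [abs_mul]
    exact mul_le_mul (hc n) (norm_le_pi_norm y n) (abs_nonneg _) (by norm_num)
  have h1 : ∀ p, |fanHeight β h p| ≤ ε * ‖p‖ := fun p => by
    refine (abs_fanHeight_le h hβ hsum hσ hβσ
      (fun n => Finset.single_le_sum (fun n _ => abs_nonneg (h n)) (Finset.mem_univ n)) p).trans ?_
    refine mul_le_mul_of_nonneg_right ?_ (norm_nonneg p)
    linarith [abs_nonneg a, abs_nonneg b]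
  have h2 : ∀ p, |ℓ p| ≤ ε * ‖p‖ := fun p => by
    have e1 : |a * p.re| ≤ |a| * ‖p‖ := by
      rw [abs_mul]; exact mul_le_mul_of_nonneg_left (Complex.abs_re_le_norm p) (abs_nonneg _)
    have e2 : |b * p.im| ≤ |b| * ‖p‖ := by
      rw [abs_mul]; exact mul_le_mul_of_nonneg_left (Complex.abs_im_le_norm p) (abs_nonneg _)
    have := mul_nonneg hS' (norm_nonneg p)
    calc |ℓ p| ≤ |a * p.re| + |b * p.im| := abs_add_le _ _
      _ ≤ ε * ‖p‖ := by rw [hεdef]; linarith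
  -- After removing ℓ the fan has heights c y, bounded by 2‖y‖; this gives δ = 4‖y‖/σ and the
  -- constant 8/σ of the statement.
  have h3 : ∀ p, |fanHeight β h p - ℓ p| ≤ 2 * (2 * ‖y‖) / σ * ‖p‖ := fun p => by
    rw [hsub]
    exact abs_fanHeight_le _ hβ hsum hσ hβσ hM p
  have h4 := abs_truncIntegral_sub_le hcont hℓc hodd hε (by positivity) h1 h2 h3
  have h5 : ∫ p in Metric.ball (0 : ℂ) 1, fanHeight β h p =
      1 / 3 * ∑ n, (1 - Real.cos (β n)) / Real.sin (β n) *
        (c n * y n + c (n + 1) * y (n + 1)) := by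
    rw [← integral_fanHeight (fun n => c n * y n) hβ hsum]
    simp_rw [← hsub]
    rw [integral_sub (integrableOn_disc hcont) (integrableOn_disc hℓc),
      integral_disc_of_odd hodd, sub_zero]
  have h6 := abs_sum_mul_add_sub_le (fun n => (1 - Real.cos (α n)) / Real.sin (α n))
    (fun n => (1 - Real.cos (β n)) / Real.sin (β n)) c y
  rw [h5] at h4
  rw [discMoment, add_mul, mul_assoc (1 / 3)]
  rw [abs_le] at h4 h6 ⊢
  have h7 : 2 * (2 * (2 * ‖y‖) / σ) * Real.pi * ε ^ 2 = 8 / σ * Real.pi * ε ^ 2 * ‖y‖ := by ring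
  rw [h7] at h4
  constructor <;> linarith [h4.1, h4.2, h6.1, h6.2]

/-- The popped state of a placement near the unfolded one is governed by a quantity that is linear
in the slopes to first order. -/
theorem exists_popped_estimate (hα : ∀ n, 0 < |α n| ∧ |α n| < Real.pi)
    (hpos : ∀ n, 0 < α n ∧ α n < Real.pi)
    (hw : ∑ n, α n = 2 * Real.pi * (1 : ℤ)) (hL : ∀ n, 0 < L n) :
    ∃ (I E : Placement N → ℝ), Tendsto E (𝓝 (flatState α L)) (𝓝 0) ∧
      ∀ᶠ X in 𝓝[reducedConfigSpace α L] (flatState α L),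
        (PoppedUp X ↔ I X < 0) ∧ (PoppedDown X ↔ 0 < I X) ∧
        |I X - 1 / 3 * discMoment α (faceSlope α L X)| ≤ E X * ‖faceSlope α L X‖ := by
  have hsin : ∀ n, 0 < Real.sin (α n) := fun n =>
    Real.sin_pos_of_pos_of_lt_pi (hpos n).1 (hpos n).2
  -- Half the smallest sine is a strict lower bound, so it persists for the turn angles of nearby
  -- placements.
  obtain ⟨σ, hσ, hσα⟩ : ∃ σ : ℝ, 0 < σ ∧ ∀ n, σ < Real.sin (α n) := by
    obtain ⟨m, hm⟩ := Finite.exists_min fun n => Real.sin (α n)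
    exact ⟨Real.sin (α m) / 2, half_pos (hsin m), fun n => by
      have := hsin m; have := hm n; linarith⟩
  let a : Placement N → ℝ := fun X => -faceNormal α L X 0 / faceNormal α L X 2
  let b : Placement N → ℝ := fun X => -faceNormal α L X 1 / faceNormal α L X 2
  let c : Placement N → Fin N → ℝ := fun X n => (faceNormal α L X 2 * ‖foldPlane L X n‖)⁻¹
  let ε : Placement N → ℝ := fun X =>
    2 * (∑ n, |foldHeight L X n|) / σ + |a X| + |b X|
  let T : ℝ → ℝ := fun x => (1 - Real.cos x) / Real.sin x
  -- The coefficient of the error. It vanishes at the unfolded state, where ε = 0, the turns are α_n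
  -- and c = 1, and it is continuous there.
  let E : Placement N → ℝ := fun X => 8 / σ * Real.pi * ε X ^ 2 +
    1 / 3 * ∑ n, (|T (turnAngle L X n) * c X n - T (α n)| +
      |T (turnAngle L X n) * c X (n + 1) - T (α n)|)
  have hν := faceNormal_flatState hα hw hL
  have hν2 : faceNormal α L (flatState α L) 2 = 1 := by rw [hν]; rfl
  have hca : ContinuousAt a (flatState α L) :=
    (continuous_faceNormal 0).neg.continuousAt.div (continuous_faceNormal 2).continuousAt
      (by rw [hν2]; exact one_ne_zero)
  have hcb : ContinuousAt b (flatState α L) :=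
    (continuous_faceNormal 1).neg.continuousAt.div (continuous_faceNormal 2).continuousAt
      (by rw [hν2]; exact one_ne_zero)
  have ha0 : a (flatState α L) = 0 := by simp [a, hν]
  have hb0 : b (flatState α L) = 0 := by simp [b, hν]
  have hcc : ∀ n, ContinuousAt (fun X => c X n) (flatState α L) := fun n =>
    ((continuous_faceNormal 2).continuousAt.mul (continuous_foldPlane n).norm.continuousAt).inv₀
      (by simp [hν2, norm_foldPlane_flatState hL])
  have hc0 : ∀ n, c (flatState α L) n = 1 := fun n => by
    simp [c, hν2, norm_foldPlane_flatState hL]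
  have hct := continuousAt_turnAngle hpos hw hL
  have ht0 := turnAngle_flatState hpos hw hL
  have hcε : ContinuousAt ε (flatState α L) := by
    have h1 : ContinuousAt (fun X => ∑ n, |foldHeight L X n|) (flatState α L) :=
      tendsto_finsetSum _ fun n _ => (continuousAt_foldHeight hL n).abs
    exact (((continuousAt_const.mul h1).div_const σ).add hca.abs).add hcb.abs
  have hε0 : ε (flatState α L) = 0 := by
    simp [ε, ha0, hb0, foldHeight_flatState hL]
  have hcT : ∀ n, ContinuousAt (fun X => T (turnAngle L X n)) (flatState α L) := fun n => by
    refine ContinuousAt.comp (g := T) ?_ (hct n)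
    rw [ht0]
    exact ContinuousAt.div (by fun_prop) (by fun_prop) (hsin n).ne'
  have hcE : ContinuousAt E (flatState α L) := by
    refine (continuousAt_const.mul (hcε.pow 2)).add (continuousAt_const.mul
      (tendsto_finsetSum _ fun n _ => ?_))
    exact (((hcT n).mul (hcc n)).sub continuousAt_const).abs.add
      (((hcT n).mul (hcc (n + 1))).sub continuousAt_const).abs
  have hE0 : E (flatState α L) = 0 := by simp [E, hε0, ht0, hc0]
  refine ⟨fun X => truncIntegral (fanHeight (turnAngle L X) (foldHeight L X)), E,
    hE0 ▸ hcE.tendsto, ?_⟩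
  have e1 : ∀ᶠ X in 𝓝 (flatState α L), ∀ n, 0 < turnAngle L X n ∧ turnAngle L X n < Real.pi :=
    eventually_all.2 fun n => .and
      (continuousAt_const.eventually_lt (hct n) (by rw [ht0]; exact (hpos n).1))
      ((hct n).eventually_lt continuousAt_const (by rw [ht0]; exact (hpos n).2))
  have e2 : ∀ᶠ X in 𝓝 (flatState α L), ∀ n, σ < Real.sin (turnAngle L X n) :=
    eventually_all.2 fun n => continuousAt_const.eventually_lt
      (Real.continuous_sin.continuousAt.comp (hct n)) (by simpa [ht0] using hσα n)
  have e3 : ∀ᶠ X in 𝓝 (flatState α L), |∑ n, turnAngle L X n - 2 * Real.pi| < 2 * Real.pi := by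
    refine ContinuousAt.eventually_lt (ContinuousAt.abs (ContinuousAt.sub
      (tendsto_finsetSum _ fun n _ => hct n) continuousAt_const)) continuousAt_const ?_
    simp only [ht0, hw]
    simpa using Real.pi_pos
  have e4 : ∀ᶠ X in 𝓝 (flatState α L), ∀ n, foldPlane L X n ≠ 0 :=
    eventually_all.2 fun n => (continuous_foldPlane n).continuousAt.eventually_ne
      (by rw [foldPlane_flatState hL]; exact Complex.exp_ne_zero _)
  have e5 : ∀ᶠ X in 𝓝 (flatState α L), ∀ n, |c X n| < 2 :=
    eventually_all.2 fun n => (hcc n).abs.eventually_lt continuousAt_const (by simp [hc0])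
  have e6 : ∀ᶠ X in 𝓝 (flatState α L), ε X ^ 2 < 1 :=
    (hcε.pow 2).eventually_lt continuousAt_const (by simp [hε0])
  have e7 : ∀ᶠ X in 𝓝 (flatState α L), faceNormal α L X 2 ≠ 0 :=
    (continuous_faceNormal 2).continuousAt.eventually_ne (by rw [hν2]; exact one_ne_zero)
  have e8 : ∀ᶠ X in 𝓝 (flatState α L), 0 < foldDir L X 0 0 :=
    continuousAt_const.eventually_lt (continuous_foldDir 0 0).continuousAt
      (by rw [foldDir_flatState_zero hL]; simp)
  filter_upwards [(e1.and (e2.and (e3.and (e4.and (e5.and (e6.and (e7.and e8))))))).filter_mono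
    nhdsWithin_le_nhds, self_mem_nhdsWithin] with X ⟨h1, h2, h3, h4, h5, h6, h7, h8⟩ hX
  have h0 : foldDir L X 0 1 = 0 := by
    simp [foldDir, hX.2.2.1, hX.2.2.2]
  obtain ⟨hsum, hdir⟩ := foldPlane_eq h0 h8 h4 h3
  obtain ⟨hp1, hp2⟩ := popped_iff (posHomogeneous_fanHeight (foldHeight L X) h1 hsum)
    (continuous_fanHeight (foldHeight L X) h1 hsum) (vertexTrace_eq hL h4 h1 hsum hdir)
  exact ⟨hp1, hp2, abs_truncIntegral_fanHeight_sub_le h1 hsum hσ (fun n => (h2 n).le)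
    (fun n => (h5 n).le) (foldHeight_sub_linearSlope h4 hdir h7) h6.le⟩

end PoppedEstimate

/-! ### Lorentz coordinates from eigenvectors -/

section Lorentz

variable {ι : Type*} [Fintype ι] [DecidableEq ι] {A : Matrix ι ι ℝ} (hA : A.IsHermitian)

/-- The coordinates in an orthonormal basis of eigenvectors. -/
def eigenCoord : (ι → ℝ) ≃ₗ[ℝ] (ι → ℝ) :=
  (WithLp.linearEquiv 2 ℝ (ι → ℝ)).symm.trans
    (hA.eigenvectorBasis.repr.toLinearEquiv.trans (WithLp.linearEquiv 2 ℝ (ι → ℝ)))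

theorem eigenCoord_apply (h : ι → ℝ) (i : ι) :
    eigenCoord hA h i = (hA.eigenvectorBasis i).ofLp ⬝ᵥ h := by
  change hA.eigenvectorBasis.repr (WithLp.toLp 2 h) i = _
  rw [hA.eigenvectorBasis.repr_apply_apply, EuclideanSpace.inner_eq_star_dotProduct,
    dotProduct_comm]
  simp

theorem toQuadraticForm'_eq_sum (h : ι → ℝ) :
    A.toQuadraticForm' h = ∑ i, hA.eigenvalues i * eigenCoord hA h i ^ 2 := by
  have h1 : h = ∑ i, eigenCoord hA h i • (hA.eigenvectorBasis i).ofLp := by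
    have := hA.eigenvectorBasis.sum_repr (WithLp.toLp 2 h)
    have := congrArg WithLp.ofLp this
    rw [WithLp.ofLp_sum] at this
    exact this.symm
  have h2 : A *ᵥ h = ∑ i, eigenCoord hA h i • hA.eigenvalues i • (hA.eigenvectorBasis i).ofLp := by
    conv_lhs => rw [h1]
    rw [Matrix.mulVec_sum]
    refine Finset.sum_congr rfl fun i _ => ?_
    rw [Matrix.mulVec_smul, hA.mulVec_eigenvectorBasis]
  have h3 : A.toQuadraticForm' h = h ⬝ᵥ A *ᵥ h := by
    simp [Matrix.toQuadraticForm', Matrix.toLinearMap₂'_apply']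
  rw [h3, h2, dotProduct_sum]
  refine Finset.sum_congr rfl fun i _ => ?_
  rw [dotProduct_smul, dotProduct_smul, dotProduct_comm, ← eigenCoord_apply]
  simp only [smul_eq_mul]
  ring

theorem equivalent_weightedSumSquares_eigenvalues :
    A.toQuadraticForm'.Equivalent (QuadraticMap.weightedSumSquares ℝ hA.eigenvalues) := by
  refine ⟨⟨eigenCoord hA, fun h => ?_⟩⟩
  rw [toQuadraticForm'_eq_sum hA, QuadraticMap.weightedSumSquares_apply]
  refine Finset.sum_congr rfl fun i _ => ?_
  simp only [AddHom.toFun_eq_coe, LinearMap.coe_toAddHom, LinearEquiv.coe_coe, smul_eq_mul]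
  ring

theorem card_eigenvalues_neg :
    (Finset.univ.filter fun i => hA.eigenvalues i < 0).card = sigNeg A.toQuadraticForm' := by
  rw [QuadraticForm.sigNeg_of_equiv_weightedSumSquares
    (equivalent_weightedSumSquares_eigenvalues hA), ← Set.ncard_coe_finset]
  simp

theorem card_eigenvalues_pos :
    (Finset.univ.filter fun i => 0 < hA.eigenvalues i).card = sigPos A.toQuadraticForm' := by
  rw [QuadraticForm.sigPos_of_equiv_weightedSumSquares
    (equivalent_weightedSumSquares_eigenvalues hA), ← Set.ncard_coe_finset]
  simp

/-- Coordinates that bring a quadratic form with one negative eigenvalue to the Lorentz form, the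
time coordinate being the product with an eigenvector; the sign of the eigenvector is chosen so that
a given time-like vector has negative time. -/
theorem exists_lorentz_coordinates (hA : A.IsHermitian) {m k : ℕ}
    (hrad : Module.finrank ℝ A.toQuadraticForm'.radical = m)
    (hpos : sigPos A.toQuadraticForm' = k) (hneg : sigNeg A.toQuadraticForm' = 1)
    {h₀ : ι → ℝ} (hh₀ : A.toQuadraticForm' h₀ < 0) :
    ∃ (μ : ℝ) (v : ι → ℝ)
      (T : (ι → ℝ) ≃ₗ[ℝ] EuclideanSpace ℝ (Fin m) × ℝ × EuclideanSpace ℝ (Fin k)),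
      μ < 0 ∧ v ≠ 0 ∧ A *ᵥ v = μ • v ∧ (∀ h, (T h).2.1 = v ⬝ᵥ h) ∧
      (∀ h, A.toQuadraticForm' h = ‖(T h).2.2‖ ^ 2 - (T h).2.1 ^ 2) ∧ v ⬝ᵥ h₀ < 0 := by
  let lam := hA.eigenvalues
  let P : Finset ι := Finset.univ.filter fun i => 0 < lam i
  let Z : Finset ι := Finset.univ.filter fun i => lam i = 0
  let M : Finset ι := Finset.univ.filter fun i => lam i < 0
  have hP : P.card = k := (card_eigenvalues_pos hA).trans hpos
  have hM : M.card = 1 := (card_eigenvalues_neg hA).trans hneg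
  have hdim := QuadraticForm.sigPos_add_sigNeg_add_radical (Q := A.toQuadraticForm')
  rw [hpos, hneg, hrad, Module.finrank_fintype_fun_eq_card] at hdim
  have huniv : (Finset.univ : Finset ι) = (Z ∪ M) ∪ P := by
    ext i
    simp only [Z, M, P, Finset.mem_univ, Finset.mem_union, Finset.mem_filter, true_and, true_iff]
    rcases lt_trichotomy (lam i) 0 with h | h | h <;> simp [h]
  have hdZM : Disjoint Z M := by
    rw [Finset.disjoint_left]; intro i; simp only [Z, M, Finset.mem_filter]; rintro ⟨_, h⟩; simp [h]
  have hdP : Disjoint (Z ∪ M) P := by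
    rw [Finset.disjoint_left]; intro i
    simp only [Z, M, P, Finset.mem_union, Finset.mem_filter, Finset.mem_univ, true_and]
    rintro (h | h) <;> linarith
  have hZ : Z.card = m := by
    have := congrArg Finset.card huniv
    rw [Finset.card_union_of_disjoint hdP, Finset.card_union_of_disjoint hdZM,
      Finset.card_univ] at this
    omega
  obtain ⟨i₀, hi₀⟩ := Finset.card_eq_one.1 hM
  have hlam : lam i₀ < 0 := by
    have : i₀ ∈ M := by rw [hi₀]; simp
    simpa [M] using this
  let eZ : Fin m ≃ Z := (Z.equivFinOfCardEq hZ).symm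
  let eP : Fin k ≃ P := (P.equivFinOfCardEq hP).symm
  have hsum : ∀ h : ι → ℝ, A.toQuadraticForm' h =
      ∑ j : Fin k, lam (eP j) * eigenCoord hA h (eP j) ^ 2 + lam i₀ * eigenCoord hA h i₀ ^ 2 := by
    intro h
    rw [toQuadraticForm'_eq_sum hA, huniv, Finset.sum_union hdP, Finset.sum_union hdZM, hi₀,
      Finset.sum_singleton, Finset.sum_eq_zero, zero_add, add_comm]
    · congr 1
      rw [← Finset.sum_coe_sort P, ← eP.sum_comp]
    · intro i hi
      have : lam i = 0 := by simpa [Z] using hi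
      change lam i * _ = 0
      rw [this, zero_mul]
  -- Without a component along the negative eigenvector the form would be nonnegative at h₀.
  have hne : eigenCoord hA h₀ i₀ ≠ 0 := by
    intro h
    rw [hsum, h] at hh₀
    have : 0 ≤ ∑ j : Fin k, lam (eP j) * eigenCoord hA h₀ (eP j) ^ 2 :=
      Finset.sum_nonneg fun j _ => by
        have : 0 < lam (eP j) := (Finset.mem_filter.1 (eP j).2).2
        positivity
    simp at hh₀
    linarith
  obtain ⟨s, hs, hs₀⟩ : ∃ s : ℝ, s ^ 2 = 1 ∧ s * eigenCoord hA h₀ i₀ < 0 := by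
    rcases lt_or_gt_of_ne hne with h | h
    exacts [⟨1, by norm_num, by linarith⟩, ⟨-1, by norm_num, by linarith⟩]
  have hr : 0 < √(-lam i₀) := Real.sqrt_pos.2 (by linarith)
  have hr2 : √(-lam i₀) ^ 2 = -lam i₀ := Real.sq_sqrt (by linarith)
  have hs0 : s ≠ 0 := by rintro rfl; norm_num at hs
  let c : (ι → ℝ) →ₗ[ℝ] (ι → ℝ) := (eigenCoord hA).toLinearMap
  -- Coordinates for zero eigenvalues are kept, the others are scaled by the root of the absolute
  -- eigenvalue; the sign s orients time so that h₀ lies in the past.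
  let T₀ : (ι → ℝ) →ₗ[ℝ] EuclideanSpace ℝ (Fin m) × ℝ × EuclideanSpace ℝ (Fin k) :=
    LinearMap.prod
      ((WithLp.linearEquiv 2 ℝ (Fin m → ℝ)).symm.toLinearMap ∘ₗ
        LinearMap.pi fun j => LinearMap.proj (eZ j).1 ∘ₗ c)
      (LinearMap.prod ((s * √(-lam i₀)) • (LinearMap.proj i₀ ∘ₗ c))
        ((WithLp.linearEquiv 2 ℝ (Fin k → ℝ)).symm.toLinearMap ∘ₗ
          LinearMap.pi fun j => √(lam (eP j).1) • (LinearMap.proj (eP j).1 ∘ₗ c)))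
  have hT1 : ∀ h j, (T₀ h).1 j = eigenCoord hA h (eZ j) := fun h j => rfl
  have hT2 : ∀ h, (T₀ h).2.1 = s * √(-lam i₀) * eigenCoord hA h i₀ := fun h => rfl
  have hT3 : ∀ h j, (T₀ h).2.2 j = √(lam (eP j)) * eigenCoord hA h (eP j) := fun h j => rfl
  have hinj : Function.Injective T₀ := by
    rw [injective_iff_map_eq_zero]
    intro h hh
    rw [← (eigenCoord hA).map_eq_zero_iff]
    ext i
    have hi : i ∈ (Z ∪ M) ∪ P := huniv ▸ Finset.mem_univ i
    rw [Finset.mem_union, Finset.mem_union] at hi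
    rcases hi with (hi | hi) | hi
    · have := hT1 h (eZ.symm ⟨i, hi⟩)
      rw [hh, Equiv.apply_symm_apply] at this
      exact this.symm
    · rw [hi₀, Finset.mem_singleton] at hi
      have := hT2 h
      rw [hh] at this
      have h1 : s * √(-lam i₀) ≠ 0 := mul_ne_zero hs0 hr.ne'
      rw [hi]
      exact (mul_eq_zero.1 this.symm).resolve_left h1
    · have := hT3 h (eP.symm ⟨i, hi⟩)
      rw [hh, Equiv.apply_symm_apply] at this
      have h1 : √(lam i) ≠ 0 := (Real.sqrt_pos.2 (by simpa [P] using hi)).ne'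
      exact (mul_eq_zero.1 this.symm).resolve_left h1
  have hfin : Module.finrank ℝ (ι → ℝ) =
      Module.finrank ℝ (EuclideanSpace ℝ (Fin m) × ℝ × EuclideanSpace ℝ (Fin k)) := by
    simp
    omega
  have hT : ∀ h, LinearEquiv.ofInjectiveOfFinrankEq T₀ hinj hfin h = T₀ h := fun h =>
    LinearMap.congr_fun (LinearEquiv.coe_ofInjectiveOfFinrankEq T₀ hinj hfin) h
  refine ⟨lam i₀, (s * √(-lam i₀)) • (hA.eigenvectorBasis i₀).ofLp,
    LinearEquiv.ofInjectiveOfFinrankEq T₀ hinj hfin, hlam, ?_, ?_, ?_, ?_, ?_⟩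
  · refine smul_ne_zero (mul_ne_zero hs0 hr.ne') fun h => ?_
    exact hA.eigenvectorBasis.orthonormal.ne_zero i₀ (by ext j; exact congrFun h j)
  · rw [Matrix.mulVec_smul, hA.mulVec_eigenvectorBasis, smul_comm]
  · intro h
    rw [hT, hT2, smul_dotProduct, ← eigenCoord_apply, smul_eq_mul]
  · intro h
    rw [hT, hT2, EuclideanSpace.norm_sq_eq, hsum]
    have : ∀ j : Fin k, ‖(T₀ h).2.2 j‖ ^ 2 = lam (eP j) * eigenCoord hA h (eP j) ^ 2 := fun j => by
      have : 0 < lam (eP j) := (Finset.mem_filter.1 (eP j).2).2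
      rw [hT3, Real.norm_eq_abs, sq_abs, mul_pow, Real.sq_sqrt this.le]
    simp_rw [this]
    linear_combination (√(-lam i₀) ^ 2 * eigenCoord hA h i₀ ^ 2) * hs +
      eigenCoord hA h i₀ ^ 2 * hr2
  · rw [smul_dotProduct, ← eigenCoord_apply, smul_eq_mul]
    nlinarith

end Lorentz

/-! ### The two nappes of the cone -/

section DoubleCone

/-- On a null-cone, the product with a time-like vector in the past has the sign of the time. -/
theorem lorentz_product_bounds {E : Type*} [NormedAddCommGroup E] [InnerProductSpace ℝ E] {y y₀ : E}
    {t t₀ : ℝ} (hcone : ‖y‖ = |t|) :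
    (0 ≤ t → (-t₀ - ‖y₀‖) * |t| ≤ inner ℝ y y₀ - t * t₀) ∧
      (t ≤ 0 → inner ℝ y y₀ - t * t₀ ≤ -((-t₀ - ‖y₀‖) * |t|)) := by
  have h := abs_le.1 (abs_real_inner_le_norm y y₀)
  rw [hcone] at h
  constructor <;> intro ht
  · rw [abs_of_nonneg ht] at h ⊢; linarith [h.1]
  · rw [abs_of_nonpos ht] at h ⊢; linarith [h.2]

/-- The main term d has sign opposite to t and size at least κ|t|, so an error of at most δ|t| with
δ < κ cannot change its sign. At t = 0 both vanish. -/
theorem sign_iff_of_abs_sub_le {I d t κ δ : ℝ} (hδ : δ < κ) (h : |I - d| ≤ δ * |t|)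
    (h1 : 0 ≤ t → d ≤ -(κ * |t|)) (h2 : t ≤ 0 → κ * |t| ≤ d) :
    (I < 0 ↔ 0 < t) ∧ (0 < I ↔ t < 0) := by
  rw [abs_le] at h
  rcases lt_trichotomy t 0 with ht | rfl | ht
  · have := mul_lt_mul_of_pos_right hδ (abs_pos.2 ht.ne)
    have := h2 ht.le
    exact ⟨⟨fun _ => by linarith, fun _ => by linarith⟩, ⟨fun _ => ht, fun _ => by linarith⟩⟩
  · have h3 := h1 le_rfl
    have h4 := h2 le_rfl
    simp only [abs_zero, mul_zero, neg_zero] at h h3 h4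
    exact ⟨⟨fun _ => by linarith, fun h => absurd h (lt_irrefl _)⟩,
      ⟨fun _ => by linarith, fun h => absurd h (lt_irrefl _)⟩⟩
  · have := mul_lt_mul_of_pos_right hδ (abs_pos.2 ht.ne')
    have := h1 ht.le
    exact ⟨⟨fun _ => ht, fun _ => by linarith⟩, ⟨fun _ => by linarith, fun _ => by linarith⟩⟩

variable {N : ℕ} [NeZero N] {α L : Fin N → ℝ}

theorem discMoment_sub (α y z : Fin N → ℝ) :
    discMoment α y - discMoment α z = discMoment α (y - z) := by
  rw [discMoment, discMoment, discMoment, ← Finset.sum_sub_distrib]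
  refine Finset.sum_congr rfl fun n _ => ?_
  simp only [Pi.sub_apply]
  ring

theorem abs_discMoment_le (α y : Fin N → ℝ) :
    |discMoment α y| ≤ (∑ n, 2 * |(1 - Real.cos (α n)) / Real.sin (α n)|) * ‖y‖ := by
  rw [discMoment, Finset.sum_mul]
  refine (Finset.abs_sum_le_sum_abs _ _).trans (Finset.sum_le_sum fun n _ => ?_)
  have h1 := norm_le_pi_norm y n
  have h2 := norm_le_pi_norm y (n + 1)
  rw [Real.norm_eq_abs] at h1 h2
  rw [abs_mul]
  have := mul_le_mul_of_nonneg_left ((abs_add_le (y n) (y (n + 1))).trans (add_le_add h1 h2))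
    (abs_nonneg ((1 - Real.cos (α n)) / Real.sin (α n)))
  linarith

/-- The heights of the pyramid in which all folds have slope `1`. -/
def pyramidHeights (L : Fin N → ℝ) : Heights N := fun i => i.elim 0 L

theorem slope_pyramidHeights (hL : ∀ n, L n ≠ 0) : slope L (pyramidHeights L) = fun _ => 1 := by
  ext n
  simp [slope, pyramidHeights, hL n]

/-- For slopes all equal to 1, sector n contributes -2 tan(α_n/2), which is negative for a
forward-track. -/
theorem stressForm_pyramidHeights_neg (hpos : ∀ n, 0 < α n ∧ α n < Real.pi)
    (hL : ∀ n, L n ≠ 0) : stressForm α L (pyramidHeights L) < 0 := by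
  have hs : ∀ n, 0 < Real.sin (α n) := fun n =>
    Real.sin_pos_of_pos_of_lt_pi (hpos n).1 (hpos n).2
  rw [stressForm_apply α L hL, slope_pyramidHeights hL]
  have h := discMoment_eq (fun n => (hs n).ne') fun _ => 1
  have h2 : 0 < discMoment α fun _ => 1 := by
    refine Finset.sum_pos (fun n _ => ?_) Finset.univ_nonempty
    have h3 : Real.cos (α n) < 1 := by
      have := Real.cos_lt_cos_of_nonneg_of_le_pi le_rfl (hpos n).2.le (hpos n).1
      rwa [Real.cos_zero] at this
    have := hs n
    have : 0 < 1 - Real.cos (α n) := by linarith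
    positivity
  linarith

/-- The two nappes of the double cone are the popped up and the popped down configurations. -/
theorem eventually_popped_iff (hα : ∀ n, 0 < |α n| ∧ |α n| < Real.pi)
    (hpos : ∀ n, 0 < α n ∧ α n < Real.pi)
    (hw : ∑ n, α n = 2 * Real.pi * (1 : ℤ)) (hL : ∀ n, 0 < L n) {F G : Slice N → Slice N}
    (hF0 : F 0 = 0) (hF : HasFDerivAt F (ContinuousLinearMap.id ℝ (Slice N)) 0)
    (h : IsGermIso {z : Slice N | angleForm α z z z = 0} 0
        {y : Slice N | slopeForm α y.1 y.1 = 0} 0 F G)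
    (hN : 2 ≤ N) (hs : ∀ n, Real.sin (α n) ≠ 0) (hL' : ∀ n, L n ≠ 0)
    {m k : ℕ} {v : Heights N}
    (T : Heights N ≃ₗ[ℝ] EuclideanSpace ℝ (Fin m) × ℝ × EuclideanSpace ℝ (Fin k))
    (hTv : ∀ h, (T h).2.1 = v ⬝ᵥ h)
    (hT : ∀ h, stressForm α L h = ‖(T h).2.2‖ ^ 2 - (T h).2.1 ^ 2)
    (hv : v ⬝ᵥ pyramidHeights L < 0) :
    ∀ᶠ X in 𝓝[reducedConfigSpace α L] (flatState α L),
      (PoppedUp X ↔ 0 < v ⬝ᵥ ((heightsEquiv hN hs hL').symm ∘ Prod.map F id ∘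
        reducedChart α L) X) ∧
      (PoppedDown X ↔ v ⬝ᵥ ((heightsEquiv hN hs hL').symm ∘ Prod.map F id ∘
        reducedChart α L) X < 0) ∧
      (Unfolded X ↔ v ⬝ᵥ ((heightsEquiv hN hs hL').symm ∘ Prod.map F id ∘
        reducedChart α L) X = 0) := by
  let e := heightsEquiv hN hs hL'
  have hpolar : ∀ h k, slopeForm α (slope L h) (slope L k) =
      inner ℝ (T h).2.2 (T k).2.2 - (T h).2.1 * (T k).2.1 := by
    intro h k
    have h1 := hT (h + k)
    have h2 := hT h
    have h3 := hT k
    rw [stressForm_apply α L hL'] at h1 h2 h3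
    rw [slope_add, slopeForm_add_left, slopeForm_add_right, slopeForm_add_right, h2, h3,
      slopeForm_comm α (slope L k), map_add] at h1
    simp only [Prod.snd_add, Prod.fst_add, norm_add_sq_real] at h1
    linarith
  have hzero : ∀ h, (∀ k, slopeForm α (slope L h) (slope L k) = 0) → (T h).2 = 0 := by
    intro h hh
    -- Testing against the time-reversed vector gives ‖y‖² + t² = 0.
    have h1 := hh (T.symm (0, -(T h).2.1, (T h).2.2))
    rw [hpolar, LinearEquiv.apply_symm_apply, real_inner_self_eq_norm_sq] at h1
    have h2 : ‖(T h).2.2‖ = 0 := by nlinarith [sq_nonneg ‖(T h).2.2‖, sq_nonneg (T h).2.1]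
    have h3 : (T h).2.1 = 0 := by nlinarith [sq_nonneg ‖(T h).2.2‖, sq_nonneg (T h).2.1]
    exact Prod.ext h3 (norm_eq_zero.1 h2)
  -- Time and space coordinates restricted to the slice. Affine heights are in the radical and have
  -- none, so J carries all the information about t and y; nondegeneracy on the slice makes it
  -- injective.
  let J : Slice N →ₗ[ℝ] ℝ × EuclideanSpace ℝ (Fin k) :=
    LinearMap.snd ℝ _ _ ∘ₗ T.toLinearMap ∘ₗ e.symm.toLinearEquiv.toLinearMap ∘ₗ
      LinearMap.inl ℝ (Slice N) (ℝ × ℝ × ℝ)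
  have hJ : ∀ p, (T (e.symm p)).2 = J p.1 := by
    intro p
    have h1 : e.symm p = e.symm (p.1, 0) + e.symm (0, p.2) := by
      rw [← map_add]; simp
    have h2 : (T (e.symm (0, p.2))).2 = 0 := hzero _ fun k => by
      rw [slope_heightsEquiv_symm hN hs hL']
      simpa using slopeForm_linearSlope α hs hw _ _ _
    rw [h1, map_add, Prod.snd_add, h2, add_zero]
    rfl
  have hslope : ∀ y : Slice N, slope L (e.symm (y, 0)) = y.1 := fun y => by
    rw [slope_heightsEquiv_symm hN hs hL']
    ext n
    simp [linearSlope]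
  have hker : LinearMap.ker J = ⊥ := by
    rw [LinearMap.ker_eq_bot']
    intro y hy
    refine slopeForm_slice_nondegenerate hα hw y fun z => ?_
    have h1 := hpolar (e.symm (y, 0)) (e.symm (z, 0))
    rw [hslope, hslope, hJ, hy] at h1
    simpa using h1
  obtain ⟨K, hK0, hK⟩ := J.exists_antilipschitzWith hker
  have hKJ : ∀ y : Slice N, ‖y‖ ≤ K * ‖J y‖ := fun y => by
    simpa using hK.le_mul_dist y 0
  have hK' : (0 : ℝ) < K := by exact_mod_cast hK0
  have hcone : ∀ y : Slice N, slopeForm α y.1 y.1 = 0 → ‖(J y).2‖ = |(J y).1| := by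
    intro y hy
    have h1 := hT (e.symm (y, 0))
    rw [stressForm_apply α L hL', hslope, hy, hJ] at h1
    rw [← abs_norm, ← sq_eq_sq_iff_abs_eq_abs]
    linarith
  -- On the cone the space part has norm |t|, so the whole vector is controlled by |t|.
  have hnorm : ∀ y : Slice N, slopeForm α y.1 y.1 = 0 → ‖y‖ ≤ K * |(J y).1| := by
    intro y hy
    refine (hKJ y).trans (mul_le_mul_of_nonneg_left (max_le (le_of_eq rfl) (hcone y hy).le) hK'.le)
  set t₀ := (T (pyramidHeights L)).2.1 with ht₀
  set y₀ := (T (pyramidHeights L)).2.2 with hy₀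
  have ht₀neg : t₀ < 0 := by rw [ht₀, hTv]; exact hv
  -- The pyramid is time-like and lies in the past.
  have hκ : 0 < -t₀ - ‖y₀‖ := by
    have h1 := stressForm_pyramidHeights_neg hpos hL'
    rw [hT, ← ht₀, ← hy₀] at h1
    nlinarith [norm_nonneg y₀]
  have hmoment : ∀ y : Slice N, discMoment α y.1 = -(inner ℝ (J y).2 y₀ - (J y).1 * t₀) := by
    intro y
    have h1 := hpolar (e.symm (y, 0)) (pyramidHeights L)
    rw [hslope, slope_pyramidHeights hL', hJ] at h1
    rw [discMoment_eq hs, h1]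
  have hbounds : ∀ y : Slice N, slopeForm α y.1 y.1 = 0 →
      (0 ≤ (J y).1 → 1 / 3 * discMoment α y.1 ≤ -((-t₀ - ‖y₀‖) / 3 * |(J y).1|)) ∧
      ((J y).1 ≤ 0 → (-t₀ - ‖y₀‖) / 3 * |(J y).1| ≤ 1 / 3 * discMoment α y.1) := by
    intro y hy
    obtain ⟨h1, h2⟩ := lorentz_product_bounds (y₀ := y₀) (t₀ := t₀) (hcone y hy)
    rw [hmoment]
    exact ⟨fun ht => by linarith [h1 ht], fun ht => by linarith [h2 ht]⟩
  obtain ⟨I, E, hE, hev⟩ := exists_popped_estimate hα hpos hw hL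
  set D := ∑ n, 2 * |(1 - Real.cos (α n)) / Real.sin (α n)| with hD
  have hD0 : 0 ≤ D := Finset.sum_nonneg fun n _ => by positivity
  -- The first η bounds the error E of the area estimate, the term (1/3) D η the change of the
  -- moment from y to F y, and 2K converts ‖y‖ to |t|. Together they must stay below the constant
  -- (-t₀ - ‖y₀‖)/3 of the main term.
  obtain ⟨η, hη, hη2, hηD⟩ : ∃ η : ℝ, 0 < η ∧ η ≤ 1 / 2 ∧
      (η + 1 / 3 * (D * η)) * (2 * K) < (-t₀ - ‖y₀‖) / 3 := by
    have h1 : Tendsto (fun η : ℝ => (η + 1 / 3 * (D * η)) * (2 * K)) (𝓝[>] 0) (𝓝 0) := by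
      have : Continuous fun η : ℝ => (η + 1 / 3 * (D * η)) * (2 * (K : ℝ)) := by fun_prop
      simpa using (this.tendsto 0).mono_left nhdsWithin_le_nhds
    have h2 := h1.eventually_lt_const (show (0 : ℝ) < (-t₀ - ‖y₀‖) / 3 by linarith)
    have h3 : ∀ᶠ η : ℝ in 𝓝[>] 0, η ∈ Set.Ioo (0 : ℝ) (1 / 2) :=
      Ioo_mem_nhdsGT (by norm_num)
    obtain ⟨η, h4, h5⟩ := (h2.and h3).exists
    exact ⟨η, h5.1, h5.2.le, h4⟩
  have hchart : Tendsto (fun X => (reducedChart α L X).1) (𝓝[reducedConfigSpace α L] flatState α L)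
      (𝓝[{z : Slice N | angleForm α z z z = 0}] 0) := by
    have h1 := (isGermIso_reducedChart hα hw hL).tendsto_toFun
    rw [nhdsWithin_prod_eq] at h1
    exact tendsto_fst.comp h1
  have hcone' := hchart.eventually h.mapsTo
  have hF' : ∀ᶠ X in 𝓝[reducedConfigSpace α L] flatState α L,
      ‖F (reducedChart α L X).1 - (reducedChart α L X).1‖ ≤ η * ‖(reducedChart α L X).1‖ := by
    have h1 := hF.isLittleO.def hη
    simp only [hF0, sub_zero, ContinuousLinearMap.coe_id', id_eq] at h1
    exact (hchart.mono_right nhdsWithin_le_nhds).eventually h1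
  have hE' : ∀ᶠ X in 𝓝[reducedConfigSpace α L] flatState α L, E X < η :=
    (hE.mono_left nhdsWithin_le_nhds).eventually_lt_const hη
  filter_upwards [hev, hcone', hF', hE', self_mem_nhdsWithin] with X ⟨hU, hDn, hI⟩ hc hd hEX hX
  set y := (reducedChart α L X).1 with hy
  have hy1 : y.1 = faceSlope α L X := sliceProj_faceSlope (hs 0) X
  have hyn : ‖faceSlope α L X‖ = ‖y‖ := by rw [← hy1]; rfl
  have hphi : v ⬝ᵥ ((heightsEquiv hN hs hL').symm ∘ Prod.map F id ∘ reducedChart α L) X =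
      (J (F y)).1 := by
    rw [← hTv]
    exact congrArg Prod.fst (hJ (F y, (reducedChart α L X).2))
  have hyF : ‖y‖ ≤ 2 * ‖F y‖ := by
    have h1 := norm_sub_norm_le y (F y)
    rw [norm_sub_rev] at h1
    nlinarith [norm_nonneg y]
  have hcF : slopeForm α (F y).1 (F y).1 = 0 := hc
  have hyJ : ‖y‖ ≤ 2 * K * |(J (F y)).1| := by
    have := hnorm _ hcF
    linarith
  have hest : |I X - 1 / 3 * discMoment α (F y).1| ≤
      (η + 1 / 3 * (D * η)) * (2 * K) * |(J (F y)).1| := by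
    have h1 : |discMoment α y.1 - discMoment α (F y).1| ≤ D * (η * ‖y‖) := by
      rw [discMoment_sub]
      refine (abs_discMoment_le α _).trans (mul_le_mul_of_nonneg_left ?_ hD0)
      rw [norm_sub_rev] at hd
      exact hd
    rw [← hy1] at hI
    have h2 : ‖y.1‖ = ‖y‖ := rfl
    rw [h2] at hI
    have h3 := mul_le_mul_of_nonneg_right hEX.le (norm_nonneg y)
    have h4 : |I X - 1 / 3 * discMoment α (F y).1| ≤ (η + 1 / 3 * (D * η)) * ‖y‖ := by
      rw [abs_le] at h1 hI ⊢
      constructor <;> linarith [h1.1, h1.2, hI.1, hI.2]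
    refine h4.trans ?_
    rw [mul_assoc]
    exact mul_le_mul_of_nonneg_left hyJ (by positivity)
  obtain ⟨hb1, hb2⟩ := hbounds (F y) hcF
  obtain ⟨s1, s2⟩ := sign_iff_of_abs_sub_le hηD hest hb1 hb2
  rw [hphi]
  refine ⟨hU.trans s1, hDn.trans s2, ?_⟩
  rw [unfolded_iff hα hw hL hX.1, ← norm_eq_zero, hyn, norm_eq_zero]
  constructor
  · intro h0
    rw [h0, hF0, map_zero]
    rfl
  · intro h0
    rw [h0, abs_zero, mul_zero] at hyJ
    exact norm_le_zero_iff.1 hyJ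

end DoubleCone

end Origami

end

/-! ### Assembly of the theorem -/

theorem theorem1 {N : ℕ} [NeZero N] (α L : Fin N → ℝ) (w : ℤ)
    (hα : ∀ n, 0 < |α n| ∧ |α n| < Real.pi)
    (hw : ∑ n, α n = 2 * Real.pi * (w : ℝ))
    (hL : ∀ n, 0 < L n) :
    -- nullity and signature of the quadratic form
    Module.finrank ℝ (Origami.stressForm α L).radical = 3 ∧
    (sigPos (Origami.stressForm α L) : ℤ) =
      ((Finset.univ.filter fun n => 0 < α n).card : ℤ) - 2 * w - 1 ∧
    (sigNeg (Origami.stressForm α L) : ℤ) =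
      ((Finset.univ.filter fun n => α n < 0).card : ℤ) + 2 * w - 1 ∧
    -- the germ of the whole configuration space: the factor `ℝ³` is the in-plane rigid motions
    (∃ (φ : Origami.Placement N → Origami.Heights N × EuclideanSpace ℝ (Fin 3))
       (ψ : Origami.Heights N × EuclideanSpace ℝ (Fin 3) → Origami.Placement N),
       Origami.IsGermIso (Origami.configSpace α L) (Origami.flatState α L)
         (Origami.nullCone (Origami.stressForm α L) ×ˢ Set.univ) 0 φ ψ) ∧
    -- the germ of the configuration space with in-plane rigid motions removed
    (∃ (φ : Origami.Placement N → Origami.Heights N)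
       (ψ : Origami.Heights N → Origami.Placement N),
       Origami.IsGermIso (Origami.reducedConfigSpace α L) (Origami.flatState α L)
         (Origami.nullCone (Origami.stressForm α L)) 0 φ ψ ∧
       -- the ordinary case
       ((∀ n, 0 < α n) → w = 1 →
         (Finset.univ.filter fun i =>
           (Origami.stressMatrix_isHermitian α L).eigenvalues i < 0).card = 1 ∧
         ∃ (μ : ℝ) (v : Origami.Heights N)
           (T : Origami.Heights N ≃ₗ[ℝ]
             EuclideanSpace ℝ (Fin 3) × ℝ × EuclideanSpace ℝ (Fin (N - 3))),
           μ < 0 ∧ v ≠ 0 ∧ (Origami.stressMatrix α L).mulVec v = μ • v ∧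
           -- the null-cone is a double cone `|y| = |t|` (times `ℝ³`), with `t` the dot product
           -- with the eigenvector `v`
           (∀ h, (T h).2.1 = v ⬝ᵥ h) ∧
           (∀ h, Origami.stressForm α L h = ‖(T h).2.2‖ ^ 2 - (T h).2.1 ^ 2) ∧
           -- its two nappes are the popped up and the popped down configurations
           (∀ᶠ X in 𝓝[Origami.reducedConfigSpace α L] (Origami.flatState α L),
             (Origami.PoppedUp X ↔ 0 < v ⬝ᵥ φ X) ∧
             (Origami.PoppedDown X ↔ v ⬝ᵥ φ X < 0) ∧
             (Origami.Unfolded X ↔ v ⬝ᵥ φ X = 0)))) := by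
  have hs : ∀ n, Real.sin (α n) ≠ 0 := fun n => Origami.sin_ne_zero_of_abs (hα n)
  have hL' : ∀ n, L n ≠ 0 := fun n => (hL n).ne'
  have hN : 2 ≤ N := Origami.two_le_of_sum_eq hα hw
  obtain ⟨hrad, hsp, hsn⟩ := Origami.signature_stressForm hα hw hL'
  obtain ⟨F, G, hF0, hF, hFG⟩ := Origami.exists_slice_chart hα hw
  have hiso := Origami.isGermIso_nullCone hα hw hL hFG hN hs hL'
  refine ⟨hrad, hsp, hsn, ⟨_, _, (Origami.isGermIso_planarNormalize hL).trans
    (hiso.prodMap (Origami.IsGermIso.refl (Set.mem_univ 0)))⟩, _, _, hiso, ?_⟩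
  rintro hpos rfl
  have hpos' : ∀ n, 0 < α n ∧ α n < Real.pi := fun n =>
    ⟨hpos n, (abs_of_pos (hpos n)) ▸ (hα n).2⟩
  have hpf : (Finset.univ.filter fun n => 0 < α n) = Finset.univ :=
    Finset.filter_true_of_mem fun n _ => hpos n
  have hnf : (Finset.univ.filter fun n => α n < 0) = ∅ :=
    Finset.filter_false_of_mem fun n _ => (hpos n).not_gt
  rw [hpf, Finset.card_univ, Fintype.card_fin] at hsp
  rw [hnf, Finset.card_empty] at hsn
  -- As an integer N - 3 is a number of positive eigenvalues, hence nonnegative, so the truncated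
  -- subtraction is exact.
  have hsp' : sigPos (Origami.stressForm α L) = N - 3 := by omega
  have hsn' : sigNeg (Origami.stressForm α L) = 1 := by omega
  refine ⟨(Origami.card_eigenvalues_neg _).trans hsn', ?_⟩
  -- The pyramid has its hub at the bottom and so models the popped down side; requiring v to be
  -- negative on it fixes the sign of v.
  obtain ⟨μ, v, T, hμ, hv, hAv, hTv, hT, hv0⟩ := Origami.exists_lorentz_coordinates
    (Origami.stressMatrix_isHermitian α L) hrad hsp' hsn'
    (Origami.stressForm_pyramidHeights_neg hpos' hL')
  exact ⟨μ, v, T, hμ, hv, hAv, hTv, hT, Origami.eventually_popped_iff hα hpos' hw hL hF0 hF hFG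
    hN hs hL' T hTv hT hv0⟩
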